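/- Setting. A Defender chooses $d\in\mathcal D$, an Attacker observes $d$ and chooses $a\in\mathcal A$, and then an outcome $\theta\in\Theta$ occurs. Each of $\mathcal D,\mathcal A,\Theta$ is either discrete (a non-empty countable set, with counting measure and the 0–1 metric) or an interval in $\mathbb R^n$ (a product of nondegenerate real intervals, bounded or not, with Lebesgue measure and the Euclidean metric); the reference measures are written $\mathrm dd,\mathrm da,\mathrm d\theta$. The Defender has a utility $u_D(d,\theta)$ and conditional densities $p_D(\theta\mid d,a)$. Her uncertainty about the Attacker is given by random utilities $U_A^\omega(a,\theta)$ and random conditional densities $P_A^\omega(\theta\mid d,a)$ on a probability space $(\Omega,P)$ (all measurable). Let $\Psi_A^\omega(d,a)=\int U_A^\omega(a,\theta)P_A^\omega(\theta\mid d,a)\,\mathrm d\theta$, let $A^*(d)^\omega$ be a (jointly measurable) random optimal attack, i.e. for each $d$, almost surely $A^*(d)^\omega\in\arg\max_a\Psi_A^\omega(d,a)$, and let $p_D(\cdot\mid d)$ be the law of $A^*(d)$ under $P$ (so $p_D(a\mid d)=P[A^*(d)=a]$ in the discrete case). Put $\psi_D(d)=\iint u_D(d,\theta)\,p_D(\theta\mid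 d,a)\,p_D(a\mid d)\,\mathrm d\theta\,\mathrm da$; the ARA solution is $d^*_{\rm ARA}=\arg\max_d\psi_D(d)$. Let $g_D(d'\mid d)$ and $g_A(a'\mid a)$ be symmetric proposal densities. Algorithm. Outer loop: from $(d,a,\theta)$ propose $\tilde d\sim g_D(\cdot\mid d)$, $\tilde a\sim p_D(\cdot\mid\tilde d)$, $\tilde\theta\sim p_D(\cdot\mid\tilde d,\tilde a)$, and accept with probability $\min\{1,u_D(\tilde d,\tilde\theta)/u_D(d,\theta)\}$, otherwise stay; it is started from any $d^{(0)}$ with $a^{(0)}\sim p_D(\cdot\mid d^{(0)})$, $\theta^{(0)}\sim p_D(\cdot\mid d^{(0)},a^{(0)})$. Inner sampler for a defense $d$: draw $\omega\sim P$, start from some $a^{(0)}$ with $\theta^{(0)}\sim P_A^\omega(\cdot\mid d,a^{(0)})$, and run $M$ iterations of: from $(a,\theta)$ propose $\tilde a\sim g_A(\cdot\mid a)$, $\tilde\theta\sim P_A^\omega(\cdot\mid d,\tilde a)$, accept with probability $\min\{1,U_A^\omega(\tilde a,\tilde\theta)/U_A^\omega(a,\theta)\}$; discard the first $K$ draws and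 return the sample mode of the $a$-components of the others. The sample mode with bandwidth $h>0$ is the (first) retained draw $x$ that maximizes the number of retained draws in the closed ball $B(x,h)$ divided by the reference measure of $B(x,h)$; on a discrete set with $h<1$ this is the most frequent value. Assume that $u_D$ and, for almost all $\omega$, $U_A^\omega$ are positive; that $p_D(\theta\mid d,a)$ and, for almost all $\omega$, $P_A^\omega(\theta\mid d,a)$ are positive; and that $u_D(d,\theta)p_D(\theta\mid d,a)p_D(a\mid d)$ is integrable in $(d,a,\theta)$ and, for each $d$ and almost all $\omega$, $U_A^\omega(a,\theta)P_A^\omega(\theta\mid d,a)$ is integrable in $(a,\theta)$. Then: (1) For each $d$ and almost all $\omega$, $\pi_A^\omega(a,\theta\mid d)\propto U_A^\omega(a,\theta)P_A^\omega(\theta\mid d,a)$ is a well-defined probability distribution and is stationary for the inner chain. (2) $\pi_D(d,a,\theta)\propto u_D(d,\theta)\,p_D(\theta\mid d,a)\,p_D(a\mid d)$ is a well-defined probability distribution and is stationary for the outer chain. If instead the attacks $\tilde a$ are drawn by the inner sampler with fixed finite $M$, $K$, $h$, $a^{(0)}$, whose output has a law $q(\cdot\mid\tilde d)$ (a Markov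 kernel), the same is true with $q(a\mid d)$ in place of $p_D(a\mid d)$, provided that $u_D(d,\theta)p_D(\theta\mid d,a)q(a\mid d)$ is integrable. Call $x$ a well-separated maximizer of a function $f$ if $f$ is continuous at $x$ and, for each $\varepsilon>0$, $f$ is bounded by a constant smaller than $f(x)$ on the set of points at distance at least $\varepsilon$ from $x$. (For a discrete set and the expected utilities here, this just means that $x$ is the unique maximizer.) (3) Let $g_A$ be irreducible (from each point, every set of positive reference measure is reached with positive probability in some number of steps), let $d\in\mathcal D$, and let $A^*(d)^\omega$ be almost surely a well-separated maximizer of $\Psi_A^\omega(d,\cdot)$. Then for almost all $\omega$ and each $\varepsilon>0$ there is $h_0>0$ such that for all $0<h<h_0$ and all $a^{(0)}$, $K$, almost surely the sample mode with bandwidth $h$ of the inner draws is within $\varepsilon$ of $A^*(d)^\omega$ for all large $M$. Moreover, for all $a^{(0)}$, $K$ there are bandwidths $h_M>0$, $h_M\to0$, for which the law of the attack returned by the inner sampler converges weakly to $p_D(\cdot\mid d)$ as $M\to\infty$. (4) Let $g_D$ be irreducible and let $d^*_{\rm ARA}$ be a well-separated maximizer of $\psi_D$. Then for each $\varepsilon>0$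 there is $h_0>0$ such that for all $0<h<h_0$ and all $d^{(0)}$, $R$, almost surely the sample mode with bandwidth $h$ of the outer draws $d^{(R+1)},\dots,d^{(N)}$ is within $\varepsilon$ of $d^*_{\rm ARA}$ for all large $N$. Moreover, for all $d^{(0)}$, $R$ there are bandwidths $h_N>0$, $h_N\to0$, for which the sample mode of these draws converges to $d^*_{\rm ARA}$ almost surely as $N\to\infty$. -/

import Mathlib

open MeasureTheory ProbabilityTheory Filter Topology
open scoped ENNReal BoundedContinuousFunction

noncomputable section

/-- `S`, with its reference measure `ν`, is either
* a discrete set: a countable set carrying the discrete (0-1) metric and counting measure, or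
* a (nondegenerate) interval in `ℝⁿ`: a product of `n` real intervals with nonempty interiors, each
  open, closed, half-open, bounded or unbounded, carrying the Euclidean metric and Lebesgue
  measure.  (`e` is the inclusion of the interval in `ℝⁿ`.) -/
class IsDiscreteOrInterval {S : Type*} [MetricSpace S] [MeasurableSpace S] [BorelSpace S]
    (ν : Measure S) : Prop where
  discrete_or_interval :
    (Countable S ∧ (∀ x y : S, x ≠ y → dist x y = 1) ∧ ν = Measure.count) ∨
    (∃ (n : ℕ) (I : Fin n → Set ℝ) (e : S → EuclideanSpace ℝ (Fin n)),
      (∀ i, (I i).OrdConnected ∧ (interior (I i)).Nonempty) ∧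
      Isometry e ∧ Set.range e = {x | ∀ i, x i ∈ I i} ∧ ν = Measure.comap e volume)

instance IsDiscreteOrInterval.sigmaFinite {S : Type*} [MetricSpace S] [MeasurableSpace S]
    [BorelSpace S] (ν : Measure S) [h : IsDiscreteOrInterval ν] : SigmaFinite ν := by
  rcases h.discrete_or_interval with ⟨_, _, rfl⟩ | ⟨n, I, e, hI, he, hr, rfl⟩
  · infer_instance
  · have hm : MeasurableSet (Set.range e) := by
      rw [hr, Set.ofPred_forall]
      exact MeasurableSet.iInter fun i =>
        (hI i).1.measurableSet.preimage (by fun_prop)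
    have hemb : MeasurableEmbedding e := he.isEmbedding.measurableEmbedding hm
    have : SigmaFinite ((Measure.comap e volume).map e) := by
      rw [hemb.map_comap]; infer_instance
    exact SigmaFinite.of_map _ hemb.measurable.aemeasurable this

/-- A (jointly measurable) conditional probability density `p (y | x)` with respect to `ν`. -/
structure CondDensity (X : Type*) {Y : Type*} [MeasurableSpace X] [MeasurableSpace Y]
    (ν : Measure Y) where
  /-- `p x y` is the density `p (y | x)` -/
  p : X → Y → ℝ
  measurable_p : Measurable (Function.uncurry p)
  nonneg : ∀ x y, 0 ≤ p x y
  lintegral_eq_one : ∀ x, ∫⁻ y, ENNReal.ofReal (p x y) ∂ν = 1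

namespace CondDensity

variable {X Y : Type*} [MeasurableSpace X] [MeasurableSpace Y] {ν : Measure Y}

/-- The Markov kernel `x ↦ p (y | x) ν(dy)`. -/
def kernel [SFinite ν] (f : CondDensity X ν) : Kernel X Y :=
  (Kernel.const X ν).withDensity fun x y => ENNReal.ofReal (f.p x y)

lemma measurable_ofReal (f : CondDensity X ν) :
    Measurable (Function.uncurry fun x y => ENNReal.ofReal (f.p x y)) :=
  ENNReal.measurable_ofReal.comp f.measurable_p

instance [SFinite ν] (f : CondDensity X ν) : IsMarkovKernel f.kernel := by
  refine ⟨fun x => ⟨?_⟩⟩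
  rw [kernel, Kernel.withDensity_apply' _ f.measurable_ofReal]
  simpa using f.lintegral_eq_one x

/-- The proposal density is symmetric: `g (x' | x) = g (x | x')`. -/
def IsSymmetric (g : CondDensity Y ν) : Prop := ∀ x x', g.p x x' = g.p x' x

end CondDensity

section MetropolisHastings

variable {S : Type*} [MeasurableSpace S]

/-- One step of a Metropolis-Hastings type chain: from the state `s`, propose `s' ∼ Q s`; with
probability `α s s'` move to `s'`, otherwise stay at `s`. -/
def mhKernel (Q : Kernel S S) [IsMarkovKernel Q] (α : S → S → ℝ≥0∞) : Kernel S S :=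
  Q.withDensity α + (Kernel.id).withDensity fun s _ => ∫⁻ s', (1 - α s s') ∂(Q s)

lemma isMarkovKernel_mhKernel (Q : Kernel S S) [IsMarkovKernel Q] (α : S → S → ℝ≥0∞)
    (hα : Measurable (Function.uncurry α)) (h1 : ∀ s s', α s s' ≤ 1) :
    IsMarkovKernel (mhKernel Q α) := by
  have hr : Measurable (Function.uncurry fun (s : S) (_ : S) => ∫⁻ s', (1 - α s s') ∂(Q s)) := by
    have : Measurable fun s => ∫⁻ s', (1 - α s s') ∂(Q s) :=
      Measurable.lintegral_kernel_prod_right (f := fun s s' => 1 - α s s')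
        (measurable_const.sub hα)
    exact this.comp measurable_fst
  refine ⟨fun s => ⟨?_⟩⟩
  rw [mhKernel, _root_.add_apply, Measure.add_apply, Kernel.withDensity_apply' _ hα,
    Kernel.withDensity_apply' _ hr, Kernel.id_apply]
  simp only [Measure.restrict_univ, lintegral_const, measure_univ, mul_one]
  have hs : Measurable (α s) := hα.comp measurable_prodMk_left
  rw [← lintegral_add_left hs]
  simp [add_tsub_cancel_of_le (h1 s _)]

/-- Law of the whole trajectory `s⁽⁰⁾, s⁽¹⁾, …` of the homogeneous Markov chain with initial law
`μ₀` and transition kernel `κ`. -/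
def chainLaw (μ₀ : Measure S) (κ : Kernel S S) [IsMarkovKernel κ] : Measure (ℕ → S) :=
  Kernel.trajMeasure (X := fun _ => S) μ₀ fun n =>
    κ.comap (fun x : (i : Finset.Iic n) → S => x ⟨n, Finset.mem_Iic.2 le_rfl⟩)
      (measurable_pi_apply _)

/-- The probability measure proportional to `m` (for `0 < m univ < ∞`). -/
def normalized (m : Measure S) : Measure S := (m Set.univ)⁻¹ • m

end MetropolisHastings

section APS

variable {X Y : Type*} [MeasurableSpace X] [MeasurableSpace Y]

/-- Given a decision `x`, draw `y ∼ L x`; the result is the pair `(x, y)`. -/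
def drawFrom (L : Kernel X Y) : Kernel X (X × Y) := Kernel.id ×ₖ L

instance (L : Kernel X Y) [IsMarkovKernel L] : IsMarkovKernel (drawFrom L) := by
  unfold drawFrom; infer_instance

/-- Candidate of the augmented probability simulation (APS) sampler at the state `(x, y)`:
`x' ∼ G (· | x)`, then `y' ∼ L (· | x')`. -/
def apsProposal (G : Kernel X X) (L : Kernel X Y) : Kernel (X × Y) (X × Y) :=
  (drawFrom L ∘ₖ G).comap Prod.fst measurable_fst

instance (G : Kernel X X) [IsMarkovKernel G] (L : Kernel X Y) [IsMarkovKernel L] :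
    IsMarkovKernel (apsProposal G L) := by
  unfold apsProposal; infer_instance

/-- Acceptance probability `min {1, u(x', y') / u(x, y)}`. -/
def apsAcceptance (u : X × Y → ℝ) (s s' : X × Y) : ℝ≥0∞ := ENNReal.ofReal (min 1 (u s' / u s))

/-- One iteration of the APS Metropolis-Hastings loop. -/
def apsKernel (G : Kernel X X) [IsMarkovKernel G] (L : Kernel X Y) [IsMarkovKernel L]
    (u : X × Y → ℝ) (_hu : Measurable u) : Kernel (X × Y) (X × Y) :=
  mhKernel (apsProposal G L) (apsAcceptance u)

instance (G : Kernel X X) [IsMarkovKernel G] (L : Kernel X Y) [IsMarkovKernel L]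
    (u : X × Y → ℝ) (hu : Measurable u) : IsMarkovKernel (apsKernel G L u hu) := by
  refine isMarkovKernel_mhKernel _ _ ?_ fun s s' => ?_
  · exact ENNReal.measurable_ofReal.comp
      (measurable_const.min ((hu.comp measurable_snd).div (hu.comp measurable_fst)))
  · exact ENNReal.ofReal_le_one.2 (min_le_left _ _)

/-- Law of the trajectory of the APS sampler started from the decision `x₀`
(with `y⁽⁰⁾ ∼ L (· | x₀)`). -/
def apsRun (G : Kernel X X) [IsMarkovKernel G] (L : Kernel X Y) [IsMarkovKernel L]
    (u : X × Y → ℝ) (hu : Measurable u) (x₀ : X) : Measure (ℕ → X × Y) :=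
  chainLaw (drawFrom L x₀) (apsKernel G L u hu)

end APS

section Mode

variable {S : Type*} [MetricSpace S] [MeasurableSpace S]

/-- Density estimate at the draw `z i`, from the draws `z j`, `K < j ≤ M`: (up to the factor
`1 / (M - K)`) the fraction of these draws at distance at most `h` of `z i`, relative to
the reference measure of that window.  On a discrete set and for `h < 1` it is the
frequency of the value `z i`. -/
def densityScore (ν : Measure S) (h : ℝ) (K M : ℕ) (z : ℕ → S) (i : ℕ) : ℝ≥0∞ :=
  (((Finset.Ioc K M).filter fun j => dist (z j) (z i) ≤ h).card : ℝ≥0∞) /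
    ν (Metric.closedBall (z i) h)

/-- Sample mode with bandwidth `h` of `z (K + 1), …, z M` (the first `K` draws are
discarded): the first of these draws at which the density estimate is largest.  On a
discrete set and for `h < 1`, it is the most frequent value (the value which appears first in case
of ties). -/
def sampleMode (ν : Measure S) (h : ℝ) (K M : ℕ) (z : ℕ → S) : S :=
  z (sInf {i | i ∈ Finset.Ioc K M ∧
    ∀ j ∈ Finset.Ioc K M, densityScore ν h K M z j ≤ densityScore ν h K M z i})

/-- `x` is the unique maximizer of `f`, `f` is continuous at `x`, and `x` is well separated: away
from `x`, `f` stays below a constant smaller than `f x`.  (On a discrete set, for `f` positive and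
summable, this just says that `x` is the unique maximizer.  So it does for a continuous positive
`f` on a compact interval.) -/
def IsWellSeparatedArgmax (f : S → ℝ≥0∞) (x : S) : Prop :=
  ContinuousAt f x ∧ ∀ ε > 0, ∃ c < f x, ∀ y, ε ≤ dist y x → f y ≤ c

end Mode

section ARA

variable {D A Θ Ω : Type*} [MeasurableSpace D] [MeasurableSpace A] [MeasurableSpace Θ]
  [MeasurableSpace Ω]

/-! ### The Attacker's problem, for utility `u` and outcome density `p` (given `d`) -/

/-- Expected utility of the attack `a`: `∫ u(a,θ) p(θ | a) dθ`. -/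
def attackerExpectedUtility (νΘ : Measure Θ) (u p : A → Θ → ℝ) (a : A) : ℝ≥0∞ :=
  ∫⁻ θ, ENNReal.ofReal (u a θ * p a θ) ∂νΘ

/-- The Attacker's augmented distribution `π_A(a,θ) ∝ u(a,θ) p(θ | a)`. -/
def attackerTarget (νA : Measure A) (νΘ : Measure Θ) (u p : A → Θ → ℝ) : Measure (A × Θ) :=
  normalized ((νA.prod νΘ).withDensity fun s => ENNReal.ofReal (u s.1 s.2 * p s.1 s.2))

/-! ### The inner sampler -/

/-- For the type `ω` and the defense `d`, the kernel `a ↦ P_A^ω(θ | d, a) dθ`. -/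
def attackerOutcomeKernel {νΘ : Measure Θ} [SFinite νΘ] (PA : CondDensity (Ω × D × A) νΘ)
    (ω : Ω) (d : D) : Kernel A Θ :=
  PA.kernel.comap (fun a => (ω, d, a)) (by fun_prop)

instance {νΘ : Measure Θ} [SFinite νΘ] (PA : CondDensity (Ω × D × A) νΘ) (ω : Ω) (d : D) :
    IsMarkovKernel (attackerOutcomeKernel PA ω d) := by
  unfold attackerOutcomeKernel; infer_instance

/-- One iteration of the inner APS loop for the sampled utility `U_A^ω` and the sampled
probabilities `P_A^ω`: `a' ∼ g_A(· | a)`, `θ' ∼ P_A^ω(· | d, a')`, accepted with probability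
`min {1, U_A^ω(a', θ') / U_A^ω(a, θ)}`. -/
def innerKernel {νA : Measure A} {νΘ : Measure Θ} [SFinite νA] [SFinite νΘ]
    (gA : CondDensity A νA) (PA : CondDensity (Ω × D × A) νΘ)
    (UA : Ω → A × Θ → ℝ) (hUA : Measurable (Function.uncurry UA)) (ω : Ω) (d : D) :
    Kernel (A × Θ) (A × Θ) :=
  apsKernel gA.kernel (attackerOutcomeKernel PA ω d) (UA ω) (hUA.comp measurable_prodMk_left)

/-- Law of the draws `(a⁽ⁱ⁾, θ⁽ⁱ⁾)` of the inner APS loop, started from the attack `a₀`. -/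
def innerRun {νA : Measure A} {νΘ : Measure Θ} [SFinite νA] [SFinite νΘ]
    (gA : CondDensity A νA) (PA : CondDensity (Ω × D × A) νΘ)
    (UA : Ω → A × Θ → ℝ) (hUA : Measurable (Function.uncurry UA)) (ω : Ω) (d : D) (a₀ : A) :
    Measure (ℕ → A × Θ) :=
  apsRun gA.kernel (attackerOutcomeKernel PA ω d) (UA ω) (hUA.comp measurable_prodMk_left) a₀

/-- Law of the attack returned by the inner sampler for the defense `d`: draw the Attacker's type
`ω ∼ P`, which gives `u_A = U_A^ω` and `p_A = P_A^ω`, run `M` iterations of the inner loop from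
`a₀`, discard the first `K` draws and return the sample mode of the others. -/
def sampleAttack [MetricSpace A] {νA : Measure A} {νΘ : Measure Θ} [SFinite νA] [SFinite νΘ]
    (P : Measure Ω) (gA : CondDensity A νA) (PA : CondDensity (Ω × D × A) νΘ)
    (UA : Ω → A × Θ → ℝ) (hUA : Measurable (Function.uncurry UA)) (d : D) (a₀ : A) (h : ℝ)
    (K M : ℕ) : Measure A :=
  P.bind fun ω => (innerRun gA PA UA hUA ω d a₀).map fun z =>
    sampleMode νA h K M fun i => (z i).1

/-! ### The Defender's problem -/

/-- `p_D(a | d) = P (A*(d) = a)`, that is, `p_D(· | d)` is the law of the random optimal attack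
`A*(d)`, as a Markov kernel in `d`. -/
def attackDist (P : Measure Ω) [SFinite P] (Astar : D → Ω → A)
    (hA : Measurable (Function.uncurry Astar)) : Kernel D A where
  toFun d := P.map (Astar d)
  measurable' := by
    have h : (fun d => P.map (Astar d)) =
        fun d => (P.map (Prod.mk d)).map (Function.uncurry Astar) := by
      funext d
      rw [Measure.map_map hA measurable_prodMk_left]
      rfl
    rw [h]
    exact (Measure.measurable_map _ hA).comp Measurable.map_prodMk_left

instance (P : Measure Ω) [IsProbabilityMeasure P] (Astar : D → Ω → A)
    (hA : Measurable (Function.uncurry Astar)) : IsMarkovKernel (attackDist P Astar hA) :=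
  ⟨fun _ => Measure.isProbabilityMeasure_map (hA.comp measurable_prodMk_left).aemeasurable⟩

/-- Expected utility of the defense `d` if attacks have the distribution `q (a | d)`:
`ψ_D(d) = ∫∫ u_D(d,θ) p_D(θ | d,a) q(a | d) da dθ`. -/
def defenderExpectedUtility {νΘ : Measure Θ} (uD : D × Θ → ℝ) (pD : CondDensity (D × A) νΘ)
    (q : Kernel D A) (d : D) : ℝ≥0∞ :=
  ∫⁻ a, ∫⁻ θ, ENNReal.ofReal (uD (d, θ) * pD.p (d, a) θ) ∂νΘ ∂(q d)

/-- The measure `q(a | d) dd da dθ` on the space of triples `(d, a, θ)`. -/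
def tripleMeasure (νD : Measure D) (νΘ : Measure Θ) [SFinite νΘ] (q : Kernel D A) :
    Measure (D × A × Θ) :=
  νD ⊗ₘ (q ×ₖ Kernel.const D νΘ)

/-- The Defender's augmented distribution `π_D(d,a,θ) ∝ u_D(d,θ) p_D(θ | d,a) q(a | d)`. -/
def defenderTarget (νD : Measure D) {νΘ : Measure Θ} [SFinite νΘ] (uD : D × Θ → ℝ)
    (pD : CondDensity (D × A) νΘ) (q : Kernel D A) : Measure (D × A × Θ) :=
  normalized ((tripleMeasure νD νΘ q).withDensity fun s =>
    ENNReal.ofReal (uD (s.1, s.2.2) * pD.p (s.1, s.2.1) s.2.2))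

/-! ### The nested sampler -/

/-- One iteration of the outer APS loop, on triples `(d, a, θ)`, when the attack sampler returns
for the defense `d` an attack of law `q (· | d)`: `d' ∼ g_D(· | d)`, `a' ∼ q(· | d')`,
`θ' ∼ p_D(· | d', a')`, accepted with probability `min {1, u_D(d', θ') / u_D(d, θ)}`. -/
def outerKernel {νD : Measure D} {νΘ : Measure Θ} [SFinite νD] [SFinite νΘ]
    (gD : CondDensity D νD) (pD : CondDensity (D × A) νΘ) (uD : D × Θ → ℝ) (huD : Measurable uD)
    (q : Kernel D A) [IsMarkovKernel q] : Kernel (D × A × Θ) (D × A × Θ) :=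
  apsKernel gD.kernel (q ⊗ₖ pD.kernel) (fun s => uD (s.1, s.2.2)) (huD.comp (by fun_prop))

/-- Law of the draws `(d⁽ⁱ⁾, a⁽ⁱ⁾, θ⁽ⁱ⁾)` of the outer APS loop, started from the defense `d₀`,
`a⁽⁰⁾ ∼ q(· | d₀)`, `θ⁽⁰⁾ ∼ p_D(· | d₀, a⁽⁰⁾)`. -/
def outerRun {νD : Measure D} {νΘ : Measure Θ} [SFinite νD] [SFinite νΘ]
    (gD : CondDensity D νD) (pD : CondDensity (D × A) νΘ) (uD : D × Θ → ℝ) (huD : Measurable uD)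
    (q : Kernel D A) [IsMarkovKernel q] (d₀ : D) : Measure (ℕ → D × A × Θ) :=
  apsRun gD.kernel (q ⊗ₖ pD.kernel) (fun s => uD (s.1, s.2.2)) (huD.comp (by fun_prop)) d₀

end ARA

end

/-! Both loops are the same Metropolis-Hastings chain on pairs s = (x, y): propose x' from a
symmetric density g and y' from a probability kernel L x', accept with probability min(1, u(x', y')
/ u(x, y)). In the inner loop y = θ, in the outer loop y = (a, θ). Against two copies of ν ⊗ₘ L the
flow of accepted moves from s to t has density g(x, x') min(u(s), u(t)), which is symmetric; hence u
· (ν ⊗ₘ L) is reversible (`isReversible_apsKernel`), and integrability lets it be normalized. Its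
x-marginal has density proportional to the expected utility ∫ u(x, y) L(x, dy), so the mode of the
draws of x estimates the optimal decision.

Consistency rests on a law of large numbers from every starting point. For a shift-invariant event E
of trajectories, the function s ↦ P_s(E) is harmonic, and along the chain it converges to the
indicator of E by martingale convergence; stationarity then forces it to be 0 or 1 almost
everywhere. Irreducibility of g spreads the value 1 from one state to almost all states
(`ae_eq_one_of_isHarmonic`), so the stationary shift is ergodic and Birkhoff's theorem applies.
Failure of convergence of the frequencies is itself an invariant event, null from almost every
start. Each state is left with positive probability, by a move whose law is absolutely continuous,
so the event is null from every start (`eq_zero_of_isHarmonic`).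

At a fixed bandwidth h, the frequencies of the cells of one countable partition of mesh δ bound
those of all windows simultaneously, at the price of enlarging the radius to h + δ. By convexity of
the box, the volumes of windows of radii h + δ and h - δ have ratio close to 1 uniformly in the
centre. Hence far from a well-separated maximizer every density estimate is eventually smaller than
at any draw very near it (`exists_forall_eventually_dist_sampleMode_lt`). A diagonal argument with
Borel-Cantelli (`exists_diagonal_ae_tendsto`) lets the bandwidth shrink along the run. For the
attacks it is applied on the joint space of the type and the inner draws, where almost sure
convergence yields convergence in law. -/

noncomputable section

/-! ### Markov chains on path space: uniqueness of the law and the Markov property. -/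

section MarkovChain

variable {S : Type*}

/-- Append a point to a finite trajectory. -/
def snocPath (n : ℕ) (p : (Finset.Iic n → S) × S) : Finset.Iic (n + 1) → S := fun i =>
  if h : (i : ℕ) ≤ n then p.1 ⟨i, Finset.mem_Iic.2 h⟩ else p.2

lemma frestrictLe_succ (n : ℕ) (z : ℕ → S) :
    (Preorder.frestrictLe (n + 1) z : Finset.Iic (n + 1) → S) =
      snocPath n (Preorder.frestrictLe n z, z (n + 1)) := by
  ext ⟨i, hi⟩
  unfold snocPath
  have := Finset.mem_Iic.1 hi
  split_ifs with h
  · rfl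
  · obtain rfl : i = n + 1 := by simp at h; omega
    rfl

/-- The shift on trajectories. -/
def shiftPath (n : ℕ) (z : ℕ → S) : ℕ → S := fun i => z (n + i)

variable [MeasurableSpace S]

/-- The measure `m` on trajectories has the transition probabilities `κ`. -/
def IsMarkovChain (m : Measure (ℕ → S)) (κ : Kernel S S) : Prop :=
  ∀ (n : ℕ) (f : (Finset.Iic n → S) × S → ℝ≥0∞), Measurable f →
    ∫⁻ z, f (Preorder.frestrictLe n z, z (n + 1)) ∂m =
      ∫⁻ z, ∫⁻ s, f (Preorder.frestrictLe n z, s) ∂κ (z n) ∂m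

/-- The law of the trajectory, as a kernel in the starting point. -/
def pathKernel (κ : Kernel S S) [IsMarkovKernel κ] : Kernel S (ℕ → S) :=
  (Kernel.traj (X := fun _ => S) (fun n =>
    κ.comap (fun x : (i : Finset.Iic n) → S => x ⟨n, Finset.mem_Iic.2 le_rfl⟩)
      (measurable_pi_apply _)) 0).comap
    (MeasurableEquiv.piUnique (fun _ : Finset.Iic 0 => S)).symm (MeasurableEquiv.measurable _)

instance (κ : Kernel S S) [IsMarkovKernel κ] : IsMarkovKernel (pathKernel κ) := by
  unfold pathKernel; infer_instance

lemma chainLaw_eq_bind (μ : Measure S) (κ : Kernel S S) [IsMarkovKernel κ] :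
    chainLaw μ κ = μ.bind (pathKernel κ) := by
  refine Measure.ext fun s hs => ?_
  unfold chainLaw Kernel.trajMeasure pathKernel
  rw [Measure.bind_apply hs (Kernel.aemeasurable _), Measure.bind_apply hs (Kernel.aemeasurable _),
    lintegral_map (Kernel.measurable_coe _ hs) (MeasurableEquiv.measurable _)]
  rfl

instance (μ : Measure S) [IsProbabilityMeasure μ] (κ : Kernel S S) [IsMarkovKernel κ] :
    IsProbabilityMeasure (chainLaw μ κ) := by
  rw [chainLaw_eq_bind]; infer_instance

lemma pathKernel_apply (κ : Kernel S S) [IsMarkovKernel κ] (s : S) :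
    pathKernel κ s = chainLaw (Measure.dirac s) κ := by
  rw [chainLaw_eq_bind, Measure.dirac_bind (Kernel.measurable _)]

lemma isMarkovChain_chainLaw (μ : Measure S) [IsProbabilityMeasure μ] (κ : Kernel S S)
    [IsMarkovKernel κ] : IsMarkovChain (chainLaw μ κ) κ := by
  intro n f hf
  have h := Kernel.map_frestrictLe_trajMeasure_compProd_eq_map_trajMeasure
    (X := fun _ => S) (μ₀ := μ) (κ := fun n => κ.comap
      (fun x : (i : Finset.Iic n) → S => x ⟨n, Finset.mem_Iic.2 le_rfl⟩)
      (measurable_pi_apply _)) (a := n)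
  have h2 := congrArg (fun m => ∫⁻ p, f p ∂m) h
  beta_reduce at h2
  have : IsProbabilityMeasure (chainLaw μ κ) := inferInstance
  unfold chainLaw at this ⊢
  rw [lintegral_map hf (by fun_prop), Measure.lintegral_compProd hf,
    lintegral_map (by fun_prop) (by fun_prop)] at h2
  exact h2.symm

lemma IsMarkovChain.bind {κ : Kernel S S} [IsMarkovKernel κ] (μ : Measure S)
    {R : Kernel S (ℕ → S)} (hR : ∀ s, IsMarkovChain (R s) κ) : IsMarkovChain (μ.bind R) κ := by
  intro n f hf
  have h1 : Measurable fun z : ℕ → S => f (Preorder.frestrictLe n z, z (n + 1)) := by fun_prop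
  have h2 : Measurable fun z : ℕ → S => ∫⁻ s, f (Preorder.frestrictLe n z, s) ∂κ (z n) :=
    Measurable.lintegral_kernel_prod_right (κ := κ.comap (fun z : ℕ → S => z n) (by fun_prop))
      (f := fun z s => f (Preorder.frestrictLe n z, s)) (by fun_prop)
  rw [Measure.lintegral_bind (Kernel.aemeasurable _) h1.aemeasurable,
    Measure.lintegral_bind (Kernel.aemeasurable _) h2.aemeasurable]
  exact lintegral_congr fun s => hR s n f hf

lemma isMarkovChain_pathKernel (κ : Kernel S S) [IsMarkovKernel κ] (s : S) :
    IsMarkovChain (pathKernel κ s) κ := by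
  rw [pathKernel_apply]; exact isMarkovChain_chainLaw _ _

lemma measurable_snocPath (n : ℕ) : Measurable (snocPath (S := S) n) := by
  refine measurable_pi_lambda _ fun i => ?_
  unfold snocPath
  split_ifs <;> fun_prop

/-- Cylinders form a π-system generating the product σ-algebra, and any finite set of times lies in
an initial segment. -/
lemma ext_of_frestrictLe {m m' : Measure (ℕ → S)} [IsFiniteMeasure m]
    (h : ∀ n, m.map (Preorder.frestrictLe (π := fun _ => S) n) =
      m'.map (Preorder.frestrictLe (π := fun _ => S) n)) : m = m' := by
  have key : ∀ (I : Finset ℕ), m.map (I.restrict (π := fun _ => S)) =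
      m'.map (I.restrict (π := fun _ => S)) := by
    intro I
    have hI : I ⊆ Finset.Iic (I.sup id) := I.subset_Iic_sup_id
    have e : ∀ m : Measure (ℕ → S), m.map (I.restrict (π := fun _ => S)) =
        (m.map (Preorder.frestrictLe (π := fun _ => S) (I.sup id))).map
          (Finset.restrict₂ (π := fun _ => S) hI) := by
      intro m
      exact (Measure.map_map (f := Preorder.frestrictLe (π := fun _ => S) (I.sup id))
        (Finset.measurable_restrict₂ (X := fun _ => S) hI) (by fun_prop)).symm
    rw [e, e, h]
  refine ext_of_generate_finite (measurableCylinders fun _ : ℕ => S)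
    generateFrom_measurableCylinders.symm isPiSystem_measurableCylinders ?_ ?_
  · intro s hs
    obtain ⟨I, C, hC, rfl⟩ := (mem_measurableCylinders s).1 hs
    have := congrArg (fun m => m C) (key I)
    beta_reduce at this
    rwa [Measure.map_apply (Finset.measurable_restrict I) hC,
      Measure.map_apply (Finset.measurable_restrict I) hC] at this
  · have := congrArg (fun m => m Set.univ) (key ∅)
    simpa [Measure.map_apply, Finset.measurable_restrict] using this

/-- Tested on indicators, the transition identity determines the law of one more coordinate from the
law of the preceding ones. Shifted or conditioned trajectories are identified through this
uniqueness. -/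
lemma IsMarkovChain.ext {κ : Kernel S S} [IsMarkovKernel κ] {m m' : Measure (ℕ → S)}
    [IsFiniteMeasure m] (hm : IsMarkovChain m κ) (hm' : IsMarkovChain m' κ)
    (h0 : m.map (fun z => z 0) = m'.map (fun z => z 0)) : m = m' := by
  refine ext_of_frestrictLe fun n => ?_
  induction n with
  | zero =>
    have : (Preorder.frestrictLe (π := fun _ => S) 0) =
        (fun s _ => s) ∘ (fun z : ℕ → S => z 0) := by
      ext z ⟨i, hi⟩
      obtain rfl : i = 0 := by simpa using hi
      rfl
    rw [this, ← Measure.map_map (by fun_prop) (by fun_prop), h0,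
      Measure.map_map (by fun_prop) (by fun_prop)]
  | succ n ih =>
    have key : ∀ m : Measure (ℕ → S), IsMarkovChain m κ → ∀ C, MeasurableSet C →
        m.map (Preorder.frestrictLe (π := fun _ => S) (n + 1)) C =
          ∫⁻ y, ∫⁻ s, C.indicator 1 (snocPath n (y, s)) ∂κ (y ⟨n, by simp⟩)
            ∂m.map (Preorder.frestrictLe (π := fun _ => S) n) := by
      intro m hm C hC
      have hf : Measurable fun p => C.indicator (1 : (Finset.Iic (n + 1) → S) → ℝ≥0∞)
          (snocPath n p) := (measurable_one.indicator hC).comp (measurable_snocPath n)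
      rw [← lintegral_indicator_one hC, lintegral_map (measurable_one.indicator hC) (by fun_prop)]
      simp only [frestrictLe_succ]
      rw [hm n _ hf, lintegral_map _ (by fun_prop)]
      · rfl
      · exact Measurable.lintegral_kernel_prod_right
          (κ := κ.comap (fun y : Finset.Iic n → S => y ⟨n, by simp⟩) (by fun_prop))
          (f := fun y s => C.indicator 1 (snocPath n (y, s))) hf
    refine Measure.ext fun C hC => ?_
    rw [key m hm C hC, key m' hm' C hC, ih]

lemma map_zero_pathKernel (κ : Kernel S S) [IsMarkovKernel κ] (s : S) :
    (pathKernel κ s).map (fun z => z 0) = Measure.dirac s := by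
  have h : (fun z : ℕ → S => z 0) = (fun y : Finset.Iic 0 → S => y ⟨0, by simp⟩) ∘
    Preorder.frestrictLe (π := fun _ => S) 0 := rfl
  rw [h, ← Measure.map_map (by fun_prop) (by fun_prop)]
  unfold pathKernel
  rw [Kernel.comap_apply, Kernel.traj_map_frestrictLe_apply, Kernel.partialTraj_self,
    Kernel.id_apply, Measure.map_dirac' (by fun_prop)]
  rfl

lemma map_zero_bind_pathKernel (κ : Kernel S S) [IsMarkovKernel κ] (μ : Measure S) :
    (μ.bind (pathKernel κ)).map (fun z => z 0) = μ := by
  refine Measure.ext fun C hC => ?_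
  have hm : Measurable fun z : ℕ → S => z 0 := by fun_prop
  rw [Measure.map_apply hm hC, Measure.bind_apply (hm hC) (Kernel.aemeasurable _)]
  simp_rw [← Measure.map_apply hm hC, map_zero_pathKernel, Measure.dirac_apply' _ hC]
  exact lintegral_indicator_one hC

lemma IsMarkovChain.eq_bind {κ : Kernel S S} [IsMarkovKernel κ] {m : Measure (ℕ → S)}
    [IsFiniteMeasure m] (hm : IsMarkovChain m κ) :
    m = (m.map fun z => z 0).bind (pathKernel κ) :=
  hm.ext (IsMarkovChain.bind _ (isMarkovChain_pathKernel κ))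
    (map_zero_bind_pathKernel κ _).symm

@[fun_prop]
lemma measurable_shiftPath (n : ℕ) : Measurable (shiftPath (S := S) n) :=
  measurable_pi_lambda _ fun _ => measurable_pi_apply _

/-- The Markov property: conditionally on an event of the past, the future is a Markov chain. -/
lemma IsMarkovChain.restrict_map_shiftPath {κ : Kernel S S} [IsMarkovKernel κ]
    {m : Measure (ℕ → S)} (hm : IsMarkovChain m κ) (n : ℕ) {C : Set (Finset.Iic n → S)}
    (hC : MeasurableSet C) :
    IsMarkovChain ((m.restrict (Preorder.frestrictLe (π := fun _ => S) n ⁻¹' C)).map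
      (shiftPath n)) κ := by
  intro k f hf
  have hpre : MeasurableSet (Preorder.frestrictLe (π := fun _ => S) n ⁻¹' C) :=
    hC.preimage (by fun_prop)
  have h1 : Measurable fun z : ℕ → S => f (Preorder.frestrictLe k z, z (k + 1)) := by fun_prop
  have h2 : Measurable fun z : ℕ → S => ∫⁻ s, f (Preorder.frestrictLe k z, s) ∂κ (z k) :=
    Measurable.lintegral_kernel_prod_right (κ := κ.comap (fun z : ℕ → S => z k) (by fun_prop))
      (f := fun z s => f (Preorder.frestrictLe k z, s)) (by fun_prop)
  rw [lintegral_map h1 (by fun_prop), lintegral_map h2 (by fun_prop),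
    ← lintegral_indicator hpre, ← lintegral_indicator hpre]
  -- The coordinates 0, …, n carry the conditioning event and n, …, n + k are the start of the
  -- shifted path. Together they turn the claim into the transition identity of the original chain
  -- at time n + k.
  let r1 : (Finset.Iic (n + k) → S) → (Finset.Iic n → S) := fun y i =>
    y ⟨i, Finset.mem_Iic.2 ((Finset.mem_Iic.1 i.2).trans (Nat.le_add_right n k))⟩
  let r2 : (Finset.Iic (n + k) → S) → (Finset.Iic k → S) := fun y i =>
    y ⟨n + i, Finset.mem_Iic.2 (Nat.add_le_add_left (Finset.mem_Iic.1 i.2) n)⟩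
  have hr1 : Measurable r1 := measurable_pi_lambda _ fun _ => measurable_pi_apply _
  have hr2 : Measurable r2 := measurable_pi_lambda _ fun _ => measurable_pi_apply _
  have hg : Measurable fun p : (Finset.Iic (n + k) → S) × S =>
      (r1 ⁻¹' C).indicator (fun y => f (r2 y, p.2)) p.1 := by
    have : (fun p : (Finset.Iic (n + k) → S) × S =>
        (r1 ⁻¹' C).indicator (fun y => f (r2 y, p.2)) p.1) =
        ((fun p : (Finset.Iic (n + k) → S) × S => r1 p.1) ⁻¹' C).indicator
          (fun p => f (r2 p.1, p.2)) := by
      ext p; rfl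
    rw [this]
    exact (hf.comp ((hr2.comp measurable_fst).prodMk measurable_snd)).indicator
      (hC.preimage (hr1.comp measurable_fst))
  have key := hm (n + k) _ hg
  have hl : ∀ z : ℕ → S, (Preorder.frestrictLe (π := fun _ => S) n ⁻¹' C).indicator
      (fun z => f (Preorder.frestrictLe k (shiftPath n z), shiftPath n z (k + 1))) z =
      (r1 ⁻¹' C).indicator (fun y => f (r2 y, z (n + k + 1))) (Preorder.frestrictLe (n + k) z) := by
    intro z
    by_cases hz : r1 (Preorder.frestrictLe (π := fun _ => S) (n + k) z) ∈ C
    · rw [Set.indicator_of_mem (by exact hz), Set.indicator_of_mem (by exact hz)]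
      rfl
    · rw [Set.indicator_of_notMem (by exact hz), Set.indicator_of_notMem (by exact hz)]
  have hr : ∀ z : ℕ → S, (Preorder.frestrictLe (π := fun _ => S) n ⁻¹' C).indicator
      (fun z => ∫⁻ s, f (Preorder.frestrictLe k (shiftPath n z), s) ∂κ (shiftPath n z k)) z =
      ∫⁻ s, (r1 ⁻¹' C).indicator (fun y => f (r2 y, s)) (Preorder.frestrictLe (n + k) z)
        ∂κ (z (n + k)) := by
    intro z
    by_cases hz : r1 (Preorder.frestrictLe (π := fun _ => S) (n + k) z) ∈ C
    · rw [Set.indicator_of_mem (by exact hz)]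
      refine lintegral_congr fun s => ?_
      rw [Set.indicator_of_mem (by exact hz)]
      rfl
    · rw [Set.indicator_of_notMem (by exact hz)]
      simp_rw [Set.indicator_of_notMem (show Preorder.frestrictLe (π := fun _ => S) (n + k) z ∉
        r1 ⁻¹' C from hz)]
      simp
  simp_rw [hl, hr]
  exact key

/-- The conditioned, shifted chain is a mixture of the laws `pathKernel κ s` over its initial state
z n. This integrated form is what identifies conditional expectations later. -/
lemma IsMarkovChain.restrict_preimage_shiftPath {κ : Kernel S S} [IsMarkovKernel κ]
    {m : Measure (ℕ → S)} [IsFiniteMeasure m] (hm : IsMarkovChain m κ) (n : ℕ)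
    {C : Set (Finset.Iic n → S)} (hC : MeasurableSet C) {E : Set (ℕ → S)} (hE : MeasurableSet E) :
    m (shiftPath n ⁻¹' E ∩ Preorder.frestrictLe (π := fun _ => S) n ⁻¹' C) =
      ∫⁻ z in Preorder.frestrictLe (π := fun _ => S) n ⁻¹' C, pathKernel κ (z n) E ∂m := by
  have hM := (hm.restrict_map_shiftPath n hC).eq_bind
  have h := congrArg (fun m => m E) hM
  beta_reduce at h
  rw [Measure.map_apply (by fun_prop) hE, Measure.restrict_apply (hE.preimage (by fun_prop)),
    Measure.bind_apply hE (Kernel.aemeasurable _), Measure.map_map (by fun_prop) (by fun_prop),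
    lintegral_map (Kernel.measurable_coe _ hE) (by fun_prop)] at h
  exact h

/-- Both sides are Markov chains for κ with the same initial law, so uniqueness applies. -/
lemma chainLaw_map_shiftPath_one (μ : Measure S) [IsProbabilityMeasure μ] (κ : Kernel S S)
    [IsMarkovKernel κ] :
    (chainLaw μ κ).map (shiftPath 1) = chainLaw (μ.bind κ) κ := by
  have h1 := ((isMarkovChain_chainLaw μ κ).restrict_map_shiftPath 1 (C := Set.univ) .univ)
  rw [Set.preimage_univ, Measure.restrict_univ] at h1
  refine h1.ext (isMarkovChain_chainLaw _ _) ?_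
  rw [chainLaw_eq_bind (μ.bind κ), map_zero_bind_pathKernel,
    Measure.map_map (by fun_prop) (by fun_prop)]
  refine Measure.ext fun C hC => ?_
  have hm0 : Measurable fun z : ℕ → S => κ (z 0) C :=
    (Kernel.measurable_coe κ hC).comp (measurable_pi_apply 0)
  have h2 := isMarkovChain_chainLaw μ κ 0 (fun p => C.indicator 1 p.2)
    ((measurable_one.indicator hC).comp measurable_snd)
  rw [Measure.map_apply (by fun_prop) hC, ← lintegral_indicator_one (hC.preimage (by fun_prop))]
  refine Eq.trans h2 ?_
  simp_rw [lintegral_indicator_one hC]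
  rw [Measure.bind_apply hC (Kernel.aemeasurable _)]
  conv_rhs => rw [← map_zero_bind_pathKernel κ μ, ← chainLaw_eq_bind]
  rw [lintegral_map (Kernel.measurable_coe κ hC) (by fun_prop)]

end MarkovChain

/-! ### Birkhoff's ergodic theorem for visit frequencies, by a stopping-time covering argument. -/

section Birkhoff

variable {Z : Type*} [MeasurableSpace Z] {T : Z → Z}

/-- Number of visits to `B` before time `n`. -/
def visits (T : Z → Z) (B : Set Z) (n : ℕ) (z : Z) : ℝ :=
  birkhoffSum T (B.indicator 1) n z

omit [MeasurableSpace Z] in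
lemma visits_eq_sum (B : Set Z) (n : ℕ) (z : Z) :
    visits T B n z = ∑ i ∈ Finset.range n, B.indicator 1 (T^[i] z) := rfl

omit [MeasurableSpace Z] in
lemma visits_add (B : Set Z) (m n : ℕ) (z : Z) :
    visits T B (m + n) z = visits T B m z + visits T B n (T^[m] z) :=
  birkhoffSum_add _ _ _ _ _

omit [MeasurableSpace Z] in
lemma visits_nonneg (B : Set Z) (n : ℕ) (z : Z) : 0 ≤ visits T B n z := by
  rw [visits_eq_sum]
  exact Finset.sum_nonneg fun i _ =>
    Set.indicator_nonneg (f := (1 : Z → ℝ)) (fun _ _ => zero_le_one) (T^[i] z)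

omit [MeasurableSpace Z] in
lemma visits_one (B : Set Z) (z : Z) : visits T B 1 z = B.indicator 1 z :=
  birkhoffSum_one _ _ _

omit [MeasurableSpace Z] in
lemma visits_compl (B : Set Z) (n : ℕ) (z : Z) : visits T Bᶜ n z = n - visits T B n z := by
  have : ∀ y, (Bᶜ).indicator (1 : Z → ℝ) y = 1 - B.indicator 1 y := by
    intro y; by_cases h : y ∈ B <;> simp [h]
  simp [visits, birkhoffSum, this]

lemma measurable_visits (hT : Measurable T) {B : Set Z} (hB : MeasurableSet B) (n : ℕ) :
    Measurable (visits T B n) := by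
  change Measurable fun z => ∑ i ∈ Finset.range n, B.indicator (1 : Z → ℝ) (T^[i] z)
  exact Finset.measurable_sum _ fun i _ => (measurable_one.indicator hB).comp (hT.iterate i)

lemma integral_visits {μ : Measure Z} [IsProbabilityMeasure μ] (hT : MeasurePreserving T μ μ)
    {B : Set Z} (hB : MeasurableSet B) (n : ℕ) : ∫ z, visits T B n z ∂μ = n * μ.real B := by
  have hi : ∀ i, Integrable (fun z => B.indicator (1 : Z → ℝ) (T^[i] z)) μ := fun i =>
    (hT.iterate i).integrable_comp_of_integrable ((integrable_const (1 : ℝ)).indicator hB)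
  have : ∀ i, ∫ z, B.indicator (1 : Z → ℝ) (T^[i] z) ∂μ = μ.real B := by
    intro i
    have h1 : ∀ z, B.indicator (1 : Z → ℝ) (T^[i] z) = (T^[i] ⁻¹' B).indicator 1 z := fun _ => rfl
    simp_rw [h1]
    rw [integral_indicator_one (hB.preimage (hT.measurable.iterate i)), measureReal_def,
      measureReal_def, (hT.iterate i).measure_preimage hB.nullMeasurableSet]
  unfold visits birkhoffSum
  rw [integral_finsetSum _ fun i _ => hi i]
  simp [this]

omit [MeasurableSpace Z] in
/-- If the points from which no average over at most `R` steps reaches `c` are rewarded by `c`,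
all averages nearly reach `c`. -/
lemma le_visits_add_of_bad {B : Set Z} {c : ℝ} (hc : 0 ≤ c) (R : ℕ) {W : Set Z}
    (hW : ∀ z ∉ W, ∃ n, 0 < n ∧ n ≤ R ∧ c * n ≤ visits T B n z) (L : ℕ) (z : Z) :
    c * L ≤ visits T B L z + c * visits T W L z + c * R := by
  induction L using Nat.strong_induction_on generalizing z with
  | _ L ih =>
    -- With at most R steps left, the term c * R pays for all of them. Otherwise a point of W
    -- advances by one step, paid for by its own visit to W, and any other point jumps over a
    -- stretch whose average already reaches c.
    by_cases hL : L ≤ R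
    · have h1 := visits_nonneg (T := T) B L z
      have h2 := mul_nonneg hc (visits_nonneg (T := T) W L z)
      have h3 : c * L ≤ c * R := by gcongr
      linarith
    by_cases hz : z ∈ W
    · obtain ⟨k, rfl⟩ : ∃ k, L = 1 + k := ⟨L - 1, by omega⟩
      have := ih k (by omega) (T^[1] z)
      rw [visits_add, visits_add, visits_one W]
      have h1 := visits_nonneg (T := T) B 1 z
      simp only [Set.indicator_of_mem hz, Pi.one_apply]
      push_cast
      linarith
    · obtain ⟨n, hn0, hnR, hn⟩ := hW z hz
      obtain ⟨k, rfl⟩ : ∃ k, L = n + k := ⟨L - n, by omega⟩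
      have := ih k (by omega) (T^[n] z)
      rw [visits_add, visits_add]
      have h1 := mul_nonneg hc (visits_nonneg (T := T) W n z)
      push_cast
      linarith

/-- The points that need more than R steps to reach the average c form sets decreasing to a null
set. Integrating the covering inequality, with its error terms made negligible by L → ∞ and then R →
∞, gives the bound. -/
lemma le_measureReal_of_ae_exists_le_visits {μ : Measure Z} [IsProbabilityMeasure μ]
    (hT : MeasurePreserving T μ μ) {B : Set Z} (hB : MeasurableSet B) {c : ℝ} (hc : 0 ≤ c)
    (h : ∀ᵐ z ∂μ, ∃ n : ℕ, 0 < n ∧ c * n ≤ visits T B n z) : c ≤ μ.real B := by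
  let W : ℕ → Set Z := fun R => {z | ∀ n : ℕ, 0 < n → n ≤ R → visits T B n z < c * n}
  have hWm : ∀ R, MeasurableSet (W R) := by
    intro R
    simp only [W, Set.ofPred_forall]
    exact MeasurableSet.iInter fun n => MeasurableSet.iInter fun _ => MeasurableSet.iInter fun _ =>
      measurableSet_lt (measurable_visits hT.measurable hB n) measurable_const
  have hWanti : Antitone W := fun R R' hR z hz n h0 hn => hz n h0 (hn.trans hR)
  have hlim : Tendsto (fun R => μ.real (W R)) atTop (𝓝 0) := by
    have h1 := tendsto_measure_iInter_atTop (μ := μ) (fun R => (hWm R).nullMeasurableSet) hWanti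
      ⟨0, measure_ne_top _ _⟩
    have h2 : μ (⋂ R, W R) = 0 := by
      rw [← nonpos_iff_eq_zero, ← (show μ _ = 0 from h)]
      refine measure_mono fun z hz => ?_
      rintro ⟨n, hn0, hn⟩
      exact absurd (Set.mem_iInter.1 hz n n hn0 le_rfl) (not_lt.2 hn)
    rw [h2] at h1
    exact (ENNReal.tendsto_toReal ENNReal.zero_ne_top).comp h1
  have hR : ∀ R, c ≤ μ.real B + c * μ.real (W R) := by
    intro R
    have key : ∀ L : ℕ, c * L ≤ L * μ.real B + c * (L * μ.real (W R)) + c * R := by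
      intro L
      have hint : ∀ {B : Set Z}, MeasurableSet B → Integrable (visits T B L) μ := by
        intro B hB
        change Integrable (fun z => ∑ i ∈ Finset.range L, B.indicator (1 : Z → ℝ) (T^[i] z)) μ
        exact integrable_finsetSum _ fun i _ => (hT.iterate i).integrable_comp_of_integrable
          ((integrable_const (1 : ℝ)).indicator hB)
      have := integral_mono (μ := μ) (f := fun _ => c * L)
        (g := fun z => visits T B L z + c * visits T (W R) L z + c * R) (integrable_const _)
        (((hint hB).add ((hint (hWm R)).const_mul c)).add (integrable_const _))
        (fun z => le_visits_add_of_bad hc R (fun z hz => by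
          simp only [W, Set.mem_ofPred_eq] at hz
          push Not at hz
          exact hz) L z)
      rw [integral_add (f := fun z => visits T B L z + c * visits T (W R) L z)
          ((hint hB).add ((hint (hWm R)).const_mul c)) (integrable_const _),
        integral_add (hint hB) ((hint (hWm R)).const_mul c),
        integral_const_mul c (visits T (W R) L),
        integral_visits hT hB, integral_visits hT (hWm R)] at this
      simpa using this
    by_contra! hlt
    -- After division by L the boundary term c * R / L is negligible, so a long orbit contradicts
    -- `hlt`.
    obtain ⟨L, hL⟩ := exists_nat_gt (c * R / (c - (μ.real B + c * μ.real (W R))))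
    rw [div_lt_iff₀ (by linarith)] at hL
    have := key L
    nlinarith
  have := (hlim.const_mul c).const_add (μ.real B)
  simp only [mul_zero, add_zero] at this
  exact ge_of_tendsto' this hR

lemma Ergodic.ae_eventually_visits_lt {μ : Measure Z} [IsProbabilityMeasure μ]
    (hT : Ergodic T μ) {B : Set Z} (hB : MeasurableSet B) {c : ℝ} (hc : μ.real B < c) :
    ∀ᵐ z ∂μ, ∀ᶠ n : ℕ in atTop, visits T B n z < c * n := by
  -- The free additive constant C makes the set exactly invariant: one shift changes both the number
  -- of visits and c * n by a bounded amount only.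
  let U : Set Z := {z | ∃ C : ℕ, ∀ N : ℕ, ∃ n : ℕ, N ≤ n ∧ c * n ≤ visits T B n z + C}
  have hUm : MeasurableSet U := by
    simp only [U, Set.ofPred_exists, Set.ofPred_forall]
    refine MeasurableSet.iUnion fun C => MeasurableSet.iInter fun N => MeasurableSet.iUnion
      fun n => (MeasurableSet.const _).inter ?_
    exact measurableSet_le measurable_const
      ((measurable_visits hT.measurable hB n).add measurable_const)
  have hc0 : 0 < c := measureReal_nonneg.trans_lt hc
  have hUinv : T ⁻¹' U = U := by
    ext z
    have hs : ∀ n, visits T B (1 + n) z = B.indicator 1 z + visits T B n (T z) := by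
      intro n; rw [visits_add, visits_one]; rfl
    have h0 : 0 ≤ B.indicator (1 : Z → ℝ) z := Set.indicator_nonneg (fun _ _ => zero_le_one) _
    have h1 : B.indicator (1 : Z → ℝ) z ≤ 1 := Set.indicator_le_self' (fun _ _ => zero_le_one) _
    constructor
    · rintro ⟨C, hC⟩
      obtain ⟨k, hk⟩ := exists_nat_ge c
      refine ⟨C + k, fun N => ?_⟩
      obtain ⟨n, hn, h⟩ := hC N
      refine ⟨1 + n, by omega, ?_⟩
      rw [hs]
      push_cast
      linarith
    · rintro ⟨C, hC⟩
      refine ⟨C + 1, fun N => ?_⟩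
      obtain ⟨n, hn, h⟩ := hC (N + 1)
      obtain ⟨k, rfl⟩ : ∃ k, n = 1 + k := ⟨n - 1, by omega⟩
      refine ⟨k, by omega, ?_⟩
      rw [hs] at h
      push_cast at h ⊢
      linarith
  rcases hT.toPreErgodic.ae_mem_or_ae_notMem hUm hUinv with h | h
  · exfalso
    -- Lowering c to the midpoint gains n (c - μ(B)) / 2, which absorbs C for large n.
    have h1 : (c + μ.real B) / 2 ≤ μ.real B := by
      refine le_measureReal_of_ae_exists_le_visits hT.toMeasurePreserving hB
        (by have := measureReal_nonneg (μ := μ) (s := B); linarith) ?_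
      filter_upwards [h] with z hz
      obtain ⟨C, hC⟩ := hz
      obtain ⟨N, hN⟩ := exists_nat_gt (C / ((c - μ.real B) / 2))
      obtain ⟨n, hn, h⟩ := hC (N + 1)
      refine ⟨n, by omega, ?_⟩
      rw [div_lt_iff₀ (by linarith)] at hN
      have h2 : (N : ℝ) ≤ n := by exact_mod_cast (Nat.le_succ N).trans hn
      have h3 : (N : ℝ) * ((c - μ.real B) / 2) ≤ n * ((c - μ.real B) / 2) := by
        gcongr
      nlinarith
    linarith
  · filter_upwards [h] with z hz
    have : ¬ ∀ N : ℕ, ∃ n : ℕ, N ≤ n ∧ c * n ≤ visits T B n z + (0 : ℕ) := fun h' => hz ⟨0, h'⟩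
    push Not at this
    obtain ⟨N, hN⟩ := this
    filter_upwards [eventually_ge_atTop N] with n hn
    simpa using hN n hn

/-- Birkhoff's ergodic theorem for indicators. -/
theorem Ergodic.ae_tendsto_visits {μ : Measure Z} [IsProbabilityMeasure μ]
    (hT : Ergodic T μ) {B : Set Z} (hB : MeasurableSet B) :
    ∀ᵐ z ∂μ, Tendsto (fun n : ℕ => visits T B n z / n) atTop (𝓝 (μ.real B)) := by
  -- Applied to the complement, the upper bound becomes the lower bound for B. The slacks 1 / (k +
  -- 1) keep the exceptional sets countable in number.
  have up : ∀ {B : Set Z}, MeasurableSet B → ∀ᵐ z ∂μ, ∀ k : ℕ,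
      ∀ᶠ n : ℕ in atTop, visits T B n z < (μ.real B + 1 / (k + 1)) * n := fun hB =>
    ae_all_iff.2 fun k => hT.ae_eventually_visits_lt hB
      (by linarith [Nat.one_div_pos_of_nat (α := ℝ) (n := k)])
  filter_upwards [up hB, up hB.compl] with z h1 h2
  rw [Metric.tendsto_nhds]
  intro ε hε
  obtain ⟨k, hk⟩ := exists_nat_one_div_lt hε
  filter_upwards [h1 k, h2 k, eventually_gt_atTop 0] with n h1 h2 hn
  have hn' : (0 : ℝ) < n := by exact_mod_cast hn
  rw [visits_compl, probReal_compl_eq_one_sub hB] at h2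
  rw [Real.dist_eq, abs_sub_lt_iff]
  constructor
  · rw [sub_lt_iff_lt_add, div_lt_iff₀ hn']
    nlinarith
  · rw [sub_lt_comm, lt_div_iff₀ hn']
    nlinarith

end Birkhoff

/-! ### Ergodicity of the stationary chain and the law of large numbers from every start. -/

section ErgodicChain

variable {S : Type*} [MeasurableSpace S]

lemma iSup_piLE_eq : ⨆ n, (Filtration.piLE (X := fun _ : ℕ => S)) n = MeasurableSpace.pi := by
  refine le_antisymm (iSup_le fun n => Filtration.piLE.le n) ?_
  refine iSup_le fun n => le_trans ?_ (le_iSup _ n)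
  rw [Filtration.piLE_eq_comap_frestrictLe]
  have : (fun z : ℕ → S => z n) = (fun y : Finset.Iic n → S => y ⟨n, by simp⟩) ∘
    Preorder.frestrictLe (π := fun _ => S) n := rfl
  rw [this, ← MeasurableSpace.comap_comp]
  exact MeasurableSpace.comap_mono (measurable_pi_apply _).comap_le

omit [MeasurableSpace S] in
lemma preimage_shiftPath_eq {E : Set (ℕ → S)} (hE : shiftPath 1 ⁻¹' E = E) (n : ℕ) :
    shiftPath n ⁻¹' E = E := by
  induction n with
  | zero =>
    have : (shiftPath 0 : (ℕ → S) → ℕ → S) = id := by funext z i; simp [shiftPath]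
    rw [this, Set.preimage_id]
  | succ n ih =>
    have : (shiftPath (n + 1) : (ℕ → S) → ℕ → S) = shiftPath 1 ∘ shiftPath n := by
      funext z i; simp only [shiftPath, Function.comp]; congr 1; omega
    rw [this, Set.preimage_comp, hE, ih]

/-- Along a Markov chain, the conditional probability of an invariant event converges to its
indicator. -/
lemma IsMarkovChain.ae_tendsto_indicator {κ : Kernel S S} [IsMarkovKernel κ]
    {m : Measure (ℕ → S)} [IsProbabilityMeasure m] (hm : IsMarkovChain m κ) {E : Set (ℕ → S)}
    (hE : MeasurableSet E) (hinv : shiftPath 1 ⁻¹' E = E) :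
    ∀ᵐ z ∂m, Tendsto (fun n => (pathKernel κ (z n)).real E) atTop (𝓝 (E.indicator 1 z)) := by
  have hgm : StronglyMeasurable[⨆ n, (Filtration.piLE (X := fun _ : ℕ => S)) n]
      (E.indicator (1 : (ℕ → S) → ℝ)) := by
    rw [iSup_piLE_eq]
    exact (measurable_one.indicator hE).stronglyMeasurable
  have hint : Integrable (E.indicator (1 : (ℕ → S) → ℝ)) m :=
    (integrable_const (1 : ℝ)).indicator hE
  have hk : Measurable fun s => (pathKernel κ s).real E :=
    (Kernel.measurable_coe _ hE).ennreal_toReal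
  have hce : ∀ n, (fun z => (pathKernel κ (z n)).real E) =ᵐ[m]
      m[E.indicator (1 : (ℕ → S) → ℝ) | Filtration.piLE (X := fun _ : ℕ => S) n] := by
    intro n
    have hI : Integrable (fun z : ℕ → S => (pathKernel κ (z n)).real E) m :=
      Integrable.of_bound (hk.comp (measurable_pi_apply n)).aestronglyMeasurable 1
        (Eventually.of_forall fun z => by
          rw [Real.norm_of_nonneg measureReal_nonneg]; exact measureReal_le_one)
    refine ae_eq_condExp_of_forall_setIntegral_eq (Filtration.piLE.le n) hint
      (fun _ _ _ => hI.integrableOn) ?_ ?_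
    · intro s hs _
      have hs0 : MeasurableSet s := Filtration.piLE.le n s hs
      rw [Filtration.piLE_eq_comap_frestrictLe] at hs
      obtain ⟨C, hC, rfl⟩ := hs
      -- Being invariant, E is an event of the path after time n, so the Markov property computes
      -- its conditional probability given the first n + 1 states.
      have h1 := hm.restrict_preimage_shiftPath n hC hE
      rw [preimage_shiftPath_eq hinv] at h1
      rw [integral_indicator_one hE, measureReal_def, Measure.restrict_apply hE, h1,
        ← integral_toReal]
      · rfl
      · exact ((Kernel.measurable_coe _ hE).comp (measurable_pi_apply n)).aemeasurable
      · exact Eventually.of_forall fun z => measure_lt_top _ _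
    · have : (fun z : ℕ → S => (pathKernel κ (z n)).real E) =
          (fun y : Finset.Iic n → S => (pathKernel κ (y ⟨n, by simp⟩)).real E) ∘
            Preorder.frestrictLe (π := fun _ => S) n := rfl
      refine StronglyMeasurable.aestronglyMeasurable ?_
      refine Measurable.stronglyMeasurable ?_
      rw [Filtration.piLE_eq_comap_frestrictLe, this]
      exact (hk.comp (measurable_pi_apply _)).comp (comap_measurable _)
  filter_upwards [hint.tendsto_ae_condExp hgm, ae_all_iff.2 hce] with z hz hz'
  simp_rw [hz']
  exact hz

/-- A function is harmonic if it is constant in mean along the chain. -/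
def IsHarmonic (κ : Kernel S S) (f : S → ℝ≥0∞) : Prop := ∀ s, f s = ∫⁻ t, f t ∂κ s

lemma pathKernel_map_shiftPath_one (κ : Kernel S S) [IsMarkovKernel κ] (s : S) :
    (pathKernel κ s).map (shiftPath 1) = (κ s).bind (pathKernel κ) := by
  rw [pathKernel_apply, chainLaw_map_shiftPath_one, Measure.dirac_bind (Kernel.measurable _),
    chainLaw_eq_bind]

/-- Condition on the first step: an invariant event does not notice that the trajectory then starts
one step later. -/
lemma isHarmonic_pathKernel (κ : Kernel S S) [IsMarkovKernel κ] {E : Set (ℕ → S)}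
    (hE : MeasurableSet E) (hinv : shiftPath 1 ⁻¹' E = E) :
    IsHarmonic κ fun s => pathKernel κ s E := by
  intro s
  have h := congrArg (fun m => m E) (pathKernel_map_shiftPath_one κ s)
  beta_reduce at h
  rwa [Measure.map_apply (by fun_prop) hE, hinv,
    Measure.bind_apply hE (Kernel.aemeasurable _)] at h

lemma chainLaw_map_eval {κ : Kernel S S} [IsMarkovKernel κ] {π : Measure S}
    [IsProbabilityMeasure π] (hπ : κ.Invariant π) (n : ℕ) :
    (chainLaw π κ).map (fun z => z n) = π := by
  have h1 : (chainLaw π κ).map (shiftPath 1) = chainLaw π κ := by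
    rw [chainLaw_map_shiftPath_one, hπ.def]
  induction n with
  | zero => rw [chainLaw_eq_bind, map_zero_bind_pathKernel]
  | succ n ih =>
    rw [← h1, Measure.map_map (by fun_prop) (by fun_prop)] at ih
    conv_rhs => rw [← ih]
    congr 1
    funext z
    simp [shiftPath, add_comm]

/-- If the bounded harmonic functions of an invariant law obey the 0-1 law, then the stationary
chain is ergodic. -/
lemma ergodic_shiftPath {κ : Kernel S S} [IsMarkovKernel κ] {π : Measure S}
    [IsProbabilityMeasure π] (hπ : κ.Invariant π)
    (h01 : ∀ f : S → ℝ≥0∞, Measurable f → (∀ s, f s ≤ 1) → IsHarmonic κ f →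
      (∃ s, f s = 1) → ∀ᵐ s ∂π, f s = 1) :
    Ergodic (shiftPath 1) (chainLaw π κ) := by
  have hmp : MeasurePreserving (shiftPath 1) (chainLaw π κ) (chainLaw π κ) :=
    ⟨by fun_prop, by rw [chainLaw_map_shiftPath_one, hπ.def]⟩
  refine { hmp with aeconst_set := fun E hE hinv => ?_ }
  have hk : Measurable fun s => (pathKernel κ s).real E :=
    (Kernel.measurable_coe _ hE).ennreal_toReal
  have hlim := (isMarkovChain_chainLaw π κ).ae_tendsto_indicator hE hinv
  -- Write p for the probability of E as a function of the state. By stationarity the mean of p(1 -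
  -- p) at time n does not depend on n, while along the chain p tends to an indicator; so this mean
  -- is 0 and p takes only the values 0 and 1 almost everywhere.
  have hz : ∫ s, (pathKernel κ s).real E * (1 - (pathKernel κ s).real E) ∂π = 0 := by
    have h1 : ∀ n : ℕ, ∫ z, (pathKernel κ (z n)).real E * (1 - (pathKernel κ (z n)).real E)
        ∂(chainLaw π κ) = ∫ s, (pathKernel κ s).real E * (1 - (pathKernel κ s).real E) ∂π := by
      intro n
      conv_rhs => rw [← chainLaw_map_eval hπ n]
      rw [integral_map (measurable_pi_apply n).aemeasurable]
      exact (hk.mul (measurable_const.sub hk)).aestronglyMeasurable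
    have h2 : Tendsto (fun n : ℕ => ∫ z, (pathKernel κ (z n)).real E *
        (1 - (pathKernel κ (z n)).real E) ∂(chainLaw π κ)) atTop
        (𝓝 (∫ _, (0 : ℝ) ∂(chainLaw π κ))) := by
      refine tendsto_integral_of_dominated_convergence (fun _ => 1) (fun n => ?_)
        (integrable_const _) (fun n => Eventually.of_forall fun z => ?_) ?_
      · exact ((hk.mul (measurable_const.sub hk)).comp (measurable_pi_apply n)).aestronglyMeasurable
      · have h0 : 0 ≤ (pathKernel κ (z n)).real E := measureReal_nonneg
        have h1 : (pathKernel κ (z n)).real E ≤ 1 := measureReal_le_one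
        rw [Real.norm_of_nonneg (mul_nonneg h0 (by linarith))]
        nlinarith
      · filter_upwards [hlim] with z hz
        have := hz.mul (hz.const_sub 1)
        by_cases hzE : z ∈ E <;> simpa [hzE] using this
    simp_rw [h1] at h2
    simpa using tendsto_nhds_unique tendsto_const_nhds h2
  rw [integral_eq_zero_iff_of_nonneg] at hz
  rotate_left
  · intro s
    have h0 : 0 ≤ (pathKernel κ s).real E := measureReal_nonneg
    have h1 : (pathKernel κ s).real E ≤ 1 := measureReal_le_one
    exact mul_nonneg h0 (by linarith)
  · refine Integrable.of_bound (hk.mul (measurable_const.sub hk)).aestronglyMeasurable 1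
      (Eventually.of_forall fun s => ?_)
    have h0 : 0 ≤ (pathKernel κ s).real E := measureReal_nonneg
    have h1 : (pathKernel κ s).real E ≤ 1 := measureReal_le_one
    rw [Real.norm_of_nonneg (mul_nonneg h0 (by linarith))]
    nlinarith
  have hE' := isHarmonic_pathKernel κ hE hinv
  by_cases hex : ∃ s, pathKernel κ s E = 1
  · have := h01 _ (Kernel.measurable_coe _ hE) (fun s => prob_le_one) hE' hex
    have h1 : E ∈ ae (chainLaw π κ) := by
      rw [mem_ae_iff_prob_eq_one hE, chainLaw_eq_bind,
        Measure.bind_apply hE (Kernel.aemeasurable _), lintegral_congr_ae this]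
      simp
    exact eventuallyConst_set.2 (Or.inl h1)
  · refine eventuallyConst_set.2 (Or.inr ?_)
    have h0 : ∀ᵐ s ∂π, pathKernel κ s E = 0 := by
      filter_upwards [hz] with s hs
      rcases mul_eq_zero.1 hs with h | h
      · exact (measureReal_eq_zero_iff).1 h
      · exfalso
        refine hex ⟨s, ?_⟩
        have : (pathKernel κ s).real E = 1 := by linarith
        rw [measureReal_def] at this
        rw [← ENNReal.ofReal_toReal (measure_ne_top (pathKernel κ s) E), this, ENNReal.ofReal_one]
    have : chainLaw π κ E = 0 := by
      rw [chainLaw_eq_bind, Measure.bind_apply hE (Kernel.aemeasurable _),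
        lintegral_congr_ae h0]
      simp
    exact measure_eq_zero_iff_ae_notMem.1 this

/-- Relative frequency of the visits of `z (K + 1), …, z M` to `B`. -/
def visitFreq {X : Type*} (B : Set X) (K M : ℕ) (z : ℕ → X) : ℝ :=
  open Classical in (((Finset.Ioc K M).filter fun j => z j ∈ B).card : ℝ) / M

omit [MeasurableSpace S] in
-- The index sets (K, M] and [0, M) differ only by the index M and by indices at most K. Dividing by
-- M instead of M - K is harmless, as scores are only compared with each other; M = 0 needs its own
-- case because of division by zero.
lemma abs_visitFreq_sub_le (B : Set S) (K M : ℕ) (z : ℕ → S) :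
    |visitFreq B K M z * M - visits (shiftPath 1) ((fun z => z 0) ⁻¹' B) M z| ≤ K + 1 := by
  classical
  have hit : ∀ i, ((shiftPath 1)^[i] z) 0 = z i := by
    have : ∀ i z k, ((shiftPath 1)^[i] z : ℕ → S) k = z (i + k) := by
      intro i
      induction i with
      | zero => intro z k; simp
      | succ i ih =>
        intro z k
        rw [Function.iterate_succ_apply, ih]
        simp [shiftPath]
        congr 1
        omega
    intro i; simpa using this i z 0
  have hv : visits (shiftPath 1) ((fun z : ℕ → S => z 0) ⁻¹' B) M z =
      ((Finset.range M).filter fun j => z j ∈ B).card := by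
    rw [visits_eq_sum, Finset.card_filter, Nat.cast_sum]
    refine Finset.sum_congr rfl fun i _ => ?_
    by_cases h : z i ∈ B <;> simp [Set.indicator, hit, h]
  have hf : visitFreq B K M z * M = ((Finset.Ioc K M).filter fun j => z j ∈ B).card := by
    unfold visitFreq
    rcases Nat.eq_zero_or_pos M with rfl | hM
    · simp
    · have : (M : ℝ) ≠ 0 := by positivity
      rw [div_mul_cancel₀ _ this]
  have h1 : ((Finset.Ioc K M).filter fun j => z j ∈ B).card ≤
      ((Finset.range M).filter fun j => z j ∈ B).card + 1 := by
    refine (Finset.card_le_card (t := ((Finset.range M).filter fun j => z j ∈ B) ∪ {M}) ?_).trans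
      (Finset.card_union_le _ _)
    intro j hj
    simp only [Finset.mem_filter, Finset.mem_Ioc, Finset.mem_union, Finset.mem_range,
      Finset.mem_singleton] at hj ⊢
    by_cases h : j = M
    · exact Or.inr h
    · exact Or.inl ⟨by omega, hj.2⟩
  have h2 : ((Finset.range M).filter fun j => z j ∈ B).card ≤
      ((Finset.Ioc K M).filter fun j => z j ∈ B).card + (K + 1) := by
    refine (Finset.card_le_card (t := ((Finset.Ioc K M).filter fun j => z j ∈ B) ∪
      Finset.range (K + 1)) ?_).trans ((Finset.card_union_le _ _).trans (by simp))
    intro j hj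
    simp only [Finset.mem_filter, Finset.mem_Ioc, Finset.mem_union, Finset.mem_range] at hj ⊢
    by_cases h : j < K + 1
    · exact Or.inr h
    · exact Or.inl ⟨by omega, hj.2⟩
  have h1' : (((Finset.Ioc K M).filter fun j => z j ∈ B).card : ℝ) ≤
      ((Finset.range M).filter fun j => z j ∈ B).card + 1 := by exact_mod_cast h1
  have h2' : (((Finset.range M).filter fun j => z j ∈ B).card : ℝ) ≤
      ((Finset.Ioc K M).filter fun j => z j ∈ B).card + (K + 1) := by exact_mod_cast h2
  rw [hf, hv, abs_le]
  have : (0 : ℝ) ≤ K := by positivity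
  constructor <;> linarith

omit [MeasurableSpace S] in
lemma tendsto_visitFreq {B : Set S} {z : ℕ → S} {p : ℝ} (K : ℕ)
    (h : Tendsto (fun n : ℕ => visits (shiftPath 1) ((fun z => z 0) ⁻¹' B) n z / n) atTop (𝓝 p)) :
    Tendsto (fun M => visitFreq B K M z) atTop (𝓝 p) := by
  have h0 : Tendsto (fun n : ℕ => ((K : ℝ) + 1) / n) atTop (𝓝 0) :=
    tendsto_const_div_atTop_nhds_zero_nat _
  have h1 : Tendsto (fun n : ℕ => visitFreq B K n z -
      visits (shiftPath 1) ((fun z => z 0) ⁻¹' B) n z / n) atTop (𝓝 0) := by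
    refine squeeze_zero_norm' ?_ h0
    filter_upwards [eventually_gt_atTop 0] with n hn
    have hn' : (0 : ℝ) < n := by exact_mod_cast hn
    rw [Real.norm_eq_abs, le_div_iff₀ hn']
    have := abs_visitFreq_sub_le B K n z
    nth_rw 2 [← abs_of_pos hn']
    rwa [← abs_mul, sub_mul, div_mul_cancel₀ _ hn'.ne']
  simpa using h1.add h

/-- The law of large numbers from every starting point, for an ergodic chain whose harmonic
functions vanish as soon as they vanish almost everywhere. -/
theorem ae_tendsto_visitFreq {κ : Kernel S S} [IsMarkovKernel κ] {π : Measure S}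
    [IsProbabilityMeasure π] (hπ : κ.Invariant π)
    (h01 : ∀ f : S → ℝ≥0∞, Measurable f → (∀ s, f s ≤ 1) → IsHarmonic κ f →
      (∃ s, f s = 1) → ∀ᵐ s ∂π, f s = 1)
    (h0 : ∀ f : S → ℝ≥0∞, Measurable f → (∀ s, f s ≤ 1) → IsHarmonic κ f →
      (∀ᵐ s ∂π, f s = 0) → ∀ s, f s = 0)
    (μ : Measure S) {B : Set S} (hB : MeasurableSet B) :
    ∀ᵐ z ∂(chainLaw μ κ), ∀ K, Tendsto (fun M => visitFreq B K M z) atTop (𝓝 (π.real B)) := by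
  have hB0 : MeasurableSet ((fun z : ℕ → S => z 0) ⁻¹' B) := hB.preimage (measurable_pi_apply 0)
  have herg := (ergodic_shiftPath hπ h01).ae_tendsto_visits hB0
  have hp : (chainLaw π κ).real ((fun z : ℕ → S => z 0) ⁻¹' B) = π.real B := by
    rw [measureReal_def, ← Measure.map_apply (measurable_pi_apply 0) hB, chainLaw_map_eval hπ]
    rfl
  rw [hp] at herg
  let v : ℕ → (ℕ → S) → ℝ := fun n z =>
    visits (shiftPath 1) ((fun z : ℕ → S => z 0) ⁻¹' B) n z / n
  have hvm : ∀ n, Measurable (v n) := fun n =>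
    (measurable_visits (measurable_shiftPath 1) hB0 n).div_const _
  -- Dropping the first draw changes the averages by O(1 / n), so non-convergence is an invariant
  -- event. Its probability is harmonic in the starting state and vanishes almost everywhere by
  -- ergodicity, hence everywhere by `h0`.
  let E : Set (ℕ → S) := {z | ¬ Tendsto (fun n => v n z) atTop (𝓝 (π.real B))}
  have hE : MeasurableSet E := (measurableSet_tendsto _ hvm).compl
  have hinv : shiftPath 1 ⁻¹' E = E := by
    ext z
    refine not_congr ?_
    have hd : Tendsto (fun n : ℕ => v (n + 1) z - v n (shiftPath 1 z)) atTop (𝓝 0) := by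
      have hlim :
          Tendsto (fun n : ℕ => (1 : ℝ) / ((n : ℝ) + 1) + 1 / ((n : ℝ) + 1)) atTop (𝓝 0) := by
        simpa using tendsto_one_div_add_atTop_nhds_zero_nat (𝕜 := ℝ).add
          tendsto_one_div_add_atTop_nhds_zero_nat
      refine squeeze_zero_norm' ?_ hlim
      filter_upwards [eventually_gt_atTop 0] with n hn
      have hn' : (0 : ℝ) < n := by exact_mod_cast hn
      set a := visits (shiftPath 1) ((fun z : ℕ → S => z 0) ⁻¹' B) n (shiftPath 1 z)
      have ha0 : 0 ≤ a := visits_nonneg _ _ _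
      have han : a ≤ n := by
        have := visits_nonneg (T := shiftPath 1) ((fun z : ℕ → S => z 0) ⁻¹' B)ᶜ n (shiftPath 1 z)
        rw [visits_compl] at this
        linarith
      have hs : visits (shiftPath 1) ((fun z : ℕ → S => z 0) ⁻¹' B) (n + 1) z =
          ((fun z : ℕ → S => z 0) ⁻¹' B).indicator 1 z + a := by
        rw [add_comm n 1, visits_add, visits_one]; rfl
      set b := ((fun z : ℕ → S => z 0) ⁻¹' B).indicator (1 : (ℕ → S) → ℝ) z
      have hb0 : 0 ≤ b := Set.indicator_nonneg (fun _ _ => zero_le_one) _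
      have hb1 : b ≤ 1 := Set.indicator_le_self' (fun _ _ => zero_le_one) _
      have e : v (n + 1) z - v n (shiftPath 1 z) = b / (n + 1) - (a / n) / (n + 1) := by
        simp only [v]
        rw [hs]
        push_cast
        change (b + a) / (n + 1) - a / n = _
        field_simp
        ring
      have han' : a / n ≤ 1 := (div_le_one hn').2 han
      have ha0' : 0 ≤ a / n := by positivity
      rw [e, Real.norm_eq_abs]
      refine (abs_sub _ _).trans ?_
      rw [abs_of_nonneg (by positivity), abs_of_nonneg (by positivity)]
      gcongr
    constructor
    · intro h
      rw [← tendsto_add_atTop_iff_nat 1]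
      simpa using hd.add h
    · intro h
      rw [← tendsto_add_atTop_iff_nat 1] at h
      simpa using h.sub hd
  have hpk : ∀ᵐ s ∂π, pathKernel κ s E = 0 := by
    have : chainLaw π κ E = 0 := herg
    rwa [chainLaw_eq_bind, Measure.bind_apply hE (Kernel.aemeasurable _),
      lintegral_eq_zero_iff (Kernel.measurable_coe _ hE)] at this
  have hall := h0 _ (Kernel.measurable_coe _ hE) (fun s => prob_le_one)
    (isHarmonic_pathKernel κ hE hinv) hpk
  have : chainLaw μ κ E = 0 := by
    rw [chainLaw_eq_bind, Measure.bind_apply hE (Kernel.aemeasurable _)]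
    simp [hall]
  have hae : ∀ᵐ z ∂(chainLaw μ κ), Tendsto (fun n => v n z) atTop (𝓝 (π.real B)) := this
  filter_upwards [hae] with z hz K
  exact tendsto_visitFreq K hz

end ErgodicChain

/-! ### Integration against a Metropolis-Hastings step. -/

section MetropolisHastingsLemmas

variable {S : Type*} [MeasurableSpace S]

lemma lintegral_mhKernel (Q : Kernel S S) [IsMarkovKernel Q] {α : S → S → ℝ≥0∞}
    (hα : Measurable (Function.uncurry α)) {f : S → ℝ≥0∞} (hf : Measurable f) (s : S) :
    ∫⁻ t, f t ∂mhKernel Q α s =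
      ∫⁻ t, α s t * f t ∂Q s + (∫⁻ t, (1 - α s t) ∂Q s) * f s := by
  have hr : Measurable (Function.uncurry fun (s : S) (_ : S) => ∫⁻ s', (1 - α s s') ∂(Q s)) := by
    have : Measurable fun s => ∫⁻ s', (1 - α s s') ∂(Q s) :=
      Measurable.lintegral_kernel_prod_right (f := fun s s' => 1 - α s s')
        (measurable_const.sub hα)
    exact this.comp measurable_fst
  rw [mhKernel, _root_.add_apply, lintegral_add_measure, Kernel.lintegral_withDensity _ hα _ hf,
    Kernel.lintegral_withDensity _ hr _ hf, Kernel.id_apply,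
    lintegral_dirac' _ (by fun_prop)]

end MetropolisHastingsLemmas

/-! ### Reversibility, harmonic functions and the law of large numbers for the APS chain. -/

section APSLemmas

variable {X Y : Type*} [MeasurableSpace X] [MeasurableSpace Y]

lemma apsProposal_apply (G : Kernel X X) [IsMarkovKernel G] (L : Kernel X Y) [IsMarkovKernel L]
    (s : X × Y) : apsProposal G L s = G s.1 ⊗ₘ L := by
  rw [apsProposal, Kernel.comap_apply, drawFrom, Measure.compProd_eq_comp_prod]
  rfl

lemma measurable_apsAcceptance {u : X × Y → ℝ} (hu : Measurable u) :
    Measurable (Function.uncurry (apsAcceptance u)) :=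
  ENNReal.measurable_ofReal.comp
    (measurable_const.min ((hu.comp measurable_snd).div (hu.comp measurable_fst)))

omit [MeasurableSpace X] [MeasurableSpace Y] in
lemma apsAcceptance_le_one (u : X × Y → ℝ) (s t : X × Y) : apsAcceptance u s t ≤ 1 :=
  ENNReal.ofReal_le_one.2 (min_le_left _ _)

omit [MeasurableSpace X] [MeasurableSpace Y] in
lemma apsAcceptance_pos {u : X × Y → ℝ} (hpos : ∀ s, 0 < u s) (s t : X × Y) :
    0 < apsAcceptance u s t :=
  ENNReal.ofReal_pos.2 (lt_min one_pos (div_pos (hpos t) (hpos s)))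

omit [MeasurableSpace X] [MeasurableSpace Y] in
-- The right-hand side is symmetric in s and t; this is the source of detailed balance.
lemma ofReal_mul_apsAcceptance {u : X × Y → ℝ} (hpos : ∀ s, 0 < u s) (s t : X × Y) :
    ENNReal.ofReal (u s) * apsAcceptance u s t = ENNReal.ofReal (min (u s) (u t)) := by
  rw [apsAcceptance, ← ENNReal.ofReal_mul (hpos s).le, mul_min_of_nonneg _ _ (hpos s).le, mul_one,
    mul_div_cancel₀ _ (hpos s).ne']

/-- The unnormalized target `u(x, y) ν(dx) L(x, dy)` of the APS sampler. -/
def apsTarget (ν : Measure X) (L : Kernel X Y) (u : X × Y → ℝ) : Measure (X × Y) :=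
  (ν ⊗ₘ L).withDensity fun s => ENNReal.ofReal (u s)

lemma CondDensity.kernel_apply {ν : Measure Y} [SFinite ν] (g : CondDensity X ν) (x : X) :
    g.kernel x = ν.withDensity fun y => ENNReal.ofReal (g.p x y) := by
  rw [CondDensity.kernel, Kernel.withDensity_apply _ g.measurable_ofReal, Kernel.const_apply]

variable {ν : Measure X} [SFinite ν] (g : CondDensity X ν) (L : Kernel X Y) [IsMarkovKernel L]
  {u : X × Y → ℝ} (hu : Measurable u)

/-- Since y' is drawn from L itself, the proposal has density g(x, x') against ν ⊗ₘ L, and L cancels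
from the acceptance ratio. -/
lemma lintegral_apsProposal {f : X × Y → ℝ≥0∞} (hf : Measurable f) (s : X × Y) :
    ∫⁻ t, f t ∂apsProposal g.kernel L s =
      ∫⁻ t, ENNReal.ofReal (g.p s.1 t.1) * f t ∂(ν ⊗ₘ L) := by
  have hg : Measurable fun x => ENNReal.ofReal (g.p s.1 x) :=
    g.measurable_ofReal.comp measurable_prodMk_left
  have hm : Measurable fun t : X × Y => ENNReal.ofReal (g.p s.1 t.1) * f t :=
    (hg.comp measurable_fst).mul hf
  rw [apsProposal_apply, Measure.lintegral_compProd hf, g.kernel_apply,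
    lintegral_withDensity_eq_lintegral_mul _ hg
      (Measurable.lintegral_kernel_prod_right (by fun_prop)),
    Measure.lintegral_compProd hm]
  refine lintegral_congr fun x => ?_
  exact (lintegral_const_mul _ (by fun_prop)).symm

lemma apsProposal_absolutelyContinuous (s : X × Y) :
    apsProposal g.kernel L s ≪ ν ⊗ₘ L := by
  rw [apsProposal_apply, g.kernel_apply]
  exact Measure.AbsolutelyContinuous.compProd_left (withDensity_absolutelyContinuous _ _) _

lemma apsKernel_apply {B : Set (X × Y)} (hB : MeasurableSet B)
    (s : X × Y) :
    apsKernel g.kernel L u hu s B =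
      ∫⁻ t, apsAcceptance u s t * B.indicator 1 t ∂apsProposal g.kernel L s +
        (∫⁻ t, (1 - apsAcceptance u s t) ∂apsProposal g.kernel L s) * B.indicator 1 s := by
  rw [← lintegral_indicator_one hB, apsKernel, lintegral_mhKernel _ (measurable_apsAcceptance hu)
    (measurable_one.indicator hB)]

/-- Detailed balance: accepted moves flow symmetrically because g and min(u(s), u(t)) are symmetric,
and rejected moves stay on the diagonal. -/
theorem isReversible_apsKernel (hg : g.IsSymmetric) (hpos : ∀ s, 0 < u s) :
    (apsKernel g.kernel L u hu).IsReversible (apsTarget ν L u) := by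
  have hu' : Measurable fun s => ENNReal.ofReal (u s) := hu.ennreal_ofReal
  have hgm : Measurable fun p : (X × Y) × (X × Y) => ENNReal.ofReal (g.p p.1.1 p.2.1) :=
    g.measurable_ofReal.comp (by fun_prop : Measurable fun p : (X × Y) × (X × Y) => (p.1.1, p.2.1))
  let F : (X × Y) → (X × Y) → ℝ≥0∞ := fun s t =>
    ENNReal.ofReal (g.p s.1 t.1) * ENNReal.ofReal (min (u s) (u t))
  have hF : Measurable (Function.uncurry F) :=
    hgm.mul ((hu.comp measurable_fst).min (hu.comp measurable_snd)).ennreal_ofReal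
  have hFsymm : ∀ s t, F s t = F t s := fun s t => by
    simp only [F]; rw [hg, min_comm]
  -- The flow from A to B splits into accepted moves, with density F, and rejections, which
  -- contribute an integral depending only on A ∩ B.
  have key : ∀ {A B : Set (X × Y)}, MeasurableSet A → MeasurableSet B →
      ∫⁻ s in A, apsKernel g.kernel L u hu s B ∂apsTarget ν L u =
        ∫⁻ s, ∫⁻ t, A.indicator 1 s * (B.indicator 1 t * F s t) ∂(ν ⊗ₘ L) ∂(ν ⊗ₘ L) +
        ∫⁻ s, (∫⁻ t, (1 - apsAcceptance u s t) ∂apsProposal g.kernel L s) *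
          (A ∩ B).indicator 1 s ∂apsTarget ν L u := by
    intro A B hA hB
    have hacc : Measurable fun s => ∫⁻ t, apsAcceptance u s t * B.indicator 1 t
        ∂apsProposal g.kernel L s :=
      Measurable.lintegral_kernel_prod_right
        (f := fun s t => apsAcceptance u s t * B.indicator 1 t)
        ((measurable_apsAcceptance hu).mul ((measurable_one.indicator hB).comp measurable_snd))
    rw [← lintegral_indicator hA]
    have h1 : ∀ s, A.indicator (fun s => apsKernel g.kernel L u hu s B) s =
        A.indicator (fun s => ∫⁻ t, apsAcceptance u s t * B.indicator 1 t
          ∂apsProposal g.kernel L s) s +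
        (∫⁻ t, (1 - apsAcceptance u s t) ∂apsProposal g.kernel L s) *
          (A ∩ B).indicator 1 s := by
      intro s
      by_cases hs : s ∈ A
      · rw [Set.indicator_of_mem hs, Set.indicator_of_mem hs, apsKernel_apply g L hu hB]
        by_cases hsB : s ∈ B <;> simp [hs, hsB]
      · simp [hs]
    simp_rw [h1]
    rw [lintegral_add_left (hacc.indicator hA)]
    congr 1
    rw [apsTarget, lintegral_withDensity_eq_lintegral_mul _ hu' (hacc.indicator hA)]
    refine lintegral_congr fun s => ?_
    by_cases hs : s ∈ A
    · have hα : Measurable fun t => apsAcceptance u s t * B.indicator 1 t :=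
        ((measurable_apsAcceptance hu).comp measurable_prodMk_left).mul
          (measurable_one.indicator hB)
      have hgs : Measurable fun t : X × Y => ENNReal.ofReal (g.p s.1 t.1) :=
        hgm.comp measurable_prodMk_left
      rw [Pi.mul_apply, Set.indicator_of_mem hs, lintegral_apsProposal g L hα,
        ← lintegral_const_mul _ (by fun_prop)]
      refine lintegral_congr fun t => ?_
      simp only [Set.indicator_of_mem hs, Pi.one_apply, one_mul, F]
      rw [← ofReal_mul_apsAcceptance hpos]
      ring
    · simp [hs]
  intro A B hA hB
  rw [key hA hB, key hB hA, Set.inter_comm B A]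
  congr 1
  have hm : Measurable (Function.uncurry fun s t : X × Y =>
      A.indicator (1 : X × Y → ℝ≥0∞) s * (B.indicator (1 : X × Y → ℝ≥0∞) t * F s t)) :=
    ((measurable_one.indicator hA).comp measurable_fst).mul
      (((measurable_one.indicator hB).comp measurable_snd).mul hF)
  rw [lintegral_lintegral_swap hm.aemeasurable]
  refine lintegral_congr fun s => lintegral_congr fun t => ?_
  rw [hFsymm t s]
  ring

lemma invariant_normalized {S : Type*} [MeasurableSpace S] {κ : Kernel S S} {m : Measure S}
    (h : κ.Invariant m) : κ.Invariant (normalized m) := by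
  rw [Kernel.Invariant, normalized, Measure.comp_smul, h.def]

theorem invariant_apsKernel (hg : g.IsSymmetric) (hpos : ∀ s, 0 < u s) :
    (apsKernel g.kernel L u hu).Invariant (normalized (apsTarget ν L u)) :=
  invariant_normalized (isReversible_apsKernel g L hu hg hpos).invariant

omit [SFinite ν] in
lemma isProbabilityMeasure_normalized {S : Type*} [MeasurableSpace S] {m : Measure S}
    (h0 : m ≠ 0) (h1 : m Set.univ ≠ ∞) : IsProbabilityMeasure (normalized m) := by
  refine ⟨?_⟩
  rw [normalized, Measure.smul_apply, smul_eq_mul]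
  exact ENNReal.inv_mul_cancel (by simpa using h0) h1

omit [SFinite ν] [IsMarkovKernel L] in
include hu in
lemma compProd_absolutelyContinuous_apsTarget (hpos : ∀ s, 0 < u s) :
    ν ⊗ₘ L ≪ apsTarget ν L u :=
  withDensity_absolutelyContinuous' hu.ennreal_ofReal.aemeasurable
    (Eventually.of_forall fun s => (ENNReal.ofReal_pos.2 (hpos s)).ne')

include hu in
lemma apsTarget_ne_zero (hν : ν ≠ 0) (hpos : ∀ s, 0 < u s) : apsTarget ν L u ≠ 0 := by
  intro h
  have h1 := compProd_absolutelyContinuous_apsTarget (ν := ν) L hu hpos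
  rw [h] at h1
  have h2 : (ν ⊗ₘ L) Set.univ = 0 := h1 rfl
  rw [Measure.compProd_apply_univ] at h2
  exact hν (Measure.measure_univ_eq_zero.1 h2)

omit [IsMarkovKernel L] in
include hu in
-- As u is positive, acceptance never has probability zero: whatever can be proposed can be reached
-- by an accepted move.
lemma lintegral_apsAcceptance_pos (hpos : ∀ s, 0 < u s) (s : X × Y) {B : Set (X × Y)}
    (hB : apsProposal g.kernel L s B ≠ 0) (hBm : MeasurableSet B) :
    ∫⁻ t, apsAcceptance u s t * B.indicator 1 t ∂apsProposal g.kernel L s ≠ 0 := by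
  intro h
  have hm : Measurable fun t => apsAcceptance u s t * B.indicator 1 t :=
    ((measurable_apsAcceptance hu).comp measurable_prodMk_left).mul (measurable_one.indicator hBm)
  rw [lintegral_eq_zero_iff hm] at h
  refine hB (measure_eq_zero_iff_ae_notMem.2 ?_)
  filter_upwards [h] with t ht hB
  simp only [hB, Set.indicator_of_mem, Pi.one_apply, mul_one, Pi.zero_apply] at ht
  exact (apsAcceptance_pos hpos s t).ne' ht

/-- Harmonic functions of the APS chain attain their upper bound almost everywhere or nowhere. -/
lemma ae_eq_one_of_isHarmonic (hpos : ∀ s, 0 < u s) (hirr : Kernel.IsIrreducible ν g.kernel)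
    {f : X × Y → ℝ≥0∞} (hf : Measurable f) (hf1 : ∀ s, f s ≤ 1)
    (hh : IsHarmonic (apsKernel g.kernel L u hu) f) (hex : ∃ s, f s = 1) :
    ∀ᵐ s ∂(ν ⊗ₘ L), f s = 1 := by
  have hHm : MeasurableSet {s | f s = 1} := hf (measurableSet_singleton 1)
  -- An average of values at most 1 equals 1 only if almost all of them do; so from such a state
  -- almost every proposal lands where f = 1.
  have step : ∀ s, f s = 1 → apsProposal g.kernel L s {t | f t = 1}ᶜ = 0 := by
    intro s hs
    have h1 : ∫⁻ t, f t ∂apsKernel g.kernel L u hu s = 1 := by rw [← hh s, hs]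
    have h2 : apsKernel g.kernel L u hu s {t | f t = 1}ᶜ = 0 := by
      have : ∫⁻ t, (1 - f t) ∂apsKernel g.kernel L u hu s = 0 := by
        rw [lintegral_sub hf (by rw [h1]; simp) (Eventually.of_forall hf1), h1]
        simp
      rw [lintegral_eq_zero_iff (by fun_prop)] at this
      rw [measure_eq_zero_iff_ae_notMem]
      filter_upwards [this] with t ht hn
      exact hn (le_antisymm (hf1 t) (tsub_eq_zero_iff_le.1 ht))
    by_contra h3
    have h4 := lintegral_apsAcceptance_pos g L hu hpos s h3 hHm.compl
    rw [apsKernel_apply g L hu hHm.compl] at h2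
    exact h4 (add_eq_zero.1 h2).1
  -- Irreducibility concerns g alone, so the set where f = 1 is projected to X: T collects the x
  -- whose fibre lies in it up to an L x-null set. Such a fibre contains a point with f = 1, whence
  -- T is closed under g.
  let T : Set X := {x | L x (Prod.mk x ⁻¹' {s | f s = 1}ᶜ) = 0}
  have hTm : MeasurableSet T :=
    (Kernel.measurable_kernel_prodMk_left (κ := L) hHm.compl) (measurableSet_singleton 0)
  have stepT : ∀ s, f s = 1 → g.kernel s.1 Tᶜ = 0 := by
    intro s hs
    have := step s hs
    rw [apsProposal_apply, Measure.compProd_apply hHm.compl,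
      lintegral_eq_zero_iff (Kernel.measurable_kernel_prodMk_left hHm.compl)] at this
    rw [measure_eq_zero_iff_ae_notMem]
    filter_upwards [this] with x hx hn
    exact hn hx
  have hTT : ∀ x ∈ T, g.kernel x Tᶜ = 0 := by
    intro x hx
    obtain ⟨y, hy⟩ : ∃ y, f (x, y) = 1 := by
      by_contra! h
      have : Prod.mk x ⁻¹' {s | f s = 1}ᶜ = Set.univ := by
        ext y; simpa using h y
      have hx' : L x (Prod.mk x ⁻¹' {s | f s = 1}ᶜ) = 0 := hx
      rw [this, measure_univ] at hx'
      exact one_ne_zero hx'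
    exact stepT (x, y) hy
  have hpow : ∀ n x, x ∈ T → (g.kernel ^ n) x Tᶜ = 0 := by
    intro n
    induction n with
    | zero =>
      intro x hx
      rw [pow_zero]
      change Measure.dirac x Tᶜ = 0
      rw [Measure.dirac_apply' _ hTm.compl]
      simp [hx]
    | succ n ih =>
      intro x hx
      rw [Kernel.pow_succ_apply_eq_lintegral _ _ _ hTm.compl]
      rw [lintegral_eq_zero_iff (Kernel.measurable_coe _ hTm.compl)]
      have := measure_eq_zero_iff_ae_notMem.1 (ih x hx)
      filter_upwards [this] with y hy
      exact hTT y (by simpa using hy)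
  obtain ⟨s, hs⟩ := hex
  obtain ⟨x, hx⟩ : ∃ x, x ∈ T := by
    by_contra! h
    have h1 : Tᶜ = Set.univ := by ext x; simpa using h x
    have := stepT s hs
    rw [h1, measure_univ] at this
    exact one_ne_zero this
  -- If the complement of T had positive measure, irreducibility would lead there from x ∈ T.
  have hνT : ν Tᶜ = 0 := by
    by_contra h
    obtain ⟨n, hn⟩ := hirr.irreducible hTm.compl (pos_iff_ne_zero.2 h) x
    exact hn.ne' (hpow n x hx)
  have : (ν ⊗ₘ L) {s | f s = 1}ᶜ = 0 := by
    rw [Measure.compProd_apply hHm.compl,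
      lintegral_eq_zero_iff (Kernel.measurable_kernel_prodMk_left hHm.compl)]
    filter_upwards [measure_eq_zero_iff_ae_notMem.1 hνT] with x hx
    simpa [T] using hx
  exact this

/-- Harmonic functions of the APS chain that vanish almost everywhere vanish everywhere: the chain
leaves every state for a random one. -/
lemma eq_zero_of_isHarmonic (hpos : ∀ s, 0 < u s)
    {f : X × Y → ℝ≥0∞} (hf : Measurable f) (hf1 : ∀ s, f s ≤ 1)
    (hh : IsHarmonic (apsKernel g.kernel L u hu) f) (h0 : ∀ᵐ s ∂(ν ⊗ₘ L), f s = 0) (s : X × Y) :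
    f s = 0 := by
  have hα : Measurable (apsAcceptance u s) :=
    (measurable_apsAcceptance hu).comp measurable_prodMk_left
  have h1 := hh s
  rw [apsKernel, lintegral_mhKernel _ (measurable_apsAcceptance hu) hf] at h1
  have h2 : ∫⁻ t, apsAcceptance u s t * f t ∂apsProposal g.kernel L s = 0 := by
    rw [lintegral_eq_zero_iff (by fun_prop)]
    filter_upwards [(apsProposal_absolutelyContinuous g L s).ae_le h0] with t ht
    simp [ht]
  rw [h2, zero_add] at h1
  set r := ∫⁻ t, (1 - apsAcceptance u s t) ∂apsProposal g.kernel L s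
  have h3 : (∫⁻ t, apsAcceptance u s t ∂apsProposal g.kernel L s) + r = 1 := by
    rw [← lintegral_add_left hα]
    simp [add_tsub_cancel_of_le (apsAcceptance_le_one u s _)]
  have h4 : ∫⁻ t, apsAcceptance u s t ∂apsProposal g.kernel L s ≠ 0 := by
    have := lintegral_apsAcceptance_pos g L hu hpos s (B := Set.univ) (by simp) .univ
    simpa using this
  -- The rejection probability r is below 1, while harmonicity has been reduced to f s = r * f s.
  have h5 : r < 1 := by
    refine lt_of_le_of_ne (by rw [← h3]; exact le_add_self) fun h => h4 ?_
    rw [h] at h3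
    exact (ENNReal.add_left_inj ENNReal.one_ne_top).1 (h3.trans (zero_add 1).symm)
  by_contra hne
  have h6 : r * f s < 1 * f s :=
    (ENNReal.mul_lt_mul_iff_left hne (ne_top_of_le_ne_top ENNReal.one_ne_top (hf1 s))).2 h5
  rw [one_mul, ← h1] at h6
  exact lt_irrefl _ h6

/-- Law of large numbers for the APS sampler, from every starting point. -/
theorem ae_tendsto_visitFreq_apsRun (hg : g.IsSymmetric) (hpos : ∀ s, 0 < u s)
    (hirr : Kernel.IsIrreducible ν g.kernel) (hν : ν ≠ 0)
    (hfin : apsTarget ν L u Set.univ ≠ ∞) (x₀ : X) {B : Set X} (hB : MeasurableSet B) :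
    ∀ᵐ z ∂(apsRun g.kernel L u hu x₀), ∀ K,
      Tendsto (fun M => visitFreq B K M fun i => (z i).1) atTop
        (𝓝 (((normalized (apsTarget ν L u)).map Prod.fst).real B)) := by
  have := isProbabilityMeasure_normalized (apsTarget_ne_zero (ν := ν) L hu hν hpos) hfin
  -- The target and ν ⊗ₘ L have the same null sets, so "almost everywhere" may be read for either.
  have hac : normalized (apsTarget ν L u) ≪ ν ⊗ₘ L :=
    (Measure.smul_absolutelyContinuous).trans (withDensity_absolutelyContinuous _ _)
  have hac' : ν ⊗ₘ L ≪ normalized (apsTarget ν L u) :=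
    (compProd_absolutelyContinuous_apsTarget L hu hpos).trans
      (Measure.absolutelyContinuous_smul (ENNReal.inv_ne_zero.2 hfin))
  have h := ae_tendsto_visitFreq (invariant_apsKernel g L hu hg hpos)
    (fun f hf hf1 hh hex => hac.ae_le
      (ae_eq_one_of_isHarmonic g L hu hpos hirr hf hf1 hh hex))
    (fun f hf hf1 hh h0 => eq_zero_of_isHarmonic g L hu hpos hf hf1 hh (hac'.ae_le h0))
    (drawFrom L x₀) (hB.preimage measurable_fst)
  rw [measureReal_def, Measure.map_apply measurable_fst hB]
  exact h

end APSLemmas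

/-! ### Geometry of the windows: discrete sets and boxes. -/

section Windows

variable {S : Type*} [MetricSpace S] [MeasurableSpace S] [BorelSpace S]

lemma IsDiscreteOrInterval.secondCountableTopology (ν : Measure S) [h : IsDiscreteOrInterval ν] :
    SecondCountableTopology S := by
  rcases h.discrete_or_interval with ⟨_, _, _⟩ | ⟨n, I, e, _, he, _⟩
  · exact UniformSpace.secondCountable_of_separable S
  · exact he.isEmbedding.secondCountableTopology

/-- Windows of small bandwidth have finite reference measure, bounded away from zero, and depending
uniformly continuously on the bandwidth. -/
structure HasRegularWindows (ν : Measure S) (r : ℝ) : Prop where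
  measure_ne_top : ∀ h, 0 < h → h < r → ∀ y, ν (Metric.closedBall y h) ≠ ∞
  exists_le : ∀ h, 0 < h → h < r → ∃ c > 0, ∀ y, c ≤ ν.real (Metric.closedBall y h)
  exists_ratio : ∀ h, 0 < h → h < r → ∀ η > 1, ∃ δ > 0, δ < h ∧ h + δ < r ∧
    ∀ y, ν.real (Metric.closedBall y (h + δ)) ≤ η * ν.real (Metric.closedBall y (h - δ))

/-- Windows of radius less than 1 are single points, of measure 1. -/
lemma hasRegularWindows_of_discrete [Countable S] (hd : ∀ x y : S, x ≠ y → dist x y = 1) :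
    HasRegularWindows (Measure.count : Measure S) 1 := by
  have hb : ∀ (y : S) (h : ℝ), 0 ≤ h → h < 1 → Metric.closedBall y h = {y} := by
    intro y h h0 h1
    ext x
    rw [Metric.mem_closedBall, Set.mem_singleton_iff]
    constructor
    · intro hx
      by_contra hne
      rw [hd x y hne] at hx
      linarith
    · rintro rfl; simpa using h0
  have hc : ∀ y : S, (Measure.count : Measure S).real {y} = 1 := by
    intro y; simp [measureReal_def]
  refine ⟨fun h h0 h1 y => ?_, fun h h0 h1 => ⟨1, one_pos, fun y => ?_⟩, fun h h0 h1 η hη => ?_⟩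
  · rw [hb y h h0.le h1]; simp
  · rw [hb y h h0.le h1, hc]
  · obtain ⟨δ, hδ, hδ'⟩ := exists_between (lt_min h0 (sub_pos.2 h1))
    rw [lt_min_iff] at hδ'
    refine ⟨δ, hδ, hδ'.1, by linarith, fun y => ?_⟩
    rw [hb y _ (by linarith) (by linarith), hb y _ (by linarith) (by linarith), hc]
    linarith

/-- By convexity, the homothety with centre p and ratio r₁ / r₂ maps the large truncated ball into
the small one. It scales volume by (r₁ / r₂) ^ n, so the estimate does not depend on how the
boundary cuts the ball. -/
lemma volume_closedBall_inter_le {n : ℕ} {R : Set (EuclideanSpace ℝ (Fin n))} (hR : Convex ℝ R)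
    {p : EuclideanSpace ℝ (Fin n)} (hp : p ∈ R) {r₁ r₂ : ℝ} (h1 : 0 < r₁) (h2 : r₁ ≤ r₂) :
    volume.real (Metric.closedBall p r₂ ∩ R) ≤
      (r₂ / r₁) ^ n * volume.real (Metric.closedBall p r₁ ∩ R) := by
  have h0 : 0 < r₂ := h1.trans_le h2
  have hsub : AffineMap.homothety p (r₁ / r₂) '' (Metric.closedBall p r₂ ∩ R) ⊆
      Metric.closedBall p r₁ ∩ R := by
    rintro _ ⟨x, ⟨hx, hxR⟩, rfl⟩
    constructor
    · rw [Metric.mem_closedBall] at hx ⊢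
      rw [dist_comm, dist_center_homothety, Real.norm_of_nonneg (by positivity), dist_comm]
      calc r₁ / r₂ * dist x p ≤ r₁ / r₂ * r₂ := by gcongr
        _ = r₁ := div_mul_cancel₀ _ h0.ne'
    · rw [AffineMap.homothety_eq_lineMap]
      exact hR.lineMap_mem hp hxR ⟨by positivity, (div_le_one h0).2 h2⟩
  have hfin : volume (Metric.closedBall p r₁ ∩ R) ≠ ∞ :=
    ne_top_of_le_ne_top measure_closedBall_lt_top.ne (measure_mono Set.inter_subset_left)
  have hm := measureReal_mono hsub hfin
  rw [measureReal_def, Measure.addHaar_image_homothety, ENNReal.toReal_mul, ← measureReal_def,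
    finrank_euclideanSpace, Fintype.card_fin, ENNReal.toReal_ofReal (abs_nonneg _),
    abs_of_nonneg (by positivity)] at hm
  calc volume.real (Metric.closedBall p r₂ ∩ R)
      = (r₂ / r₁) ^ n * ((r₁ / r₂) ^ n * volume.real (Metric.closedBall p r₂ ∩ R)) := by
        rw [← mul_assoc, ← mul_pow, div_mul_div_cancel₀ h1.ne', div_self h0.ne', one_pow, one_mul]
    _ ≤ _ := by gcongr

/-- Even at a corner there is room in some direction: in each coordinate, step from y towards the
farther end of a fixed segment [a i, b i] inside the interval. The radius t depends on h and these
segments, not on y. -/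
lemma exists_closedBall_subset_box {n : ℕ} {I : Fin n → Set ℝ}
    (hI : ∀ i, (I i).OrdConnected ∧ (interior (I i)).Nonempty) {h : ℝ} (h0 : 0 < h) :
    ∃ t > 0, ∀ y ∈ {x : EuclideanSpace ℝ (Fin n) | ∀ i, x i ∈ I i}, ∃ z,
      Metric.closedBall z t ⊆ Metric.closedBall y h ∩ {x | ∀ i, x i ∈ I i} := by
  have hex : ∀ i, ∃ a b : ℝ, a < b ∧ Set.Icc a b ⊆ I i := by
    intro i
    obtain ⟨x, hx⟩ := (hI i).2
    obtain ⟨ε, hε, hb⟩ := Metric.isOpen_iff.1 isOpen_interior x hx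
    refine ⟨x, x + ε / 2, by linarith, fun y hy => interior_subset (hb ?_)⟩
    rw [Metric.mem_ball, Real.dist_eq, abs_lt]
    constructor <;> linarith [hy.1, hy.2]
  choose a b hab hI' using hex
  -- A shift by t and a ball of radius t use up 2 * t, less than half of each segment. The shift
  -- vector has norm at most n * t, so n * t + t < h keeps the ball in the window.
  have hev : ∀ᶠ t : ℝ in 𝓝[>] 0, (∀ i, 4 * t < b i - a i) ∧ (n * t + t < h) ∧ 0 < t := by
    refine Filter.Eventually.and ?_ (Filter.Eventually.and ?_ self_mem_nhdsWithin)
    · refine eventually_all.2 fun i => ?_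
      have : Tendsto (fun t : ℝ => 4 * t) (𝓝[>] 0) (𝓝 0) :=
        ((continuous_const.mul continuous_id).tendsto' 0 0 (by simp)).mono_left nhdsWithin_le_nhds
      exact this.eventually_lt_const (by linarith [hab i])
    · have : Tendsto (fun t : ℝ => n * t + t) (𝓝[>] 0) (𝓝 0) :=
        (((continuous_const.mul continuous_id).add continuous_id).tendsto' 0 0
          (by simp)).mono_left nhdsWithin_le_nhds
      exact this.eventually_lt_const h0
  obtain ⟨t, ht, hth, ht0⟩ := hev.exists
  refine ⟨t, ht0, fun y hy => ?_⟩
  let s : Fin n → ℝ := fun i => if y i ≤ (a i + b i) / 2 then t else -t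
  have hs : ∀ i, |s i| = t := by
    intro i; simp only [s]; split_ifs <;> simp [abs_of_pos ht0]
  refine ⟨y + WithLp.toLp 2 s, fun x hx => ⟨?_, fun i => ?_⟩⟩
  · rw [Metric.mem_closedBall] at hx ⊢
    have h1 : ‖(WithLp.toLp 2 s : EuclideanSpace ℝ (Fin n))‖ ≤ n * t := by
      rw [EuclideanSpace.norm_eq]
      simp only [Real.norm_eq_abs, hs, Finset.sum_const, Finset.card_univ, Fintype.card_fin,
        nsmul_eq_mul]
      refine Real.sqrt_le_left (by positivity) |>.2 ?_
      rcases Nat.eq_zero_or_pos n with rfl | hn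
      · simp
      · have hn' : (1 : ℝ) ≤ n := by exact_mod_cast hn
        nlinarith [mul_nonneg (mul_nonneg (Nat.cast_nonneg (α := ℝ) n) (sub_nonneg.2 hn'))
          (sq_nonneg t)]
    calc dist x y ≤ dist x (y + WithLp.toLp 2 s) + dist (y + WithLp.toLp 2 s) y :=
          dist_triangle _ _ _
      _ ≤ t + n * t := by
          refine add_le_add hx ?_
          rw [dist_eq_norm, add_sub_cancel_left]; exact h1
      _ ≤ h := by linarith
  · have hx' : |x i - (y i + s i)| ≤ t := by
      rw [Metric.mem_closedBall, dist_eq_norm] at hx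
      exact (PiLp.norm_apply_le (x - (y + WithLp.toLp 2 s)) i).trans hx
    rw [abs_le] at hx'
    have hyi := hy i
    have := ht i
    simp only [s] at hx'
    split_ifs at hx' with hc
    · refine (hI i).1.out hyi (hI' i (Set.right_mem_Icc.2 (hab i).le)) ⟨?_, ?_⟩ <;> linarith
    · push Not at hc
      refine (hI i).1.out (hI' i (Set.left_mem_Icc.2 (hab i).le)) hyi ⟨?_, ?_⟩ <;> linarith

lemma hasRegularWindows_of_interval {n : ℕ} {I : Fin n → Set ℝ} {e : S → EuclideanSpace ℝ (Fin n)}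
    (hI : ∀ i, (I i).OrdConnected ∧ (interior (I i)).Nonempty) (he : Isometry e)
    (hr : Set.range e = {x | ∀ i, x i ∈ I i}) : HasRegularWindows (Measure.comap e volume) 1 := by
  have hm : MeasurableSet (Set.range e) := by
    rw [hr, Set.ofPred_forall]
    exact MeasurableSet.iInter fun i => (hI i).1.measurableSet.preimage (by fun_prop)
  have hemb : MeasurableEmbedding e := he.isEmbedding.measurableEmbedding hm
  have hconv : Convex ℝ (Set.range e) := by
    rw [hr]
    intro x hx y hy a b ha hb hab i
    exact (hI i).1.convex (hx i) (hy i) ha hb hab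
  have hball : ∀ y h, (Measure.comap e volume) (Metric.closedBall y h) =
      volume (Metric.closedBall (e y) h ∩ Set.range e) := by
    intro y h
    rw [hemb.comap_apply]
    congr 1
    ext x
    constructor
    · rintro ⟨w, hw, rfl⟩
      exact ⟨by simpa [he.dist_eq] using hw, w, rfl⟩
    · rintro ⟨hw, w, rfl⟩
      exact ⟨w, by simpa [he.dist_eq] using hw, rfl⟩
  have hballr : ∀ y h, (Measure.comap e volume).real (Metric.closedBall y h) =
      volume.real (Metric.closedBall (e y) h ∩ Set.range e) := fun y h => by
    rw [measureReal_def, hball, measureReal_def]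
  have hfin : ∀ (p : EuclideanSpace ℝ (Fin n)) (h : ℝ),
      volume (Metric.closedBall p h ∩ Set.range e) ≠ ∞ := fun p h =>
    ne_top_of_le_ne_top measure_closedBall_lt_top.ne (measure_mono Set.inter_subset_left)
  refine ⟨fun h h0 h1 y => ?_, fun h h0 h1 => ?_, fun h h0 h1 η hη => ?_⟩
  · rw [hball]; exact hfin _ _
  · obtain ⟨t, ht, hz⟩ := exists_closedBall_subset_box hI h0
    refine ⟨volume.real (Metric.closedBall (0 : EuclideanSpace ℝ (Fin n)) t), ?_, fun y => ?_⟩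
    · exact ENNReal.toReal_pos (Metric.measure_closedBall_pos _ _ ht).ne'
        measure_closedBall_lt_top.ne
    · obtain ⟨z, hz⟩ := hz (e y) (by rw [← hr]; exact ⟨y, rfl⟩)
      rw [hballr, measureReal_def, ← Measure.addHaar_closedBall_center volume z t]
      rw [← hr] at hz
      exact measureReal_mono hz (hfin _ _)
  -- The volume ratio is at most ((h + δ) / (h - δ)) ^ n for every centre, and this tends to 1 as δ
  -- → 0.
  · have hlim : Tendsto (fun δ : ℝ => ((h + δ) / (h - δ)) ^ n) (𝓝[>] 0) (𝓝 1) := by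
      have : ContinuousAt (fun δ : ℝ => ((h + δ) / (h - δ)) ^ n) 0 := by
        refine ContinuousAt.pow (ContinuousAt.div (by fun_prop) (by fun_prop) ?_) n
        simpa using h0.ne'
      have h2 := this.tendsto
      simp only [add_zero, sub_zero, div_self h0.ne', one_pow] at h2
      exact h2.mono_left nhdsWithin_le_nhds
    have hsm : ∀ᶠ δ : ℝ in 𝓝[>] 0, δ < h ∧ δ < 1 - h :=
      nhdsWithin_le_nhds ((eventually_lt_nhds h0).and (eventually_lt_nhds (by linarith)))
    obtain ⟨δ, hδη, ⟨hδh, hδ1⟩, hδ0⟩ :=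
      ((hlim.eventually_lt_const hη).and (hsm.and self_mem_nhdsWithin)).exists
    have hδ0' : 0 < δ := hδ0
    refine ⟨δ, hδ0', hδh, by linarith, fun y => ?_⟩
    rw [hballr, hballr]
    refine (volume_closedBall_inter_le hconv ⟨y, rfl⟩ (r₁ := h - δ) (by linarith)
      (by linarith)).trans ?_
    gcongr

lemma IsDiscreteOrInterval.hasRegularWindows (ν : Measure S) [h : IsDiscreteOrInterval ν] :
    HasRegularWindows ν 1 := by
  rcases h.discrete_or_interval with ⟨_, hd, rfl⟩ | ⟨n, I, e, hI, he, hr, rfl⟩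
  · exact hasRegularWindows_of_discrete hd
  · exact hasRegularWindows_of_interval hI he hr

lemma IsDiscreteOrInterval.ne_zero (ν : Measure S) [IsDiscreteOrInterval ν] [Nonempty S] :
    ν ≠ 0 := by
  rintro rfl
  obtain ⟨c, hc, h⟩ := (hasRegularWindows (0 : Measure S)).exists_le (1 / 2) (by norm_num)
    (by norm_num)
  have := h (Classical.arbitrary S)
  simp at this
  linarith

end Windows

/-! ### Elementary bounds for visit frequencies. -/

section VisitFreq

variable {X : Type*}

lemma visitFreq_eq_sum (B : Set X) (K M : ℕ) (z : ℕ → X) :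
    visitFreq B K M z = (∑ i ∈ Finset.Ioc K M, B.indicator (1 : X → ℝ) (z i)) / M := by
  classical
  unfold visitFreq
  rw [Finset.card_filter, Nat.cast_sum]
  congr 1
  refine Finset.sum_congr rfl fun i _ => ?_
  by_cases h : z i ∈ B <;> simp [h]

lemma visitFreq_mono {B C : Set X} (h : B ⊆ C) (K M : ℕ) (z : ℕ → X) :
    visitFreq B K M z ≤ visitFreq C K M z := by
  rw [visitFreq_eq_sum, visitFreq_eq_sum]
  gcongr with i
  exact zero_le_one (α := ℝ)

lemma visitFreq_add_sum_le_one {B : Set X} {C : ℕ → Set X} {T : Finset ℕ}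
    (hd : Pairwise (Function.onFun Disjoint C)) (hB : ∀ k ∈ T, Disjoint (C k) B)
    (K M : ℕ) (z : ℕ → X) :
    visitFreq B K M z + ∑ k ∈ T, visitFreq (C k) K M z ≤ 1 := by
  simp_rw [visitFreq_eq_sum]
  rw [← Finset.sum_div, ← add_div, Finset.sum_comm, ← Finset.sum_add_distrib]
  refine div_le_one_of_le₀ ?_ (Nat.cast_nonneg _)
  have hpt : ∀ x, B.indicator (1 : X → ℝ) x + ∑ k ∈ T, (C k).indicator (1 : X → ℝ) x ≤ 1 := by
    intro x
    by_cases hx : ∃ k ∈ T, x ∈ C k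
    · obtain ⟨k, hk, hxk⟩ := hx
      rw [Finset.sum_eq_single_of_mem k hk fun j _ hjk => ?_]
      · rw [Set.indicator_of_notMem (Set.disjoint_left.1 (hB k hk) hxk),
          Set.indicator_of_mem hxk]
        simp
      · exact Set.indicator_of_notMem (Set.disjoint_left.1 (hd hjk.symm) hxk) _
    · push Not at hx
      rw [Finset.sum_eq_zero fun k hk => Set.indicator_of_notMem (hx k hk) _, add_zero]
      exact Set.indicator_le_self' (fun _ _ => zero_le_one) _
  refine (Finset.sum_le_sum fun i _ => hpt (z i)).trans ?_
  simp

end VisitFreq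

/-! ### Uniform control of all windows, and consistency of the sample mode at fixed bandwidth. -/

section UniformConvergence

variable {X : Type*} [MetricSpace X] [MeasurableSpace X] [BorelSpace X]

lemma exists_partition_dist_le [SecondCountableTopology X] [Nonempty X] {δ : ℝ} (hδ : 0 < δ) :
    ∃ C : ℕ → Set X, (∀ k, MeasurableSet (C k)) ∧ Pairwise (Function.onFun Disjoint C) ∧
      (⋃ k, C k) = Set.univ ∧ ∀ k, ∀ x ∈ C k, ∀ y ∈ C k, dist x y ≤ δ := by
  let D : ℕ → Set X := fun k => Metric.closedBall (TopologicalSpace.denseSeq X k) (δ / 2)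
  refine ⟨disjointed D, fun k => MeasurableSet.disjointed (fun _ => measurableSet_closedBall) k,
    disjoint_disjointed D, ?_, fun k x hx y hy => ?_⟩
  · rw [iUnion_disjointed, Set.eq_univ_iff_forall]
    intro x
    obtain ⟨k, hk⟩ := (TopologicalSpace.denseRange_denseSeq X).exists_dist_lt x (half_pos hδ)
    exact Set.mem_iUnion.2 ⟨k, hk.le⟩
  · have h1 := disjointed_subset D k hx
    have h2 := disjointed_subset D k hy
    simp only [D, Metric.mem_closedBall] at h1 h2
    linarith [dist_triangle_right x y (TopologicalSpace.denseSeq X k)]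

omit [BorelSpace X] in
/-- If the visit frequencies of the cells of a fine partition converge, then all balls are
visited, uniformly, not much more often than in the limit. -/
lemma eventually_visitFreq_closedBall_le (ρ : Measure X) [IsProbabilityMeasure ρ] {δ : ℝ}
    {C : ℕ → Set X} (hCm : ∀ k, MeasurableSet (C k)) (hd : Pairwise (Function.onFun Disjoint C))
    (hU : (⋃ k, C k) = Set.univ) (hC : ∀ k, ∀ x ∈ C k, ∀ y ∈ C k, dist x y ≤ δ)
    {z : ℕ → X} {K : ℕ}
    (hz : ∀ k, Tendsto (fun M => visitFreq (C k) K M z) atTop (𝓝 (ρ.real (C k))))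
    {σ : ℝ} (hσ : 0 < σ) :
    ∀ᶠ M in atTop, ∀ y h, visitFreq (Metric.closedBall y h) K M z ≤
      ρ.real (Metric.closedBall y (h + δ)) + σ := by
  classical
  have hsum : Tendsto (fun J => ∑ k ∈ Finset.range J, ρ.real (C k)) atTop (𝓝 1) := by
    have h1 := ENNReal.tendsto_nat_tsum fun k => ρ (C k)
    rw [← measure_iUnion hd hCm, hU, measure_univ] at h1
    have h2 := (ENNReal.tendsto_toReal ENNReal.one_ne_top).comp h1
    refine h2.congr fun J => ?_
    rw [Function.comp, ENNReal.toReal_sum fun k _ => measure_ne_top _ _]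
    rfl
  -- Finitely many cells carry all but σ / 2 of the mass. The other σ / 2 is shared among their
  -- frequency errors.
  obtain ⟨J, hJ⟩ := (hsum.eventually_const_lt (show 1 - σ / 2 < 1 by linarith)).exists
  have hJ0 : (0 : ℝ) < J + 1 := by positivity
  have hev : ∀ᶠ M in atTop, ∀ k ∈ Finset.range J,
      ρ.real (C k) - σ / 2 / (J + 1) < visitFreq (C k) K M z :=
    (Finset.range J).eventually_all.2 fun k _ => (hz k).eventually_const_lt
      (by have : 0 < σ / 2 / (J + 1) := by positivity
          linarith)
  filter_upwards [hev] with M hM y h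
  -- A window is bounded from above through lower bounds for the cells that miss it. The cells that
  -- meet it lie in the ball of radius h + δ. Only J cells are involved, whence uniformity in y and
  -- h.
  let T := (Finset.range J).filter fun k => Disjoint (C k) (Metric.closedBall y h)
  let T' := (Finset.range J).filter fun k => ¬ Disjoint (C k) (Metric.closedBall y h)
  have h1 : visitFreq (Metric.closedBall y h) K M z + ∑ k ∈ T, visitFreq (C k) K M z ≤ 1 :=
    visitFreq_add_sum_le_one hd (fun k hk => (Finset.mem_filter.1 hk).2) _ _ _
  have h2 : ∑ k ∈ T, (ρ.real (C k) - σ / 2 / (J + 1)) ≤ ∑ k ∈ T, visitFreq (C k) K M z :=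
    Finset.sum_le_sum fun k hk => (hM k (Finset.mem_filter.1 hk).1).le
  have h3 : (T.card : ℝ) * (σ / 2 / (J + 1)) ≤ σ / 2 := by
    have : (T.card : ℝ) ≤ J + 1 := by
      have : T.card ≤ J := (Finset.card_filter_le _ _).trans (by simp)
      exact_mod_cast this.trans (Nat.le_succ J)
    calc (T.card : ℝ) * (σ / 2 / (J + 1)) ≤ (J + 1) * (σ / 2 / (J + 1)) := by gcongr
      _ = σ / 2 := mul_div_cancel₀ _ hJ0.ne'
  rw [Finset.sum_sub_distrib, Finset.sum_const, nsmul_eq_mul] at h2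
  have h4 : ∑ k ∈ T, ρ.real (C k) + ∑ k ∈ T', ρ.real (C k) = ∑ k ∈ Finset.range J, ρ.real (C k) :=
    Finset.sum_filter_add_sum_filter_not _ _ _
  have h5 : ∑ k ∈ T', ρ.real (C k) ≤ ρ.real (Metric.closedBall y (h + δ)) := by
    rw [← measureReal_biUnion_finset (fun i _ j _ hij => hd hij) (fun k _ => hCm k)]
    refine measureReal_mono (Set.iUnion₂_subset fun k hk x hx => ?_)
    obtain ⟨w, hw, hwB⟩ := Set.not_disjoint_iff.1 (Finset.mem_filter.1 hk).2
    rw [Metric.mem_closedBall] at hwB ⊢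
    linarith [dist_triangle x w y, hC k x hx w hw]
  linarith

omit [BorelSpace X] in
/-- If the density estimates are larger near `x` than away from `x`, the sample mode is close
to `x`. -/
lemma eventually_dist_sampleMode_lt {ν ρ : Measure X} {x : X} {h δ ε a b c : ℝ} (hab : a < b)
    (hc : 0 < c)
    (hlow : ∀ y, c ≤ ν.real (Metric.closedBall y h))
    (hfar : ∀ y, ε ≤ dist y x →
      ρ.real (Metric.closedBall y (h + δ)) ≤ a * ν.real (Metric.closedBall y h))
    (hnear : ∀ y, dist y x ≤ δ →
      b * ν.real (Metric.closedBall y h) ≤ ρ.real (Metric.closedBall x (h - δ)))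
    {z : ℕ → X} {K : ℕ}
    (hup : ∀ σ > 0, ∀ᶠ M in atTop, ∀ y, visitFreq (Metric.closedBall y h) K M z ≤
      ρ.real (Metric.closedBall y (h + δ)) + σ)
    (hz : Tendsto (fun M => visitFreq (Metric.closedBall x (h - δ)) K M z) atTop
      (𝓝 (ρ.real (Metric.closedBall x (h - δ)))))
    (hzδ : Tendsto (fun M => visitFreq (Metric.closedBall x δ) K M z) atTop
      (𝓝 (ρ.real (Metric.closedBall x δ))))
    (hpos : 0 < ρ.real (Metric.closedBall x δ)) :
    ∀ᶠ M in atTop, dist (sampleMode ν h K M z) x < ε := by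
  classical
  have hσ : 0 < (b - a) * c / 3 := by have := mul_pos (sub_pos.2 hab) hc; linarith
  -- After cross-multiplication each of the two frequency errors costs at most a third of the gap (b
  -- - a) * vi * vj, because all window volumes are at least c.
  set σ := (b - a) * c / 3 with hσdef
  filter_upwards [hup σ hσ, hz.eventually_const_lt (sub_lt_self _ hσ),
    hzδ.eventually_const_lt hpos, eventually_gt_atTop 0] with M h1 h2 h3 hM
  have hM' : (0 : ℝ) < M := by exact_mod_cast hM
  -- The maximizing draw has to be compared with an actual draw near x; there is one since the ball
  -- of radius δ has positive frequency.
  obtain ⟨i, hi, hix⟩ : ∃ i ∈ Finset.Ioc K M, dist (z i) x ≤ δ := by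
    by_contra! hne
    rw [visitFreq_eq_sum, Finset.sum_eq_zero fun i hi => ?_] at h3
    · simp at h3
    · exact Set.indicator_of_notMem (fun hm => absurd (Metric.mem_closedBall.1 hm)
        (not_le.2 (hne i hi))) _
  obtain ⟨m, hm, hmax⟩ := Finset.exists_max_image (Finset.Ioc K M) (densityScore ν h K M z) ⟨i, hi⟩
  -- The set of maximizing indices is nonempty, so its infimum is attained and is not the default
  -- value 0 of an empty set.
  have hj := Nat.sInf_mem (s := {i | i ∈ Finset.Ioc K M ∧
    ∀ j ∈ Finset.Ioc K M, densityScore ν h K M z j ≤ densityScore ν h K M z i}) ⟨m, hm, hmax⟩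
  have hmode : sampleMode ν h K M z = z (sInf {i | i ∈ Finset.Ioc K M ∧
    ∀ j ∈ Finset.Ioc K M, densityScore ν h K M z j ≤ densityScore ν h K M z i}) := rfl
  rw [hmode]
  set j := sInf {i | i ∈ Finset.Ioc K M ∧
    ∀ j ∈ Finset.Ioc K M, densityScore ν h K M z j ≤ densityScore ν h K M z i}
  by_contra! hjx
  have hvpos : ∀ y, 0 < ν.real (Metric.closedBall y h) := fun y => hc.trans_le (hlow y)
  have hscore : ∀ k, (densityScore ν h K M z k).toReal =
      visitFreq (Metric.closedBall (z k) h) K M z * M / ν.real (Metric.closedBall (z k) h) := by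
    intro k
    have : (visitFreq (Metric.closedBall (z k) h) K M z) * M =
        ((Finset.Ioc K M).filter fun j => dist (z j) (z k) ≤ h).card := by
      unfold visitFreq
      rw [div_mul_cancel₀ _ hM'.ne']
      congr!
    rw [this, densityScore, ENNReal.toReal_div, ENNReal.toReal_natCast]
    rfl
  have hle : (densityScore ν h K M z i).toReal ≤ (densityScore ν h K M z j).toReal := by
    refine ENNReal.toReal_mono ?_ (hj.2 i hi)
    refine ENNReal.div_ne_top (ENNReal.natCast_ne_top _) fun h0 => ?_
    have := hvpos (z j)
    rw [measureReal_def, h0] at this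
    simp at this
  rw [hscore, hscore, div_le_div_iff₀ (hvpos _) (hvpos _)] at hle
  have hfi : visitFreq (Metric.closedBall x (h - δ)) K M z ≤
      visitFreq (Metric.closedBall (z i) h) K M z := by
    refine visitFreq_mono (Metric.closedBall_subset_closedBall' ?_) _ _ _
    rw [dist_comm]; linarith
  have e1 : b * ν.real (Metric.closedBall (z i) h) - σ ≤
      visitFreq (Metric.closedBall (z i) h) K M z := by
    linarith [hnear (z i) hix]
  have e2 : visitFreq (Metric.closedBall (z j) h) K M z ≤
      a * ν.real (Metric.closedBall (z j) h) + σ := by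
    linarith [hfar (z j) hjx, h1 (z j)]
  have hvi := hvpos (z i)
  have hvj := hvpos (z j)
  have hci := hlow (z i)
  have hcj := hlow (z j)
  set vi := ν.real (Metric.closedBall (z i) h)
  set vj := ν.real (Metric.closedBall (z j) h)
  set fi := visitFreq (Metric.closedBall (z i) h) K M z
  set fj := visitFreq (Metric.closedBall (z j) h) K M z
  have e3 : fi * vj ≤ fj * vi := by
    refine le_of_mul_le_mul_right ?_ hM'
    linarith
  have e4 : (b * vi - σ) * vj ≤ (a * vj + σ) * vi :=
    (mul_le_mul_of_nonneg_right e1 hvj.le).trans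
      (e3.trans (mul_le_mul_of_nonneg_right e2 hvi.le))
  have hba := sub_pos.2 hab
  have e5 : σ * vi ≤ (b - a) * (vj * vi) / 3 := by
    have : (b - a) * (c * vi) ≤ (b - a) * (vj * vi) := by gcongr
    rw [hσdef]; linarith
  have e6 : σ * vj ≤ (b - a) * (vj * vi) / 3 := by
    have : (b - a) * (c * vj) ≤ (b - a) * (vi * vj) := by gcongr
    rw [hσdef]; linarith
  have e7 : 0 < (b - a) * (vj * vi) := by positivity
  linarith

/-- For draws of a law with density proportional to `f`, the sample mode with a small bandwidth is
eventually close to a well-separated maximizer of `f`.  It suffices that countably many events have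
the right asymptotic frequencies. -/
theorem exists_forall_eventually_dist_sampleMode_lt [SecondCountableTopology X] {ν ρ : Measure X}
    [IsProbabilityMeasure ρ] {r : ℝ} (hr : 0 < r) (hν : HasRegularWindows ν r) {f : X → ℝ≥0∞}
    {Z : ℝ≥0∞} (hZ0 : Z ≠ 0) (hZ : Z ≠ ∞)
    (hρ : ∀ B, MeasurableSet B → ρ B = Z⁻¹ * ∫⁻ y in B, f y ∂ν)
    {x : X} (hx : IsWellSeparatedArgmax f x) {ε : ℝ} (hε : 0 < ε) :
    ∃ h₀ > 0, ∀ h, 0 < h → h < h₀ → ∃ 𝒞 : Set (Set X), 𝒞.Countable ∧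
      (∀ C ∈ 𝒞, MeasurableSet C) ∧ ∀ (z : ℕ → X) (K : ℕ),
        (∀ C ∈ 𝒞, Tendsto (fun M => visitFreq C K M z) atTop (𝓝 (ρ.real C))) →
        ∀ᶠ M in atTop, dist (sampleMode ν h K M z) x < ε := by
  obtain ⟨hcont, hsep⟩ := hx
  -- Separation is used at ε / 2: a window of radius h + δ < ε / 2 around a point at distance at
  -- least ε from x stays at distance at least ε / 2.
  obtain ⟨c, hcx, hc⟩ := hsep (ε / 2) (half_pos hε)
  obtain ⟨t, hct, htx⟩ := exists_between hcx
  lift c to NNReal using (hct.trans htx).ne_top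
  lift t to NNReal using htx.ne_top
  have hct' : (c : ℝ) < t := by exact_mod_cast hct
  have ht0 : (0 : ℝ) < t := c.2.trans_lt hct'
  obtain ⟨δ₀, hδ₀, hball⟩ := Metric.mem_nhds_iff.1 (hcont.eventually_const_lt htx)
  have hW : 0 < Z⁻¹.toReal := ENNReal.toReal_pos (ENNReal.inv_ne_zero.2 hZ)
    (ENNReal.inv_ne_top.2 hZ0)
  set W := Z⁻¹.toReal with hWdef
  have hupper : ∀ (B : Set X) (C : NNReal), MeasurableSet B → ν B ≠ ∞ → (∀ y ∈ B, f y ≤ C) →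
      ρ.real B ≤ W * (C * ν.real B) := by
    intro B C hB hfin hle
    have h1 : ∫⁻ y in B, f y ∂ν ≤ C * ν B := by
      rw [← setLIntegral_const]
      exact setLIntegral_mono' hB hle
    rw [measureReal_def, hρ B hB, ENNReal.toReal_mul]
    refine mul_le_mul_of_nonneg_left ?_ hW.le
    have := ENNReal.toReal_mono (ENNReal.mul_ne_top ENNReal.coe_ne_top hfin) h1
    rwa [ENNReal.toReal_mul] at this
  have hlower : ∀ (B : Set X), MeasurableSet B → (∀ y ∈ B, (t : ℝ≥0∞) ≤ f y) →
      W * (t * ν.real B) ≤ ρ.real B := by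
    intro B hB hle
    have h1 : t * ν B ≤ ∫⁻ y in B, f y ∂ν := by
      rw [← setLIntegral_const]
      exact setLIntegral_mono' hB hle
    have h2 : Z⁻¹ * (t * ν B) ≤ ρ B := by
      rw [hρ B hB]; gcongr
    have := ENNReal.toReal_mono (measure_ne_top _ _) h2
    rwa [ENNReal.toReal_mul, ENNReal.toReal_mul] at this
  -- One factor η is lost in enlarging windows far from x and another in shrinking the one at x. The
  -- condition c * η * η < t keeps c * η < t / η.
  obtain ⟨η, hη, hη1⟩ : ∃ η : ℝ, c * η * η < t ∧ 1 < η := by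
    have hlim : Tendsto (fun η : ℝ => c * η * η) (𝓝[>] 1) (𝓝 c) := by
      have : Continuous fun η : ℝ => c * η * η := by fun_prop
      exact (this.tendsto' 1 c (by simp)).mono_left nhdsWithin_le_nhds
    exact ((hlim.eventually_lt_const hct').and self_mem_nhdsWithin).exists
  have hη0 : 0 < η := one_pos.trans hη1
  refine ⟨min r (min (ε / 4) (δ₀ / 2)), by positivity, fun h h0 hlt => ?_⟩
  obtain ⟨hhr, hhε, hhδ⟩ : h < r ∧ h < ε / 4 ∧ h < δ₀ / 2 := by
    simpa only [lt_min_iff] using hlt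
  obtain ⟨κ, hκ, hκν⟩ := hν.exists_le h h0 hhr
  obtain ⟨δ, hδ, hδh, hδr, hratio⟩ := hν.exists_ratio h h0 hhr η hη1
  have : Nonempty X := ⟨x⟩
  obtain ⟨C, hCm, hCd, hCU, hC⟩ := exists_partition_dist_le (X := X) hδ
  -- The cells give the uniform upper bound; the two balls at x give the lower bound for the score
  -- and a draw near x.
  refine ⟨Set.range C ∪ {Metric.closedBall x (h - δ), Metric.closedBall x δ},
    (Set.countable_range C).union (Set.toFinite _).countable, ?_, fun z K hz => ?_⟩
  · rintro _ (⟨k, rfl⟩ | rfl | rfl)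
    · exact hCm k
    · exact measurableSet_closedBall
    · exact measurableSet_closedBall
  refine eventually_dist_sampleMode_lt (ν := ν) (ρ := ρ) (δ := δ) (a := W * (c * η))
    (b := W * (t / η)) ?_ hκ hκν ?_ ?_
    (fun σ hσ => ?_) (hz _ (Or.inr (Or.inl rfl))) (hz _ (Or.inr (Or.inr rfl))) ?_
  · gcongr
    rwa [lt_div_iff₀ hη0]
  · intro y hy
    have h1 := hupper (Metric.closedBall y (h + δ)) c measurableSet_closedBall
      (hν.measure_ne_top _ (by linarith) hδr y) fun w hw => hc w (by
        rw [Metric.mem_closedBall] at hw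
        linarith [dist_triangle y w x, dist_comm y w])
    have h2 : ν.real (Metric.closedBall y (h - δ)) ≤ ν.real (Metric.closedBall y h) :=
      measureReal_mono (Metric.closedBall_subset_closedBall (by linarith))
        (hν.measure_ne_top h h0 hhr y)
    calc ρ.real (Metric.closedBall y (h + δ))
        ≤ W * (c * ν.real (Metric.closedBall y (h + δ))) := h1
      _ ≤ W * (c * (η * ν.real (Metric.closedBall y h))) := by
          have := (hratio y).trans (mul_le_mul_of_nonneg_left h2 hη0.le)
          gcongr
      _ = W * (c * η) * ν.real (Metric.closedBall y h) := by ring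
  · intro y hy
    have h1 := hlower (Metric.closedBall x (h - δ)) measurableSet_closedBall fun w hw =>
      le_of_lt (hball (by
        rw [Metric.mem_closedBall] at hw
        rw [Metric.mem_ball]; linarith))
    have h2 : ν.real (Metric.closedBall y h) ≤ ν.real (Metric.closedBall x (h + δ)) :=
      measureReal_mono (Metric.closedBall_subset_closedBall' (by linarith))
        (hν.measure_ne_top _ (by linarith) hδr x)
    calc W * (t / η) * ν.real (Metric.closedBall y h)
        ≤ W * (t / η) * (η * ν.real (Metric.closedBall x (h - δ))) := by
          have := h2.trans (hratio x)
          gcongr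
      _ = W * (t * ν.real (Metric.closedBall x (h - δ))) := by field_simp
      _ ≤ _ := h1
  · filter_upwards [eventually_visitFreq_closedBall_le ρ hCm hCd hCU hC
      (fun k => hz _ (Or.inl ⟨k, rfl⟩)) hσ] with M hM y using hM y h
  · obtain ⟨κ', hκ', hκν'⟩ := hν.exists_le δ hδ (by linarith)
    refine lt_of_lt_of_le ?_ (hlower (Metric.closedBall x δ) measurableSet_closedBall fun w hw =>
      le_of_lt (hball (by
        rw [Metric.mem_closedBall] at hw
        rw [Metric.mem_ball]; linarith)))
    have := hκ'.trans_le (hκν' x)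
    positivity

end UniformConvergence

/-! ### The sample mode of an APS run. -/

section ModeOfRun

variable {X Y : Type*} [MetricSpace X] [MeasurableSpace X] [BorelSpace X] [MeasurableSpace Y]

/-- Consistency of the sample mode of the APS sampler. -/
theorem exists_forall_ae_dist_sampleMode_apsRun_lt {ν : Measure X} [IsDiscreteOrInterval ν]
    (g : CondDensity X ν) (hg : g.IsSymmetric) (hirr : Kernel.IsIrreducible ν g.kernel)
    (L : Kernel X Y) [IsMarkovKernel L] {u : X × Y → ℝ} (hu : Measurable u)
    (hpos : ∀ s, 0 < u s) (hfin : apsTarget ν L u Set.univ ≠ ∞) {x : X}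
    (hx : IsWellSeparatedArgmax (fun a => ∫⁻ y, ENNReal.ofReal (u (a, y)) ∂L a) x)
    {ε : ℝ} (hε : 0 < ε) :
    ∃ h₀ > 0, ∀ h, 0 < h → h < h₀ → ∀ (x₀ : X) (K : ℕ),
      ∀ᵐ z ∂(apsRun g.kernel L u hu x₀), ∀ᶠ M in atTop,
        dist (sampleMode ν h K M fun i => (z i).1) x < ε := by
  have := IsDiscreteOrInterval.secondCountableTopology ν
  have : Nonempty X := ⟨x⟩
  have hν := IsDiscreteOrInterval.ne_zero ν
  have hT0 := apsTarget_ne_zero (ν := ν) L hu hν hpos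
  have := isProbabilityMeasure_normalized hT0 hfin
  have hprob : IsProbabilityMeasure ((normalized (apsTarget ν L u)).map Prod.fst) :=
    Measure.isProbabilityMeasure_map measurable_fst.aemeasurable
  -- Integrating out y leaves the expected utility as the unnormalized density of the x-marginal.
  have hρ : ∀ B, MeasurableSet B → ((normalized (apsTarget ν L u)).map Prod.fst) B =
      (apsTarget ν L u Set.univ)⁻¹ * ∫⁻ a in B, ∫⁻ y, ENNReal.ofReal (u (a, y)) ∂L a ∂ν := by
    intro B hB
    rw [Measure.map_apply measurable_fst hB, normalized, Measure.smul_apply, smul_eq_mul]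
    congr 1
    rw [apsTarget, withDensity_apply _ (hB.preimage measurable_fst), ← Set.prod_univ,
      Measure.setLIntegral_compProd (by fun_prop) hB .univ]
    simp
  obtain ⟨h₀, hh₀, H⟩ := exists_forall_eventually_dist_sampleMode_lt one_pos
    (IsDiscreteOrInterval.hasRegularWindows ν) (by simpa using hT0) hfin hρ hx hε
  refine ⟨h₀, hh₀, fun h h0 hlt x₀ K => ?_⟩
  obtain ⟨𝒞, h𝒞, hm, H⟩ := H h h0 hlt
  have hae : ∀ᵐ z ∂(apsRun g.kernel L u hu x₀), ∀ C ∈ 𝒞, ∀ K,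
      Tendsto (fun M => visitFreq C K M fun i => (z i).1) atTop
        (𝓝 (((normalized (apsTarget ν L u)).map Prod.fst).real C)) :=
    (ae_ball_iff h𝒞).2 fun C hC =>
      ae_tendsto_visitFreq_apsRun g L hu hg hpos hirr hν hfin x₀ (hm C hC)
  filter_upwards [hae] with z hz
  exact H _ K fun C hC => hz C hC K

end ModeOfRun

/-! ### Measurability of the sample mode and of chain laws in a parameter. -/

section Measurability

lemma measurable_sampleMode {X : Type*} [MetricSpace X] [SecondCountableTopology X]
    [MeasurableSpace X] [BorelSpace X] (ν : Measure X) [SFinite ν] (h : ℝ) (K M : ℕ) :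
    Measurable (sampleMode ν h K M) := by
  classical
  have hball : Measurable fun x : X => ν (Metric.closedBall x h) := by
    have hs : MeasurableSet {p : X × X | dist p.2 p.1 ≤ h} :=
      measurableSet_le (by fun_prop) measurable_const
    exact measurable_measure_prodMk_left hs
  have hscore : ∀ i, Measurable fun z : ℕ → X => densityScore ν h K M z i := by
    intro i
    refine Measurable.div ?_ (hball.comp (measurable_pi_apply i))
    simp_rw [Finset.card_filter, Nat.cast_sum]
    refine Finset.measurable_sum _ fun j _ => ?_
    have hs : MeasurableSet {z : ℕ → X | dist (z j) (z i) ≤ h} :=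
      measurableSet_le (by fun_prop) measurable_const
    have : (fun z : ℕ → X => (((if dist (z j) (z i) ≤ h then 1 else 0 : ℕ) : ℕ) : ℝ≥0∞)) =
        {z : ℕ → X | dist (z j) (z i) ≤ h}.indicator 1 := by
      ext z
      by_cases hz : dist (z j) (z i) ≤ h <;> simp [hz]
    rw [this]
    exact measurable_one.indicator hs
  let s : ℕ → Set (ℕ → X) := fun i => {z | i ∈ Finset.Ioc K M ∧
    ∀ j ∈ Finset.Ioc K M, densityScore ν h K M z j ≤ densityScore ν h K M z i}
  have hs : ∀ i, MeasurableSet (s i) := by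
    intro i
    refine (MeasurableSet.const _).inter ?_
    change MeasurableSet {z : ℕ → X | ∀ j ∈ Finset.Ioc K M,
      densityScore ν h K M z j ≤ densityScore ν h K M z i}
    simp only [Set.ofPred_forall]
    exact MeasurableSet.iInter fun j => MeasurableSet.iInter fun _ =>
      measurableSet_le (hscore j) (hscore i)
  have hidx : Measurable fun z : ℕ → X => sInf {i | z ∈ s i} := by
    refine measurable_to_countable' fun n => ?_
    -- Either n is the first maximizing index, or no index is maximizing and n = 0, the infimum of
    -- the empty set.
    have : (fun z : ℕ → X => sInf {i | z ∈ s i}) ⁻¹' {n} =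
        (s n ∩ ⋂ k ∈ Finset.range n, (s k)ᶜ) ∪ ({z | n = 0} ∩ ⋂ k, (s k)ᶜ) := by
      ext z
      simp only [Set.mem_preimage, Set.mem_singleton_iff, Set.mem_union, Set.mem_inter_iff,
        Set.mem_iInter, Finset.mem_range, Set.mem_compl_iff, Set.mem_ofPred_eq]
      constructor
      · intro hz
        by_cases hne : ({i | z ∈ s i}).Nonempty
        · left
          refine ⟨hz ▸ Nat.sInf_mem hne, fun k hk => ?_⟩
          exact Nat.notMem_of_lt_sInf (hz ▸ hk)
        · right
          rw [Set.not_nonempty_iff_eq_empty] at hne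
          refine ⟨by rw [← hz, hne, Nat.sInf_empty], fun k hk => ?_⟩
          have : k ∈ ({i | z ∈ s i} : Set ℕ) := hk
          rw [hne] at this
          exact this
      · rintro (⟨hn, hk⟩ | ⟨rfl, hk⟩)
        · refine le_antisymm (Nat.sInf_le hn) ?_
          by_contra! hlt
          exact hk _ hlt (Nat.sInf_mem (s := {i | z ∈ s i}) ⟨n, hn⟩)
        · have : ({i | z ∈ s i} : Set ℕ) = ∅ := Set.eq_empty_of_forall_notMem hk
          rw [this, Nat.sInf_empty]
    rw [this]
    exact ((hs n).inter (Finset.measurableSet_biInter _ fun k _ => (hs k).compl)).union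
      ((MeasurableSet.const _).inter (MeasurableSet.iInter fun k => (hs k).compl))
  have heval : Measurable fun p : (ℕ → X) × ℕ => p.1 p.2 :=
    measurable_from_prod_countable_left fun n => measurable_pi_apply n
  exact heval.comp (measurable_id.prodMk hidx)

variable {P S : Type*} [MeasurableSpace P] [MeasurableSpace S]

/-- The laws of Markov chains whose initial law and transition probabilities depend measurably on
a parameter depend measurably on it. -/
lemma measurable_chainLaw (μ : Kernel P S) [IsMarkovKernel μ] (κ : Kernel (P × S) S)
    [IsMarkovKernel κ] (κ' : P → Kernel S S) [∀ p, IsMarkovKernel (κ' p)]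
    (hκ : ∀ p s, κ' p s = κ (p, s)) :
    Measurable fun p => chainLaw (μ p) (κ' p) := by
  -- The laws of initial segments are built inductively as kernels in the parameter; they determine
  -- the probabilities of cylinders, which generate the σ-algebra.
  have key : ∀ n, ∃ m : Kernel P (Finset.Iic n → S), IsMarkovKernel m ∧
      ∀ p, (chainLaw (μ p) (κ' p)).map (Preorder.frestrictLe (π := fun _ => S) n) = m p := by
    intro n
    induction n with
    | zero =>
      refine ⟨μ.map fun s _ => s, Kernel.IsMarkovKernel.map _ (by fun_prop), fun p => ?_⟩
      have : (Preorder.frestrictLe (π := fun _ => S) 0) =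
          (fun s _ => s) ∘ (fun z : ℕ → S => z 0) := by
        ext z ⟨i, hi⟩
        obtain rfl : i = 0 := by simpa using hi
        rfl
      rw [Kernel.map_apply _ (by fun_prop), this, ← Measure.map_map (by fun_prop) (by fun_prop),
        chainLaw_eq_bind, map_zero_bind_pathKernel]
    | succ n ih =>
      obtain ⟨m, hm, h⟩ := ih
      let c : P × (Finset.Iic n → S) → P × S := fun q => (q.1, q.2 ⟨n, by simp⟩)
      have hc : Measurable c := by fun_prop
      refine ⟨(m ⊗ₖ κ.comap c hc).map (snocPath n),
        Kernel.IsMarkovKernel.map _ (measurable_snocPath n), fun p => ?_⟩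
      refine Measure.ext fun C hC => ?_
      have hf : Measurable fun q => C.indicator (1 : (Finset.Iic (n + 1) → S) → ℝ≥0∞)
          (snocPath n q) := (measurable_one.indicator hC).comp (measurable_snocPath n)
      rw [← lintegral_indicator_one hC, lintegral_map (measurable_one.indicator hC) (by fun_prop),
        Kernel.map_apply _ (measurable_snocPath n), ← lintegral_indicator_one hC,
        lintegral_map (measurable_one.indicator hC) (measurable_snocPath n),
        Kernel.lintegral_compProd _ _ _ hf, ← h p, lintegral_map _ (by fun_prop)]
      · simp only [frestrictLe_succ]
        rw [isMarkovChain_chainLaw (μ p) (κ' p) n _ hf]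
        simp only [hκ]
        rfl
      · exact Measurable.lintegral_kernel_prod_right
          (κ := κ.comap (fun y : Finset.Iic n → S => c (p, y)) (by fun_prop))
          (f := fun y s => C.indicator 1 (snocPath n (y, s))) hf
  refine Measurable.measure_of_isPiSystem_of_isProbabilityMeasure
    (generateFrom_measurableCylinders (α := fun _ : ℕ => S)).symm isPiSystem_measurableCylinders ?_
  intro s hs
  obtain ⟨I, C, hC, rfl⟩ := (mem_measurableCylinders s).1 hs
  obtain ⟨m, hm, h⟩ := key (I.sup id)
  have hI : I ⊆ Finset.Iic (I.sup id) := I.subset_Iic_sup_id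
  have hC' : MeasurableSet (Finset.restrict₂ (π := fun _ => S) hI ⁻¹' C) :=
    hC.preimage (Finset.measurable_restrict₂ (X := fun _ => S) hI)
  have : (fun p => chainLaw (μ p) (κ' p) (cylinder I C)) =
      fun p => m p (Finset.restrict₂ (π := fun _ => S) hI ⁻¹' C) := by
    funext p
    rw [← h p, Measure.map_apply (by fun_prop) hC']
    rfl
  rw [this]
  exact Kernel.measurable_coe m hC'

end Measurability

/-! ### Diagonal choice of the bandwidth index. -/

section Diagonal

/-- A slow inverse of n: at time N take the largest m ≤ N with n m ≤ N. The comparison is only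
eventual, since before time n 0 there may be no such m. -/
lemma exists_tendsto_atTop_le (n : ℕ → ℕ) :
    ∃ ψ : ℕ → ℕ, Tendsto ψ atTop atTop ∧ ∀ᶠ N in atTop, n (ψ N) ≤ N := by
  refine ⟨fun N => Nat.findGreatest (fun m => n m ≤ N) N, tendsto_atTop.2 fun m => ?_, ?_⟩
  · filter_upwards [eventually_ge_atTop (max m (n m))] with N hN
    exact Nat.le_findGreatest ((le_max_left _ _).trans hN) ((le_max_right _ _).trans hN)
  · filter_upwards [eventually_ge_atTop (n 0)] with N hN
    exact Nat.findGreatest_spec (P := fun m => n m ≤ N) (Nat.zero_le N) hN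

variable {Z : Type*} [MeasurableSpace Z]

/-- Almost sure convergence along a diagonal sequence. -/
lemma exists_diagonal_ae_tendsto (μ : Measure Z) [IsFiniteMeasure μ] {D : ℕ → ℕ → Z → ℝ}
    (hD : ∀ k N, Measurable (D k N))
    (H : ∀ ε > 0, ∀ᵐ z ∂μ, ∃ k₀, ∀ k ≥ k₀, ∀ᶠ N in atTop, D k N z < ε) :
    ∃ φ : ℕ → ℕ, Tendsto φ atTop atTop ∧ ∀ᵐ z ∂μ, ∀ ε > 0, ∀ᶠ N in atTop, D (φ N) N z < ε := by
  -- As in Egorov's theorem: some index k ≥ m and time n are such that an error of at least ε at or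
  -- after n has probability at most p.
  have step : ∀ (ε : ℝ) (m : ℕ) (p : ℝ≥0∞), 0 < ε → 0 < p →
      ∃ k ≥ m, ∃ n, μ {z | ∃ N, n ≤ N ∧ ε ≤ D k N z} ≤ p := by
    intro ε m p hε hp
    let B : ℕ → ℕ → Set Z := fun k n => {z | ∃ N, n ≤ N ∧ ε ≤ D k N z}
    have hB : ∀ k n, MeasurableSet (B k n) := by
      intro k n
      simp only [B, Set.ofPred_exists]
      exact MeasurableSet.iUnion fun N => (MeasurableSet.const _).inter
        (measurableSet_le measurable_const (hD k N))
    -- A k: some index k' ≥ k errs at arbitrarily late times. By `H` these events decrease to a null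
    -- set, so one index can be fixed first and the time afterwards.
    let A : ℕ → Set Z := fun k => ⋃ k' ∈ Set.Ici k, ⋂ n, B k' n
    have hA : ∀ k, MeasurableSet (A k) := fun k =>
      MeasurableSet.biUnion (Set.to_countable _) fun k' _ => MeasurableSet.iInter fun n => hB k' n
    have hAanti : Antitone A := fun k k' hk =>
      Set.biUnion_subset_biUnion_left (Set.Ici_subset_Ici.2 hk)
    have hA0 : μ (⋂ k, A k) = 0 := by
      refine measure_eq_zero_iff_ae_notMem.2 ?_
      filter_upwards [H ε hε] with z hz hmem
      obtain ⟨k₀, hk₀⟩ := hz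
      obtain ⟨k, hk, hkz⟩ := Set.mem_iUnion₂.1 (Set.mem_iInter.1 hmem k₀)
      obtain ⟨n, hn⟩ := eventually_atTop.1 (hk₀ k hk)
      obtain ⟨N, hN, hN'⟩ := Set.mem_iInter.1 hkz n
      exact absurd (hn N hN) (not_lt.2 hN')
    have h1 := tendsto_measure_iInter_atTop (μ := μ) (fun k => (hA k).nullMeasurableSet) hAanti
      ⟨0, measure_ne_top _ _⟩
    rw [hA0] at h1
    obtain ⟨k, hk, hkm⟩ := ((h1.eventually_lt_const hp).and (eventually_ge_atTop m)).exists
    have hBanti : Antitone (B k) := fun n n' hn z ⟨N, hN, h⟩ => ⟨N, hn.trans hN, h⟩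
    have h2 := tendsto_measure_iInter_atTop (μ := μ) (fun n => (hB k n).nullMeasurableSet) hBanti
      ⟨0, measure_ne_top _ _⟩
    have h3 : μ (⋂ n, B k n) < p :=
      (measure_mono (Set.subset_biUnion_of_mem (u := fun k' => ⋂ n, B k' n)
        (Set.mem_Ici.2 le_rfl))).trans_lt hk
    obtain ⟨n, hn⟩ := (h2.eventually_lt_const h3).exists
    exact ⟨k, hkm, n, hn.le⟩
  -- Summable error budgets, so that by Borel-Cantelli almost every z is eventually good; ψ delays
  -- each index until its time n m has passed.
  obtain ⟨p, hp, hsum⟩ := ENNReal.exists_pos_sum_of_countable one_ne_zero ℕ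
  choose k hk n hn using fun m : ℕ =>
    step (1 / (m + 1)) m (p m) Nat.one_div_pos_of_nat (by exact_mod_cast hp m)
  obtain ⟨ψ, hψ, hψn⟩ := exists_tendsto_atTop_le n
  refine ⟨k ∘ ψ, (tendsto_atTop_mono hk tendsto_id).comp hψ, ?_⟩
  have hfin : ∑' m, μ {z | ∃ N, n m ≤ N ∧ 1 / ((m : ℝ) + 1) ≤ D (k m) N z} ≠ ∞ :=
    ne_top_of_le_ne_top (hsum.trans ENNReal.one_lt_top).ne (ENNReal.tsum_le_tsum hn)
  filter_upwards [ae_eventually_notMem hfin] with z hz ε hε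
  obtain ⟨m₀, hm₀⟩ := exists_nat_one_div_lt hε
  filter_upwards [hψ.eventually hz, hψn, hψ.eventually (eventually_ge_atTop m₀)] with N h1 h2 h3
  by_contra! h4
  refine h1 ⟨N, h2, le_trans ?_ h4⟩
  refine le_trans ?_ hm₀.le
  gcongr

end Diagonal

/-! ### Joint measurability of the inner loop in the type and the defense. -/

section InnerSampler

variable {D A Θ Ω : Type*} [MeasurableSpace D] [MeasurableSpace A] [MeasurableSpace Θ]
  [MeasurableSpace Ω] {νA : Measure A} {νΘ : Measure Θ} [SFinite νA] [SFinite νΘ]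
  (gA : CondDensity A νA) (PA : CondDensity (Ω × D × A) νΘ)
  (UA : Ω → A × Θ → ℝ) (hUA : Measurable (Function.uncurry UA))

/-- The proposals of the inner loop, as a kernel in the Attacker's type, the defense and the
state. -/
def innerProposal : Kernel ((Ω × D) × (A × Θ)) (A × Θ) :=
  (gA.kernel.comap (fun q : (Ω × D) × (A × Θ) => q.2.1) (by fun_prop)) ⊗ₖ
    (PA.kernel.comap (fun r : ((Ω × D) × (A × Θ)) × A => (r.1.1.1, r.1.1.2, r.2)) (by fun_prop))

instance : IsMarkovKernel (innerProposal gA PA) := by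
  unfold innerProposal; infer_instance

lemma innerProposal_apply (p : Ω × D) (s : A × Θ) :
    innerProposal gA PA (p, s) =
      apsProposal gA.kernel (attackerOutcomeKernel PA p.1 p.2) s := by
  rw [apsProposal_apply, innerProposal, Kernel.compProd_apply_eq_compProd_sectR,
    Kernel.comap_apply]
  congr 1

/-- The transitions of the inner loop, as a kernel in the Attacker's type, the defense and the
state. -/
def innerTransition : Kernel ((Ω × D) × (A × Θ)) (A × Θ) :=
  (innerProposal gA PA).withDensity (fun q t => apsAcceptance (UA q.1.1) q.2 t) +
    (Kernel.deterministic Prod.snd measurable_snd).withDensity fun q _ =>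
      ∫⁻ t, (1 - apsAcceptance (UA q.1.1) q.2 t) ∂(innerProposal gA PA q)

include hUA in
omit [SFinite νA] [SFinite νΘ] [MeasurableSpace D] in
lemma measurable_innerAcceptance [MeasurableSpace D] : Measurable (Function.uncurry
    fun (q : (Ω × D) × (A × Θ)) (t : A × Θ) => apsAcceptance (UA q.1.1) q.2 t) := by
  have h1 : Measurable fun r : ((Ω × D) × (A × Θ)) × (A × Θ) => UA r.1.1.1 r.2 :=
    hUA.comp (by fun_prop : Measurable fun r : ((Ω × D) × (A × Θ)) × (A × Θ) => (r.1.1.1, r.2))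
  have h2 : Measurable fun r : ((Ω × D) × (A × Θ)) × (A × Θ) => UA r.1.1.1 r.1.2 :=
    hUA.comp (by fun_prop : Measurable fun r : ((Ω × D) × (A × Θ)) × (A × Θ) => (r.1.1.1, r.1.2))
  exact (measurable_const.min (h1.div h2)).ennreal_ofReal

/-- Exhibits the kernels for fixed (ω, d) as sections of one kernel, as required for
`measurable_chainLaw`. -/
lemma innerKernel_apply (p : Ω × D) (s : A × Θ) :
    innerKernel gA PA UA hUA p.1 p.2 s = innerTransition gA PA UA (p, s) := by
  have hα := measurable_innerAcceptance (D := D) UA hUA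
  have hr : Measurable (Function.uncurry fun (q : (Ω × D) × (A × Θ)) (_ : A × Θ) =>
      ∫⁻ t, (1 - apsAcceptance (UA q.1.1) q.2 t) ∂(innerProposal gA PA q)) := by
    have : Measurable fun q : (Ω × D) × (A × Θ) =>
        ∫⁻ t, (1 - apsAcceptance (UA q.1.1) q.2 t) ∂(innerProposal gA PA q) :=
      Measurable.lintegral_kernel_prod_right
        (f := fun (q : (Ω × D) × (A × Θ)) t => 1 - apsAcceptance (UA q.1.1) q.2 t)
        (measurable_const.sub hα)
    exact this.comp measurable_fst
  refine Measure.ext fun C hC => ?_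
  have hu : Measurable (UA p.1) := hUA.comp measurable_prodMk_left
  rw [← lintegral_indicator_one hC, ← lintegral_indicator_one hC]
  refine (lintegral_mhKernel (apsProposal gA.kernel (attackerOutcomeKernel PA p.1 p.2))
    (measurable_apsAcceptance hu) (measurable_one.indicator hC) s).trans ?_
  rw [innerTransition, _root_.add_apply, lintegral_add_measure,
    Kernel.lintegral_withDensity _ hα _ (measurable_one.indicator hC),
    Kernel.lintegral_withDensity _ hr _ (measurable_one.indicator hC), Kernel.deterministic_apply,
    lintegral_const_mul _ (measurable_one.indicator hC),
    lintegral_dirac' _ (measurable_one.indicator hC), innerProposal_apply]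

instance (ω : Ω) (d : D) : IsMarkovKernel (innerKernel gA PA UA hUA ω d) :=
  inferInstanceAs (IsMarkovKernel (apsKernel gA.kernel (attackerOutcomeKernel PA ω d) (UA ω)
    (show Measurable (UA ω) from hUA.comp measurable_prodMk_left)))

lemma measurable_innerRun (a₀ : A) :
    Measurable fun p : Ω × D => innerRun gA PA UA hUA p.1 p.2 a₀ := by
  have : IsMarkovKernel (innerTransition gA PA UA) :=
    ⟨fun q => by rw [← innerKernel_apply gA PA UA hUA q.1 q.2]; infer_instance⟩
  let μ : Kernel (Ω × D) (A × Θ) :=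
    (PA.kernel.comap (fun p : Ω × D => (p.1, p.2, a₀)) (by fun_prop)).map (Prod.mk a₀)
  have hμ : IsMarkovKernel μ := Kernel.IsMarkovKernel.map _ (by fun_prop)
  have h := measurable_chainLaw μ (innerTransition gA PA UA)
    (fun p => innerKernel gA PA UA hUA p.1 p.2) (innerKernel_apply gA PA UA hUA)
  convert h using 2 with p
  change chainLaw (drawFrom (attackerOutcomeKernel PA p.1 p.2) a₀)
    (innerKernel gA PA UA hUA p.1 p.2) = _
  congr 1
  rw [drawFrom, Kernel.prod_apply, Kernel.id_apply, Measure.dirac_prod,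
    Kernel.map_apply _ (by fun_prop)]
  rfl

instance (ω : Ω) (d : D) (a₀ : A) : IsProbabilityMeasure (innerRun gA PA UA hUA ω d a₀) :=
  inferInstanceAs (IsProbabilityMeasure (chainLaw
    (drawFrom (attackerOutcomeKernel PA ω d) a₀) (innerKernel gA PA UA hUA ω d)))

/-- The law of the draws of the inner loop, as a kernel in the Attacker's type and the defense. -/
def innerRunKernel (a₀ : A) : Kernel (Ω × D) (ℕ → A × Θ) where
  toFun p := innerRun gA PA UA hUA p.1 p.2 a₀
  measurable' := measurable_innerRun gA PA UA hUA a₀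

instance (a₀ : A) : IsMarkovKernel (innerRunKernel gA PA UA hUA a₀) :=
  ⟨fun p => inferInstanceAs (IsProbabilityMeasure (innerRun gA PA UA hUA p.1 p.2 a₀))⟩

end InnerSampler

/-! ### The returned attack as a random variable and as a kernel. -/

section SampleAttack

variable {D A Θ Ω : Type*} [MeasurableSpace D] [MetricSpace A] [SecondCountableTopology A]
  [MeasurableSpace A] [BorelSpace A] [MeasurableSpace Θ]
  [MeasurableSpace Ω] {νA : Measure A} {νΘ : Measure Θ} [SFinite νA] [SFinite νΘ]
  (P : Measure Ω) [IsProbabilityMeasure P]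
  (gA : CondDensity A νA) (PA : CondDensity (Ω × D × A) νΘ)
  (UA : Ω → A × Θ → ℝ) (hUA : Measurable (Function.uncurry UA))

lemma measurable_sampleMode_fst (h : ℝ) (K M : ℕ) :
    Measurable fun z : ℕ → A × Θ => sampleMode νA h K M fun i => (z i).1 :=
  (measurable_sampleMode νA h K M).comp
    (measurable_pi_lambda _ fun i => measurable_fst.comp (measurable_pi_apply i))

/-- The joint law of the Attacker's type and the draws of the inner loop. -/
def innerJoint (d : D) (a₀ : A) : Measure (Ω × (ℕ → A × Θ)) :=
  P ⊗ₘ ((innerRunKernel gA PA UA hUA a₀).comap (fun ω => (ω, d)) (by fun_prop))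

instance (d : D) (a₀ : A) : IsProbabilityMeasure (innerJoint P gA PA UA hUA d a₀) := by
  unfold innerJoint; infer_instance

/-- For all bandwidths and run lengths the returned attacks live on one probability space, that of
the type and the draws, so almost sure limits make sense. Measurability in ω makes the `bind` a
genuine mixture. -/
lemma sampleAttack_eq_map (d : D) (a₀ : A) (h : ℝ) (K M : ℕ) :
    sampleAttack P gA PA UA hUA d a₀ h K M =
      (innerJoint P gA PA UA hUA d a₀).map
        fun q => sampleMode νA h K M fun i => (q.2 i).1 := by
  have hm := measurable_sampleMode_fst (νA := νA) (Θ := Θ) h K M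
  have hm2 : Measurable fun q : Ω × (ℕ → A × Θ) => sampleMode νA h K M fun i => (q.2 i).1 :=
    hm.comp measurable_snd
  have h1 : Measurable fun ω => innerRun gA PA UA hUA ω d a₀ := by
    have h := measurable_innerRun gA PA UA hUA a₀
    have hd : Measurable fun ω : Ω => (ω, d) := by fun_prop
    have h2 := h.comp hd
    exact h2
  have hR : Measurable fun ω => (innerRun gA PA UA hUA ω d a₀).map fun z =>
      sampleMode νA h K M fun i => (z i).1 :=
    (Measure.measurable_map _ hm).comp h1
  refine Measure.ext fun C hC => ?_
  unfold sampleAttack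
  rw [Measure.bind_apply hC hR.aemeasurable, Measure.map_apply hm2 hC, innerJoint,
    Measure.compProd_apply (hC.preimage hm2)]
  refine lintegral_congr fun ω => ?_
  rw [Measure.map_apply hm hC]
  rfl

lemma exists_kernel_eq_sampleAttack (a₀ : A) (h : ℝ) (K M : ℕ) :
    ∃ (q : Kernel D A) (_ : IsMarkovKernel q),
      ∀ d, q d = sampleAttack P gA PA UA hUA d a₀ h K M := by
  have hm := measurable_sampleMode_fst (νA := νA) (Θ := Θ) h K M
  have hm2 : Measurable fun q : Ω × (ℕ → A × Θ) => sampleMode νA h K M fun i => (q.2 i).1 :=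
    hm.comp measurable_snd
  let q : Kernel D A := ((innerRunKernel gA PA UA hUA a₀).map
    fun z => sampleMode νA h K M fun i => (z i).1) ∘ₖ (Kernel.const D P ×ₖ Kernel.id)
  have hq : IsMarkovKernel q := by
    have := Kernel.IsMarkovKernel.map (innerRunKernel gA PA UA hUA a₀) hm
    infer_instance
  refine ⟨q, hq, fun d => ?_⟩
  refine Measure.ext fun C hC => ?_
  rw [sampleAttack_eq_map, Measure.map_apply hm2 hC, innerJoint,
    Measure.compProd_apply (hC.preimage hm2), Kernel.comp_apply' _ _ _ hC,
    Kernel.prod_apply, Kernel.const_apply, Kernel.id_apply,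
    lintegral_prod _ (Kernel.measurable_coe _ hC).aemeasurable]
  refine lintegral_congr fun ω => ?_
  rw [lintegral_dirac' d (f := fun y => ((innerRunKernel gA PA UA hUA a₀).map
      fun z => sampleMode νA h K M fun i => (z i).1) (ω, y) C)
    ((Kernel.measurable_coe _ hC).comp measurable_prodMk_left), Kernel.map_apply' _ hm _ hC]
  rfl

end SampleAttack

/-! ### Augmented distributions and expected utilities in the form of the APS sampler. -/

section Targets

variable {X Y : Type*} [MeasurableSpace X] [MeasurableSpace Y]

/-- Moves the outcome density from the weight into the sampling kernel, so that only the utility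
remains as weight. -/
lemma withDensity_mul_compProd {ν : Measure X} [SFinite ν] {κ L : Kernel X Y} [IsSFiniteKernel κ]
    [IsSFiniteKernel L] {f : X → Y → ℝ≥0∞} (hf : Measurable (Function.uncurry f))
    (hL : L = κ.withDensity f) {u : X × Y → ℝ≥0∞} (hu : Measurable u) :
    (ν ⊗ₘ κ).withDensity (fun s => u s * f s.1 s.2) = (ν ⊗ₘ L).withDensity u := by
  have hm : Measurable fun s : X × Y => u s * f s.1 s.2 := hu.mul hf
  refine Measure.ext fun C hC => ?_
  rw [withDensity_apply _ hC, withDensity_apply _ hC, ← lintegral_indicator hC,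
    ← lintegral_indicator hC, Measure.lintegral_compProd (hm.indicator hC),
    Measure.lintegral_compProd (hu.indicator hC)]
  refine lintegral_congr fun x => ?_
  have hux : Measurable fun y => C.indicator u (x, y) :=
    (hu.indicator hC).comp measurable_prodMk_left
  rw [hL, Kernel.lintegral_withDensity _ hf _ hux]
  refine lintegral_congr fun y => ?_
  by_cases h : (x, y) ∈ C <;> simp [h, mul_comm]

variable {D A Θ Ω : Type*} [MeasurableSpace D] [MeasurableSpace A] [MeasurableSpace Θ]
  [MeasurableSpace Ω] {νΘ : Measure Θ} [SFinite νΘ]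

lemma attackerOutcomeKernel_eq (PA : CondDensity (Ω × D × A) νΘ) (ω : Ω) (d : D) :
    attackerOutcomeKernel PA ω d =
      (Kernel.const A νΘ).withDensity fun a θ => ENNReal.ofReal (PA.p (ω, d, a) θ) := by
  have hm : Measurable (Function.uncurry fun (a : A) θ => ENNReal.ofReal (PA.p (ω, d, a) θ)) :=
    PA.measurable_ofReal.comp
      (by fun_prop : Measurable fun r : A × Θ => ((ω, d, r.1), r.2))
  ext1 a
  rw [attackerOutcomeKernel, Kernel.comap_apply, CondDensity.kernel_apply,
    Kernel.withDensity_apply _ hm, Kernel.const_apply]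

lemma attackerTarget_eq {νA : Measure A} [SFinite νA] (PA : CondDensity (Ω × D × A) νΘ) (ω : Ω)
    (d : D) {u : A × Θ → ℝ} (hu : Measurable u) :
    attackerTarget νA νΘ (fun a θ => u (a, θ)) (fun a => PA.p (ω, d, a)) =
      normalized (apsTarget νA (attackerOutcomeKernel PA ω d) u) := by
  have hm : Measurable (Function.uncurry fun (a : A) θ => ENNReal.ofReal (PA.p (ω, d, a) θ)) :=
    PA.measurable_ofReal.comp
      (by fun_prop : Measurable fun r : A × Θ => ((ω, d, r.1), r.2))
  rw [apsTarget, ← withDensity_mul_compProd hm (attackerOutcomeKernel_eq PA ω d) hu.ennreal_ofReal,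
    attackerTarget, Measure.compProd_const]
  congr 2
  funext s
  exact ENNReal.ofReal_mul' (PA.nonneg _ _)

lemma apsTarget_attackerOutcomeKernel_univ_ne_top {νA : Measure A} [SFinite νA]
    (PA : CondDensity (Ω × D × A) νΘ) (ω : Ω) (d : D) {u : A × Θ → ℝ} (hu : Measurable u)
    (hint : Integrable (fun s : A × Θ => u (s.1, s.2) * PA.p (ω, d, s.1) s.2) (νA.prod νΘ)) :
    apsTarget νA (attackerOutcomeKernel PA ω d) u Set.univ ≠ ∞ := by
  have hm : Measurable (Function.uncurry fun (a : A) θ => ENNReal.ofReal (PA.p (ω, d, a) θ)) :=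
    PA.measurable_ofReal.comp
      (by fun_prop : Measurable fun r : A × Θ => ((ω, d, r.1), r.2))
  rw [apsTarget, ← withDensity_mul_compProd hm (attackerOutcomeKernel_eq PA ω d) hu.ennreal_ofReal,
    Measure.compProd_const, withDensity_apply _ .univ, Measure.restrict_univ]
  refine ne_of_lt (lt_of_eq_of_lt ?_ hint.lintegral_lt_top)
  exact lintegral_congr fun s => (ENNReal.ofReal_mul' (PA.nonneg _ _)).symm

lemma attackerExpectedUtility_eq (PA : CondDensity (Ω × D × A) νΘ) (ω : Ω)
    (d : D) {u : A × Θ → ℝ} (hu : Measurable u) :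
    attackerExpectedUtility νΘ (fun a θ => u (a, θ)) (fun a => PA.p (ω, d, a)) =
      fun a => ∫⁻ θ, ENNReal.ofReal (u (a, θ)) ∂attackerOutcomeKernel PA ω d a := by
  funext a
  have hm : Measurable (Function.uncurry fun (a : A) θ => ENNReal.ofReal (PA.p (ω, d, a) θ)) :=
    PA.measurable_ofReal.comp
      (by fun_prop : Measurable fun r : A × Θ => ((ω, d, r.1), r.2))
  rw [attackerOutcomeKernel_eq, Kernel.lintegral_withDensity _ hm _ (by fun_prop),
    attackerExpectedUtility, Kernel.const_apply]
  refine lintegral_congr fun θ => ?_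
  rw [ENNReal.ofReal_mul' (PA.nonneg _ _), mul_comm]

/-- Presents the outer loop as an APS sampler with y = (a, θ); the attack enters only through its
law, so no density of q is needed. -/
lemma compProd_kernel_eq (pD : CondDensity (D × A) νΘ) (q : Kernel D A) [IsMarkovKernel q] :
    q ⊗ₖ pD.kernel =
      (q ×ₖ Kernel.const D νΘ).withDensity fun d y => ENNReal.ofReal (pD.p (d, y.1) y.2) := by
  have hm : Measurable (Function.uncurry fun d (y : A × Θ) =>
      ENNReal.ofReal (pD.p (d, y.1) y.2)) :=
    pD.measurable_ofReal.comp
      (by fun_prop : Measurable fun r : D × A × Θ => ((r.1, r.2.1), r.2.2))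
  ext1 d
  refine Measure.ext fun C hC => ?_
  have hmd : Measurable fun y : A × Θ => ENNReal.ofReal (pD.p (d, y.1) y.2) :=
    hm.comp measurable_prodMk_left
  rw [Kernel.withDensity_apply' _ hm, ← lintegral_indicator hC, Kernel.prod_apply,
    Kernel.const_apply, lintegral_prod _ (hmd.indicator hC).aemeasurable,
    Kernel.compProd_apply hC]
  refine lintegral_congr fun a => ?_
  rw [CondDensity.kernel_apply, withDensity_apply _ (hC.preimage measurable_prodMk_left),
    ← lintegral_indicator (hC.preimage measurable_prodMk_left)]
  rfl

lemma defenderTarget_eq {νD : Measure D} [SFinite νD] {uD : D × Θ → ℝ} (huD : Measurable uD)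
    (pD : CondDensity (D × A) νΘ) (q : Kernel D A) [IsMarkovKernel q] :
    defenderTarget νD uD pD q =
      normalized (apsTarget νD (q ⊗ₖ pD.kernel) fun s => uD (s.1, s.2.2)) := by
  have hm : Measurable (Function.uncurry fun d (y : A × Θ) =>
      ENNReal.ofReal (pD.p (d, y.1) y.2)) :=
    pD.measurable_ofReal.comp
      (by fun_prop : Measurable fun r : D × A × Θ => ((r.1, r.2.1), r.2.2))
  rw [apsTarget, ← withDensity_mul_compProd hm (compProd_kernel_eq pD q) (by fun_prop),
    defenderTarget, tripleMeasure]
  congr 2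
  funext s
  exact ENNReal.ofReal_mul' (pD.nonneg _ _)

lemma apsTarget_compProd_kernel_univ_ne_top {νD : Measure D} [SFinite νD] {uD : D × Θ → ℝ}
    (huD : Measurable uD) (pD : CondDensity (D × A) νΘ) (q : Kernel D A) [IsMarkovKernel q]
    (hint : Integrable (fun s : D × A × Θ => uD (s.1, s.2.2) * pD.p (s.1, s.2.1) s.2.2)
      (tripleMeasure νD νΘ q)) :
    apsTarget νD (q ⊗ₖ pD.kernel) (fun s => uD (s.1, s.2.2)) Set.univ ≠ ∞ := by
  have hm : Measurable (Function.uncurry fun d (y : A × Θ) =>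
      ENNReal.ofReal (pD.p (d, y.1) y.2)) :=
    pD.measurable_ofReal.comp
      (by fun_prop : Measurable fun r : D × A × Θ => ((r.1, r.2.1), r.2.2))
  rw [apsTarget, ← withDensity_mul_compProd hm (compProd_kernel_eq pD q) (by fun_prop),
    withDensity_apply _ .univ, Measure.restrict_univ]
  refine ne_of_lt (lt_of_eq_of_lt ?_ hint.lintegral_lt_top)
  exact lintegral_congr fun s => (ENNReal.ofReal_mul' (pD.nonneg _ _)).symm

lemma defenderExpectedUtility_eq {uD : D × Θ → ℝ} (huD : Measurable uD)
    (pD : CondDensity (D × A) νΘ) (q : Kernel D A) [IsMarkovKernel q] :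
    defenderExpectedUtility uD pD q =
      fun d => ∫⁻ y, ENNReal.ofReal (uD (d, y.2)) ∂(q ⊗ₖ pD.kernel) d := by
  funext d
  rw [Kernel.lintegral_compProd _ _ _ (by fun_prop), defenderExpectedUtility]
  refine lintegral_congr fun a => ?_
  have hp : Measurable fun θ => ENNReal.ofReal (pD.p (d, a) θ) :=
    pD.measurable_ofReal.comp measurable_prodMk_left
  rw [CondDensity.kernel_apply, lintegral_withDensity_eq_lintegral_mul _ hp (by fun_prop)]
  refine lintegral_congr fun θ => ?_
  rw [ENNReal.ofReal_mul' (pD.nonneg _ _), mul_comm]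
  rfl

end Targets

/-! ### Stationarity of both loops and shrinking bandwidths. -/

section Samplers

variable {D A Θ Ω : Type*} [MeasurableSpace D] [MeasurableSpace A] [MeasurableSpace Θ]
  [MeasurableSpace Ω]

theorem isProbabilityMeasure_attackerTarget_and_invariant {νA : Measure A} {νΘ : Measure Θ}
    [SFinite νA] [SFinite νΘ] (hνA : νA ≠ 0) (gA : CondDensity A νA) (hgA : gA.IsSymmetric)
    (PA : CondDensity (Ω × D × A) νΘ) (UA : Ω → A × Θ → ℝ)
    (hUA : Measurable (Function.uncurry UA)) {ω : Ω} {d : D} (hpos : ∀ a θ, 0 < UA ω (a, θ))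
    (hint : Integrable (fun s : A × Θ => UA ω (s.1, s.2) * PA.p (ω, d, s.1) s.2) (νA.prod νΘ)) :
    IsProbabilityMeasure
        (attackerTarget νA νΘ (fun a θ => UA ω (a, θ)) (fun a => PA.p (ω, d, a))) ∧
      (innerKernel gA PA UA hUA ω d).Invariant
        (attackerTarget νA νΘ (fun a θ => UA ω (a, θ)) (fun a => PA.p (ω, d, a))) := by
  have hu : Measurable (UA ω) := hUA.comp measurable_prodMk_left
  have hpos' : ∀ s, 0 < UA ω s := fun s => hpos s.1 s.2
  rw [attackerTarget_eq PA ω d hu]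
  exact ⟨isProbabilityMeasure_normalized (apsTarget_ne_zero _ hu hνA hpos')
      (apsTarget_attackerOutcomeKernel_univ_ne_top PA ω d hu hint),
    invariant_apsKernel gA (attackerOutcomeKernel PA ω d) hu hgA hpos'⟩

theorem isProbabilityMeasure_defenderTarget_and_invariant {νD : Measure D} {νΘ : Measure Θ}
    [SFinite νD] [SFinite νΘ] (hνD : νD ≠ 0) (gD : CondDensity D νD) (hgD : gD.IsSymmetric)
    (pD : CondDensity (D × A) νΘ) (uD : D × Θ → ℝ) (huD : Measurable uD)
    (q : Kernel D A) [IsMarkovKernel q] (hpos : ∀ d θ, 0 < uD (d, θ))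
    (hint : Integrable (fun s : D × A × Θ => uD (s.1, s.2.2) * pD.p (s.1, s.2.1) s.2.2)
      (tripleMeasure νD νΘ q)) :
    IsProbabilityMeasure (defenderTarget νD uD pD q) ∧
      (outerKernel gD pD uD huD q).Invariant (defenderTarget νD uD pD q) := by
  have hu : Measurable fun s : D × A × Θ => uD (s.1, s.2.2) := huD.comp (by fun_prop)
  have hpos' : ∀ s : D × A × Θ, 0 < uD (s.1, s.2.2) := fun s => hpos _ _
  rw [defenderTarget_eq huD pD q]
  exact ⟨isProbabilityMeasure_normalized (apsTarget_ne_zero _ hu hνD hpos')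
      (apsTarget_compProd_kernel_univ_ne_top huD pD q hint),
    invariant_apsKernel gD (q ⊗ₖ pD.kernel) hu hgD hpos'⟩

/-- If the sample mode is consistent for every small bandwidth, the bandwidths can be chosen to
converge to zero along the run. -/
lemma exists_bandwidth_ae_tendsto {Z S : Type*} [MeasurableSpace Z] [MetricSpace S]
    [SecondCountableTopology S] [MeasurableSpace S] [BorelSpace S] (μ : Measure Z)
    [IsFiniteMeasure μ] (mode : ℝ → ℕ → Z → S) (hmode : ∀ h N, Measurable (mode h N))
    {target : Z → S} (htarget : Measurable target)
    (H : ∀ ε > 0, ∀ᵐ z ∂μ, ∃ k₀ : ℕ, ∀ k ≥ k₀, ∀ᶠ N in atTop,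
      dist (mode (1 / ((k : ℝ) + 1)) N z) (target z) < ε) :
    ∃ h : ℕ → ℝ, (∀ N, 0 < h N) ∧ Tendsto h atTop (𝓝 0) ∧
      ∀ᵐ z ∂μ, Tendsto (fun N => mode (h N) N z) atTop (𝓝 (target z)) := by
  obtain ⟨φ, hφ, h⟩ := exists_diagonal_ae_tendsto μ
    (D := fun k N z => dist (mode (1 / ((k : ℝ) + 1)) N z) (target z))
    (fun k N => (hmode _ _).dist htarget) H
  refine ⟨fun N => 1 / ((φ N : ℝ) + 1), fun N => Nat.one_div_pos_of_nat,
    tendsto_one_div_add_atTop_nhds_zero_nat.comp hφ, ?_⟩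
  filter_upwards [h] with z hz
  exact Metric.tendsto_nhds.2 hz

end Samplers

/-! ### Consistency of the inner sampler. -/

section Consistency

variable {D A Θ Ω : Type*} [MeasurableSpace D] [MetricSpace A] [MeasurableSpace A] [BorelSpace A]
  [MeasurableSpace Θ] [MeasurableSpace Ω]

theorem exists_forall_ae_dist_sampleMode_innerRun_lt {νA : Measure A} [IsDiscreteOrInterval νA]
    {νΘ : Measure Θ} [SFinite νΘ] (gA : CondDensity A νA) (hgA : gA.IsSymmetric)
    (hirr : Kernel.IsIrreducible νA gA.kernel) (PA : CondDensity (Ω × D × A) νΘ)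
    (UA : Ω → A × Θ → ℝ) (hUA : Measurable (Function.uncurry UA)) {ω : Ω} {d : D}
    (hpos : ∀ a θ, 0 < UA ω (a, θ))
    (hint : Integrable (fun s : A × Θ => UA ω (s.1, s.2) * PA.p (ω, d, s.1) s.2) (νA.prod νΘ))
    {x : A} (hx : IsWellSeparatedArgmax
      (attackerExpectedUtility νΘ (fun a θ => UA ω (a, θ)) (fun a => PA.p (ω, d, a))) x)
    {ε : ℝ} (hε : 0 < ε) :
    ∃ h₀ > 0, ∀ h, 0 < h → h < h₀ → ∀ (a₀ : A) (K : ℕ),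
      ∀ᵐ z ∂(innerRun gA PA UA hUA ω d a₀), ∀ᶠ M in atTop,
        dist (sampleMode νA h K M fun i => (z i).1) x < ε := by
  have hu : Measurable (UA ω) := hUA.comp measurable_prodMk_left
  rw [attackerExpectedUtility_eq PA ω d hu] at hx
  exact exists_forall_ae_dist_sampleMode_apsRun_lt gA hgA hirr (attackerOutcomeKernel PA ω d) hu
    (fun s => hpos s.1 s.2) (apsTarget_attackerOutcomeKernel_univ_ne_top PA ω d hu hint) hx hε

/-- With bandwidths that decrease slowly enough, the attack returned by the inner sampler converges
in law to the random optimal attack. -/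
theorem exists_bandwidth_tendsto_sampleAttack {νA : Measure A} [SFinite νA]
    [SecondCountableTopology A] {νΘ : Measure Θ} [SFinite νΘ] (P : Measure Ω)
    [IsProbabilityMeasure P] (gA : CondDensity A νA) (PA : CondDensity (Ω × D × A) νΘ)
    (UA : Ω → A × Θ → ℝ) (hUA : Measurable (Function.uncurry UA)) {d : D} {x : Ω → A}
    (hx : Measurable x) (a₀ : A) (K : ℕ)
    (H : ∀ᵐ ω ∂P, ∀ ε > 0, ∃ h₀ > 0, ∀ h, 0 < h → h < h₀ →
      ∀ᵐ z ∂(innerRun gA PA UA hUA ω d a₀), ∀ᶠ M in atTop,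
        dist (sampleMode νA h K M fun i => (z i).1) (x ω) < ε) :
    ∃ h : ℕ → ℝ, (∀ M, 0 < h M) ∧ Tendsto h atTop (𝓝 0) ∧
      (∀ M, IsProbabilityMeasure (sampleAttack P gA PA UA hUA d a₀ (h M) K M)) ∧
      ∀ f : A →ᵇ ℝ,
        Tendsto (fun M => ∫ a, f a ∂(sampleAttack P gA PA UA hUA d a₀ (h M) K M)) atTop
          (𝓝 (∫ a, f a ∂(P.map x))) := by
  let mode : ℝ → ℕ → Ω × (ℕ → A × Θ) → A := fun h M q => sampleMode νA h K M fun i => (q.2 i).1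
  have hmode : ∀ h M, Measurable (mode h M) := fun h M =>
    (measurable_sampleMode_fst h K M).comp measurable_snd
  have hx' : Measurable fun q : Ω × (ℕ → A × Θ) => x q.1 := hx.comp measurable_fst
  obtain ⟨h, h0, hlim, hae⟩ := exists_bandwidth_ae_tendsto (innerJoint P gA PA UA hUA d a₀) mode
    hmode hx' (fun ε hε => by
      have hms : MeasurableSet {q : Ω × (ℕ → A × Θ) | ∃ k₀ : ℕ, ∀ k ≥ k₀, ∀ᶠ N in atTop,
          dist (mode (1 / ((k : ℝ) + 1)) N q) (x q.1) < ε} := by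
        simp only [eventually_atTop, Set.ofPred_exists, Set.ofPred_forall]
        exact MeasurableSet.iUnion fun k₀ => MeasurableSet.iInter fun k => MeasurableSet.iInter
          fun _ => MeasurableSet.iUnion fun N₀ => MeasurableSet.iInter fun N =>
          MeasurableSet.iInter fun _ => measurableSet_lt ((hmode _ _).dist hx') measurable_const
      -- By Fubini it suffices to argue for almost every type. There h₀ may depend on ω, which is
      -- why the threshold k₀ is chosen pointwise.
      refine Measure.ae_compProd_of_ae_ae hms ?_
      filter_upwards [H] with ω hω
      obtain ⟨h₀, hh₀, hω⟩ := hω ε hε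
      obtain ⟨k₀, hk₀⟩ := exists_nat_one_div_lt hh₀
      have : ∀ᵐ z ∂(innerRun gA PA UA hUA ω d a₀), ∀ k : ℕ, k₀ ≤ k → ∀ᶠ M in atTop,
          dist (sampleMode νA (1 / ((k : ℝ) + 1)) K M fun i => (z i).1) (x ω) < ε := by
        refine ae_all_iff.2 fun k => ?_
        by_cases hk : k₀ ≤ k
        · filter_upwards [hω (1 / ((k : ℝ) + 1)) Nat.one_div_pos_of_nat
            (lt_of_le_of_lt (by gcongr) hk₀)] with z hz _ using hz
        · exact Eventually.of_forall fun z h => absurd h hk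
      filter_upwards [this] with z hz using ⟨k₀, hz⟩)
  refine ⟨h, h0, hlim, fun M => ?_, fun f => ?_⟩
  · rw [sampleAttack_eq_map]
    exact Measure.isProbabilityMeasure_map (hmode _ _).aemeasurable
  · have e1 : ∀ M, ∫ a, f a ∂(sampleAttack P gA PA UA hUA d a₀ (h M) K M) =
        ∫ q, f (mode (h M) M q) ∂(innerJoint P gA PA UA hUA d a₀) := by
      intro M
      rw [sampleAttack_eq_map, integral_map (hmode _ _).aemeasurable
        f.continuous.measurable.aestronglyMeasurable]
    have e2 : ∫ a, f a ∂(P.map x) = ∫ q, f (x q.1) ∂(innerJoint P gA PA UA hUA d a₀) := by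
      have hfst : (innerJoint P gA PA UA hUA d a₀).map Prod.fst = P := Measure.fst_compProd _ _
      conv_lhs => rw [← hfst, Measure.map_map hx measurable_fst]
      rw [integral_map (hx.comp measurable_fst).aemeasurable
        f.continuous.measurable.aestronglyMeasurable]
      rfl
    simp_rw [e1, e2]
    -- Almost sure convergence on the joint space gives convergence in law.
    refine tendsto_integral_of_dominated_convergence (fun _ => ‖f‖)
      (fun M => (f.continuous.measurable.comp (hmode _ _)).aestronglyMeasurable)
      (integrable_const _) (fun M => Eventually.of_forall fun q => f.norm_coe_le_norm _) ?_
    filter_upwards [hae] with q hq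
    exact (f.continuous.tendsto _).comp hq

end Consistency

/-! ### Consistency of the outer sampler. -/

section OuterConsistency

variable {D A Θ : Type*} [MetricSpace D] [MeasurableSpace D] [BorelSpace D] [MeasurableSpace A]
  [MeasurableSpace Θ]

theorem exists_forall_ae_dist_sampleMode_outerRun_lt {νD : Measure D} [IsDiscreteOrInterval νD]
    {νΘ : Measure Θ} [SFinite νΘ] (gD : CondDensity D νD) (hgD : gD.IsSymmetric)
    (hirr : Kernel.IsIrreducible νD gD.kernel) (pD : CondDensity (D × A) νΘ)
    (uD : D × Θ → ℝ) (huD : Measurable uD) (q : Kernel D A) [IsMarkovKernel q]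
    (hpos : ∀ d θ, 0 < uD (d, θ))
    (hint : Integrable (fun s : D × A × Θ => uD (s.1, s.2.2) * pD.p (s.1, s.2.1) s.2.2)
      (tripleMeasure νD νΘ q))
    {x : D} (hx : IsWellSeparatedArgmax (defenderExpectedUtility uD pD q) x)
    {ε : ℝ} (hε : 0 < ε) :
    ∃ h₀ > 0, ∀ h, 0 < h → h < h₀ → ∀ (d₀ : D) (R : ℕ),
      ∀ᵐ z ∂(outerRun gD pD uD huD q d₀), ∀ᶠ N in atTop,
        dist (sampleMode νD h R N fun i => (z i).1) x < ε := by
  have hu : Measurable fun s : D × A × Θ => uD (s.1, s.2.2) := huD.comp (by fun_prop)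
  rw [defenderExpectedUtility_eq huD pD q] at hx
  exact exists_forall_ae_dist_sampleMode_apsRun_lt gD hgD hirr (q ⊗ₖ pD.kernel) hu
    (fun s => hpos _ _) (apsTarget_compProd_kernel_univ_ne_top huD pD q hint) hx hε

theorem exists_bandwidth_tendsto_sampleMode_outerRun {νD : Measure D} [SFinite νD]
    [SecondCountableTopology D] {νΘ : Measure Θ} [SFinite νΘ] (gD : CondDensity D νD)
    (pD : CondDensity (D × A) νΘ) (uD : D × Θ → ℝ) (huD : Measurable uD) (q : Kernel D A)
    [IsMarkovKernel q] {x : D} (d₀ : D) (R : ℕ)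
    (H : ∀ ε > 0, ∃ h₀ > 0, ∀ h, 0 < h → h < h₀ →
      ∀ᵐ z ∂(outerRun gD pD uD huD q d₀), ∀ᶠ N in atTop,
        dist (sampleMode νD h R N fun i => (z i).1) x < ε) :
    ∃ h : ℕ → ℝ, (∀ N, 0 < h N) ∧ Tendsto h atTop (𝓝 0) ∧
      ∀ᵐ z ∂(outerRun gD pD uD huD q d₀),
        Tendsto (fun N => sampleMode νD (h N) R N fun i => (z i).1) atTop (𝓝 x) := by
  have : IsProbabilityMeasure (outerRun gD pD uD huD q d₀) := by
    unfold outerRun apsRun; infer_instance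
  refine exists_bandwidth_ae_tendsto (outerRun gD pD uD huD q d₀)
    (fun h N z => sampleMode νD h R N fun i => (z i).1)
    (fun h N => measurable_sampleMode_fst h R N) (measurable_const (a := x)) fun ε hε => ?_
  obtain ⟨h₀, hh₀, hω⟩ := H ε hε
  obtain ⟨k₀, hk₀⟩ := exists_nat_one_div_lt hh₀
  have : ∀ᵐ z ∂(outerRun gD pD uD huD q d₀), ∀ k : ℕ, k₀ ≤ k → ∀ᶠ M in atTop,
      dist (sampleMode νD (1 / ((k : ℝ) + 1)) R M fun i => (z i).1) x < ε := by
    refine ae_all_iff.2 fun k => ?_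
    by_cases hk : k₀ ≤ k
    · filter_upwards [hω (1 / ((k : ℝ) + 1)) Nat.one_div_pos_of_nat
        (lt_of_le_of_lt (by gcongr) hk₀)] with z hz _ using hz
    · exact Eventually.of_forall fun z h => absurd h hk
  filter_upwards [this] with z hz using ⟨k₀, hz⟩

end OuterConsistency

end

theorem proposition2 {D A Θ Ω : Type*}
    [MetricSpace D] [MeasurableSpace D] [BorelSpace D] [Nonempty D]
    [MetricSpace A] [MeasurableSpace A] [BorelSpace A]
    [MetricSpace Θ] [MeasurableSpace Θ] [BorelSpace Θ]
    [MeasurableSpace Ω]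
    -- the decision sets, the outcome set, and their reference measures
    (νD : Measure D) [IsDiscreteOrInterval νD]
    (νA : Measure A) [IsDiscreteOrInterval νA]
    (νΘ : Measure Θ) [IsDiscreteOrInterval νΘ]
    -- the space of types of the Attacker
    (P : Measure Ω) [IsProbabilityMeasure P]
    -- utility and probabilities of the Defender
    (uD : D × Θ → ℝ) (huD : Measurable uD) (pD : CondDensity (D × A) νΘ)
    -- random utility and random probabilities of the Attacker
    (UA : Ω → A × Θ → ℝ) (hUA : Measurable (Function.uncurry UA))
    (PA : CondDensity (Ω × D × A) νΘ)
    -- the random optimal attack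
    (Astar : D → Ω → A) (hA : Measurable (Function.uncurry Astar))
    (hAstar : ∀ d, ∀ᵐ ω ∂P, ∀ a,
      attackerExpectedUtility νΘ (fun a θ => UA ω (a, θ)) (fun a => PA.p (ω, d, a)) a ≤
        attackerExpectedUtility νΘ (fun a θ => UA ω (a, θ)) (fun a => PA.p (ω, d, a)) (Astar d ω))
    -- the symmetric proposals
    (gD : CondDensity D νD) (hgD : gD.IsSymmetric)
    (gA : CondDensity A νA) (hgA : gA.IsSymmetric)
    -- positivity
    (huD_pos : ∀ d θ, 0 < uD (d, θ)) (hUA_pos : ∀ᵐ ω ∂P, ∀ a θ, 0 < UA ω (a, θ))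
    (hpD_pos : ∀ d a θ, 0 < pD.p (d, a) θ) (hPA_pos : ∀ᵐ ω ∂P, ∀ d a θ, 0 < PA.p (ω, d, a) θ)
    -- integrability
    (hD_int : Integrable (fun s : D × A × Θ => uD (s.1, s.2.2) * pD.p (s.1, s.2.1) s.2.2)
      (tripleMeasure νD νΘ (attackDist P Astar hA)))
    (hA_int : ∀ d, ∀ᵐ ω ∂P, Integrable
      (fun s : A × Θ => UA ω (s.1, s.2) * PA.p (ω, d, s.1) s.2) (νA.prod νΘ)) :
    -- 1. the inner chain has the stationary distribution `π_A^ω(a, θ | d)`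
    (∀ d, ∀ᵐ ω ∂P,
      IsProbabilityMeasure
        (attackerTarget νA νΘ (fun a θ => UA ω (a, θ)) (fun a => PA.p (ω, d, a))) ∧
      (innerKernel gA PA UA hUA ω d).Invariant
        (attackerTarget νA νΘ (fun a θ => UA ω (a, θ)) (fun a => PA.p (ω, d, a)))) ∧
    -- 2. the outer chain has the stationary distribution `π_D(d, a, θ)`
    (IsProbabilityMeasure (defenderTarget νD uD pD (attackDist P Astar hA)) ∧
      (outerKernel gD pD uD huD (attackDist P Astar hA)).Invariant
        (defenderTarget νD uD pD (attackDist P Astar hA)) ∧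
      -- and so it does, with `p_D(a | d)` replaced by the law of the attack returned by the inner
      -- sampler, if the inner sampler is run with a finite number `M` of iterations
      (∀ (a₀ : A) (h : ℝ) (K M : ℕ), ∃ (q : Kernel D A) (_ : IsMarkovKernel q),
        (∀ d, q d = sampleAttack P gA PA UA hUA d a₀ h K M) ∧
        (Integrable (fun s : D × A × Θ => uD (s.1, s.2.2) * pD.p (s.1, s.2.1) s.2.2)
            (tripleMeasure νD νΘ q) →
          IsProbabilityMeasure (defenderTarget νD uD pD q) ∧
          (outerKernel gD pD uD huD q).Invariant (defenderTarget νD uD pD q)))) ∧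
    -- 3. the inner sampler returns attacks distributed as `p_D(a | d)`, as the run length grows
    (Kernel.IsIrreducible νA gA.kernel →
      ∀ d, (∀ᵐ ω ∂P, IsWellSeparatedArgmax
        (attackerExpectedUtility νΘ (fun a θ => UA ω (a, θ)) (fun a => PA.p (ω, d, a)))
        (Astar d ω)) →
      (∀ᵐ ω ∂P, ∀ ε > 0, ∃ h₀ > 0, ∀ h, 0 < h → h < h₀ → ∀ (a₀ : A) (K : ℕ),
        ∀ᵐ z ∂(innerRun gA PA UA hUA ω d a₀), ∀ᶠ M in atTop,
          dist (sampleMode νA h K M fun i => (z i).1) (Astar d ω) < ε) ∧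
      (∀ (a₀ : A) (K : ℕ), ∃ h : ℕ → ℝ, (∀ M, 0 < h M) ∧ Tendsto h atTop (𝓝 0) ∧
        (∀ M, IsProbabilityMeasure (sampleAttack P gA PA UA hUA d a₀ (h M) K M)) ∧
        ∀ f : A →ᵇ ℝ,
          Tendsto (fun M => ∫ a, f a ∂(sampleAttack P gA PA UA hUA d a₀ (h M) K M)) atTop
            (𝓝 (∫ a, f a ∂(attackDist P Astar hA d))))) ∧
    -- 4. the mode of the draws of `d` approximates the solution `d*_ARA`
    (Kernel.IsIrreducible νD gD.kernel →
      ∀ dstar, IsWellSeparatedArgmax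
        (defenderExpectedUtility uD pD (attackDist P Astar hA)) dstar →
      (∀ ε > 0, ∃ h₀ > 0, ∀ h, 0 < h → h < h₀ → ∀ (d₀ : D) (R : ℕ),
        ∀ᵐ z ∂(outerRun gD pD uD huD (attackDist P Astar hA) d₀), ∀ᶠ N in atTop,
          dist (sampleMode νD h R N fun i => (z i).1) dstar < ε) ∧
      (∀ (d₀ : D) (R : ℕ), ∃ h : ℕ → ℝ, (∀ N, 0 < h N) ∧ Tendsto h atTop (𝓝 0) ∧
        ∀ᵐ z ∂(outerRun gD pD uD huD (attackDist P Astar hA) d₀),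
          Tendsto (fun N => sampleMode νD (h N) R N fun i => (z i).1) atTop (𝓝 dstar))) := by
  have hA2 := IsDiscreteOrInterval.secondCountableTopology νA
  have hD2 := IsDiscreteOrInterval.secondCountableTopology νD
  refine ⟨fun d => ?_, ?_, fun hirr d hwell => ?_, fun hirr dstar hwell => ?_⟩
  · filter_upwards [hUA_pos, hA_int d] with ω hpos hint
    -- The optimal attack itself shows that A is nonempty, so its reference measure is not zero.
    have : Nonempty A := ⟨Astar d ω⟩
    exact isProbabilityMeasure_attackerTarget_and_invariant
      (IsDiscreteOrInterval.ne_zero νA) gA hgA PA UA hUA hpos hint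
  · have target (q : Kernel D A) [IsMarkovKernel q] :=
      isProbabilityMeasure_defenderTarget_and_invariant
        (IsDiscreteOrInterval.ne_zero νD) gD hgD pD uD huD q huD_pos
    refine ⟨(target _ hD_int).1, (target _ hD_int).2, fun a₀ h K M => ?_⟩
    obtain ⟨q, hq, hq_eq⟩ := exists_kernel_eq_sampleAttack P gA PA UA hUA a₀ h K M
    exact ⟨q, hq, hq_eq, target q⟩
  · have consistent : ∀ᵐ ω ∂P, ∀ ε > 0, ∃ h₀ > 0, ∀ h, 0 < h → h < h₀ → ∀ (a₀ : A) (K : ℕ),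
        ∀ᵐ z ∂(innerRun gA PA UA hUA ω d a₀), ∀ᶠ M in atTop,
          dist (sampleMode νA h K M fun i => (z i).1) (Astar d ω) < ε := by
      filter_upwards [hUA_pos, hA_int d, hwell] with ω hpos hint hx ε hε
      exact exists_forall_ae_dist_sampleMode_innerRun_lt gA hgA hirr PA UA hUA hpos hint hx hε
    refine ⟨consistent, fun a₀ K => ?_⟩
    refine exists_bandwidth_tendsto_sampleAttack P gA PA UA hUA
      (hA.comp measurable_prodMk_left : Measurable (Astar d)) a₀ K ?_
    filter_upwards [consistent] with ω hω ε hε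
    obtain ⟨h₀, hh₀, hω⟩ := hω ε hε
    exact ⟨h₀, hh₀, fun h h0 h1 => hω h h0 h1 a₀ K⟩
  · have consistent := fun ε (hε : (0 : ℝ) < ε) =>
      exists_forall_ae_dist_sampleMode_outerRun_lt gD hgD hirr pD uD huD (attackDist P Astar hA)
        huD_pos hD_int hwell hε
    refine ⟨consistent, fun d₀ R => ?_⟩
    refine exists_bandwidth_tendsto_sampleMode_outerRun gD pD uD huD _ d₀ R fun ε hε => ?_
    obtain ⟨h₀, hh₀, H⟩ := consistent ε hε
    exact ⟨h₀, hh₀, fun h h0 h1 => H h h0 h1 d₀ R⟩
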